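/- Let $N,p$ be integers with $0<p<N/2$ and $\gcd(N,p)=1$. Write $\mathbf e(z)=e^{2\pi i z}$ and $q^x=\mathbf e(x\tau)$ with $\operatorname{Im}\tau>0$. Let $T_{mn}$, $(m,n)\in\{0,\dots,N-1\}^2\setminus\{(0,0)\}$, be the basis of $\mathfrak{sl}(N,\mathbb C)$ with $(T_{mn})_{ij}=\mathbf e(\tfrac{mn}{2N})\,\mathbf e(\tfrac{im}{N})$ if $j-i\equiv n \pmod N$ and $(T_{mn})_{ij}=0$ otherwise, and let $s_{mn}$ be the corresponding coordinates. For arbitrary integers $a,b$ put $s_{ab}=\mathbf e\big(\tfrac{(a\bmod N)(b\bmod N)-ab}{2N}\big)s_{a\bmod N,\,b\bmod N}$, and $s_{ab}=0$ if $a\equiv b\equiv 0\pmod N$. **The elliptic top.** Its Poisson brackets are $\{s_{ab},s_{cd}\}=2i\sin\!\big(\tfrac{\pi}{N}(bc-ad)\big)\,s_{a+c,b+d}$. Its Hamiltonian is $H^{\rm rot}=-\tfrac12\operatorname{Tr}(S\,J(S))$, where $S=\sum s_{mn}T_{mn}$, $J(S)=\sum E_2\big(\tfrac{m+n\tau}{N}\big)s_{mn}T_{mn}$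 and $E_2(z)=\sum_{n\in\mathbb Z}\sum_{k\in\mathbb Z}(z+k+n\tau)^{-2}$. Its Lax matrix is $L(z)=\sum s_{mn}\,\mathbf e(-\tfrac{nz}{N})\,\phi\big(-\tfrac{m+n\tau}{N},z\big)T_{mn}$, where $\phi(u,z)=\frac{\vartheta(u+z)\vartheta'(0)}{\vartheta(u)\vartheta(z)}$ and $\vartheta(z)=\sum_{j\in\mathbb Z}q^{\frac12(j+\frac12)^2}\mathbf e\big((j+\tfrac12)(z+\tfrac12)\big)$. **The limit.** Substitute $s_{mn}=\tilde s_{mn}q^{-g(n)}$ and $z=\tilde z+\tau/2$, and let $\operatorname{Im}\tau\to+\infty$. Here $g$ is $N$-periodic, with $g(k)=\tfrac{k}{2N}$ for $0\le k\le p$, $g(k)=\tfrac{p}{2N}$ for $p<k<N-p$, and $g(k)=\tfrac{N-k}{2N}$ for $N-p\le k<N$. Then the following holds. 1. The brackets of the scaled coordinates converge to the brackets $\{\tilde s_{ab},\tilde s_{cd}\}=2i\sin\!\big(\tfrac{\pi}{N}(bc-ad)\big)\tilde s_{a+c,b+d}$ if $g(b)+g(d)=g(b+d)$, and $\{\tilde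 s_{ab},\tilde s_{cd}\}=0$ otherwise, and these define a Poisson structure on $\mathbb C^{N^2-1}$. The Lax matrix converges to $\tilde L(\tilde z)=\sum c_{mn}(\tilde z)\,\tilde s_{mn}T_{mn}$ with $c_{m0}=-\pi\,\mathbf e(\tfrac{m}{2N})/\sin(\tfrac{\pi m}{N})$, $c_{mn}=2\pi i\,\mathbf e(-\tfrac{n\tilde z}{N}+\tfrac mN)$ for $1\le n\le p$, $c_{mn}=-2\pi i\,\mathbf e(\tfrac{(N-n)\tilde z}{N})$ for $N-p\le n<N$, and $c_{mn}=0$ for the other $n$. 2. There are polynomials $H_{kj}$ in the $\tilde s_{mn}$ with $\operatorname{Tr}\tilde L(\tilde z)^k=\sum_{|j|\le\lfloor kp/N\rfloor}H_{kj}\,\mathbf e(j\tilde z)$ for all $k\ge0$ and $\tilde z\in\mathbb C$. The Hamiltonian $H^{\rm rot}$ converges to $\tilde H=\tfrac12H_{2,0}=\tfrac12\operatorname{Tr}\tilde L(\tilde z)^2$. All the coefficients $H_{kj}$, $|j|\le\lfloor kp/N\rfloor$, are in involution. 3. The limiting system is completely integrable in the Liouville sense. There are exactly $p(N-1)$ coefficients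 $H_{kj}$ with $2\le k\le N$, $|j|\le p$ and $k>\lceil |j|N/p\rceil$. They are integrals of motion of $\tilde H$ in involution, the generic symplectic leaf of the limiting Poisson structure has dimension $2p(N-1)$, and the restrictions of these $p(N-1)$ coefficients to a generic leaf are functionally independent (their Hamiltonian vector fields are linearly independent at a generic point). 4. Put $\tilde S_{ij}=\sum\tilde s_{mn}(T_{mn})_{ij}$. The subalgebra $\mathcal S_2$ generated by the $\tilde S_{ij}$ with $0\le(j-i)\bmod N\le p$ or $N-p\le(j-i)\bmod N<N$ is closed under the limiting Poisson bracket and contains all the $H_{kj}$ with $|j|\le\lfloor kp/N\rfloor$. The dimension of its generic symplectic leaf, which is the rank at a generic point of the matrix of brackets of these generators, is exactly $2p(N-1)$, and the $p(N-1)$ coefficients of part 3 are functionally independent on that leaf. ("Generic" means: at all points outside the zero set of some nonzero polynomial.) -/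

import Mathlib

open MvPolynomial Filter Topology

noncomputable section

/-! ### Polynomial Poisson structures on a coordinate space and Liouville integrability -/

section Poisson

variable {σ : Type*} [Fintype σ]

/-- The bracket `{f, g} = ∑ P_{xy} ∂_x f ∂_y g` given by a tensor `P_{xy} = {X_x, X_y}` with
polynomial entries on the space `σ → ℂ`. -/
def poissonBracket (P : σ → σ → MvPolynomial σ ℂ) (f g : MvPolynomial σ ℂ) :
    MvPolynomial σ ℂ :=
  ∑ x, ∑ y, P x y * pderiv x f * pderiv y g

/-- The bracket of `P` is a Poisson bracket: it is antisymmetric and satisfies the Jacobi identity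
(bilinearity and the Leibniz rule hold by construction). -/
def IsPoissonTensor (P : σ → σ → MvPolynomial σ ℂ) : Prop :=
  (∀ f g, poissonBracket P f g = -poissonBracket P g f) ∧
  ∀ f g h, poissonBracket P f (poissonBracket P g h) + poissonBracket P g (poissonBracket P h f)
    + poissonBracket P h (poissonBracket P f g) = 0

/-- `Q` holds at every point of a nonempty Zariski-open (hence open and dense) subset. -/
def Generically (Q : (σ → ℂ) → Prop) : Prop :=
  ∃ D : MvPolynomial σ ℂ, D ≠ 0 ∧ ∀ s, eval s D ≠ 0 → Q s

/-- The matrix `({f_a, f_b}(s))_{a,b}` of a finite family of functions at the point `s`. For the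
family of all coordinates this is the Poisson tensor at `s`, and its rank is the dimension of the
symplectic leaf through `s`. -/
def bracketMatrix {ι : Type*} (P : σ → σ → MvPolynomial σ ℂ) (f : ι → MvPolynomial σ ℂ)
    (s : σ → ℂ) : Matrix ι ι ℂ :=
  Matrix.of fun a b => eval s (poissonBracket P (f a) (f b))

/-- The components `{h, f_b}(s)` of the Hamiltonian vector field of `h` at the point `s`. -/
def hamiltonianVector {ι : Type*} (P : σ → σ → MvPolynomial σ ℂ) (f : ι → MvPolynomial σ ℂ)
    (h : MvPolynomial σ ℂ) (s : σ → ℂ) : ι → ℂ :=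
  fun b => eval s (poissonBracket P h (f b))

/-- The Hamiltonian system with Poisson tensor `P` and Hamiltonian `h` is completely integrable in
the Liouville sense by means of the family `F`: the members of `F` are integrals of motion in
involution, the generic symplectic leaf has dimension `2 * #F`, and the restrictions of the
members of `F` to the generic leaf have linearly independent differentials at a generic point. The
tangent space of the leaf is the image of the Poisson tensor, so the last condition says that the
Hamiltonian vector fields of the members of `F` are linearly independent. -/
def IsLiouvilleIntegrable {κ : Type*} [Fintype κ] (P : σ → σ → MvPolynomial σ ℂ)
    (h : MvPolynomial σ ℂ) (F : κ → MvPolynomial σ ℂ) : Prop :=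
  IsPoissonTensor P ∧
  (∀ a, poissonBracket P h (F a) = 0) ∧
  (∀ a b, poissonBracket P (F a) (F b) = 0) ∧
  Generically fun s : σ → ℂ =>
    (bracketMatrix P (X : σ → MvPolynomial σ ℂ) s).rank = 2 * Fintype.card κ ∧
    LinearIndependent ℂ fun a => hamiltonianVector P (X : σ → MvPolynomial σ ℂ) (F a) s

end Poisson

namespace EllipticTop

/-- `𝐞(z) = exp(2πiz)`. -/
def ex (z : ℂ) : ℂ := Complex.exp (2 * Real.pi * Complex.I * z)

/-! ### Elliptic functions; `q ^ x` is `ex (x * τ)` -/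

/-- The odd theta function. -/
def theta (z τ : ℂ) : ℂ :=
  ∑' j : ℤ, ex (((j : ℂ) + 1 / 2) ^ 2 * τ / 2) * ex (((j : ℂ) + 1 / 2) * (z + 1 / 2))

/-- `φ(u, z) = ϑ(u + z) ϑ'(0) / (ϑ(u) ϑ(z))`. -/
def phi (u z τ : ℂ) : ℂ :=
  theta (u + z) τ * deriv (fun v => theta v τ) 0 / (theta u τ * theta z τ)

/-- The second Eisenstein function `E₂(z) = ∑_n ∑_k (z + k + n τ)⁻²`. -/
def eisensteinE2 (z τ : ℂ) : ℂ :=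
  ∑' n : ℤ, ∑' k : ℤ, 1 / (z + k + n * τ) ^ 2

/-! ### The sin-algebra basis and the elliptic top

Residues modulo `N` are represented by `0, …, N - 1` through `ZMod.val`. The matrix index `N` of the
usual numbering `1, …, N` is the residue `0`. -/

variable (N : ℕ) [NeZero N]

/-- The labels `(m, n) ≠ (0, 0)` of the sin-algebra basis of `𝔰𝔩(N, ℂ)`. -/
abbrev Mode : Type := {x : ZMod N × ZMod N // x ≠ 0}

variable {N}

/-- The representative of `m` in `{0, …, N - 1}`. -/
def Mode.m (x : Mode N) : ℕ := x.1.1.val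

/-- The representative of `n` in `{0, …, N - 1}`. -/
def Mode.n (x : Mode N) : ℕ := x.1.2.val

variable (N)

/-- The sin-algebra matrix `(T_{mn})_{ij} = 𝐞(mn/2N) 𝐞(im/N) δ(j - i - n mod N)`. -/
def sinBasis (x : Mode N) : Matrix (ZMod N) (ZMod N) ℂ :=
  Matrix.of fun i j =>
    if j - i = x.1.2 then
      ex ((x.m : ℂ) * x.n / (2 * N)) * ex ((i.val : ℂ) * x.m / N)
    else 0

/-- The coordinate function `s_{ab}` for arbitrary integers `a, b`:
`s_{ab} = 𝐞(((a mod N)(b mod N) - ab) / 2N) s_{a mod N, b mod N}`, and `s_{00} = 0`. -/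
def coord (a b : ℤ) : MvPolynomial (Mode N) ℂ :=
  if h : ((a : ZMod N), (b : ZMod N)) ≠ 0 then
    C (ex ((((a % N) * (b % N) - a * b : ℤ) : ℂ) / (2 * N))) * X ⟨_, h⟩
  else 0

/-- The structure constant `2i sin(π (bc - ad) / N)`. -/
def sinConst (x y : Mode N) : ℂ :=
  2 * Complex.I *
    Complex.sin (Real.pi / N * ((x.n : ℂ) * (y.m : ℂ) - (x.m : ℂ) * (y.n : ℂ)))

/-- The Lie-Poisson tensor of the elliptic top,
`{s_{ab}, s_{cd}} = 2i sin(π (bc - ad) / N) s_{a+c, b+d}`. -/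
def topTensor (x y : Mode N) : MvPolynomial (Mode N) ℂ :=
  C (sinConst N x y) * coord N ((x.m : ℤ) + y.m) ((x.n : ℤ) + y.n)

/-- The Lax matrix `∑ s_{mn} φ_{mn}(z) T_{mn}`, `φ_{mn}(z) = 𝐞(-nz/N) φ(-(m + nτ)/N, z)`, of the
elliptic top at the point `s`. -/
def topLax (τ z : ℂ) (s : Mode N → ℂ) : Matrix (ZMod N) (ZMod N) ℂ :=
  ∑ x : Mode N, (s x * (ex (-((x.n : ℂ) * z / N)) * phi (-(((x.m : ℂ) + x.n * τ) / N)) z τ)) •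
    sinBasis N x

/-- The Hamiltonian `-½ Tr (S J(S))` of the elliptic top at the point `s`, where
`S = ∑ s_{mn} T_{mn}` and `J(S) = ∑ E₂((m + nτ)/N) s_{mn} T_{mn}`. -/
def topHamiltonian (τ : ℂ) (s : Mode N → ℂ) : ℂ :=
  -(1 / 2) * Matrix.trace ((∑ x : Mode N, s x • sinBasis N x) *
    ∑ x : Mode N, (eisensteinE2 (((x.m : ℂ) + x.n * τ) / N) τ * s x) • sinBasis N x)

/-! ### The scaling and the limiting system -/

variable (p : ℕ)

/-- The scaling exponent `g(n)`. -/
def scalingExp (n : ZMod N) : ℝ :=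
  if n.val ≤ p then (n.val : ℝ) / (2 * N)
  else if n.val < N - p then (p : ℝ) / (2 * N)
  else ((N : ℝ) - n.val) / (2 * N)

/-- The original coordinates `s_{mn} = s̃_{mn} q^{-g(n)}` of the point with scaled coordinates
`s̃`. -/
def unscale (τ : ℂ) (s : Mode N → ℂ) : Mode N → ℂ :=
  fun x => s x * ex (-(scalingExp N p x.1.2 : ℂ) * τ)

/-- The Poisson tensor of the elliptic top in the scaled coordinates at the point `s̃ = s`:
`{s̃_x, s̃_y} = q^{g(x)} q^{g(y)} {s_x, s_y}`, where `s̃_x = q^{g(x)} s_x`. -/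
def scaledTensor (τ : ℂ) (s : Mode N → ℂ) (x y : Mode N) : ℂ :=
  ex ((scalingExp N p x.1.2 : ℂ) * τ) * ex ((scalingExp N p y.1.2 : ℂ) * τ) *
    eval (unscale N p τ s) (topTensor N x y)

/-- The limiting Poisson tensor: the brackets with `g(b) + g(d) = g(b + d)` survive, all others
vanish. -/
def limitTensor (x y : Mode N) : MvPolynomial (Mode N) ℂ :=
  if scalingExp N p x.1.2 + scalingExp N p y.1.2 = scalingExp N p (x.1.2 + y.1.2) then
    topTensor N x y
  else 0

/-- The limiting coefficient of `s̃_{mn} T_{mn}` in the Lax matrix. The modes with `N - p ≤ n < N`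
are those with second label `-l`, `l = N - n`. -/
def limitLaxCoeff (z : ℂ) (x : Mode N) : ℂ :=
  if x.n = 0 then
    -(Real.pi * ex ((x.m : ℂ) / (2 * N)) / Complex.sin (Real.pi * x.m / N))
  else if x.n ≤ p then
    2 * Real.pi * Complex.I * ex (-((x.n : ℂ) * z / N) + (x.m : ℂ) / N)
  else if N - p ≤ x.n then
    -(2 * Real.pi * Complex.I * ex (((N : ℂ) - x.n) * z / N))
  else 0

/-- The limiting Lax matrix, whose entries are linear functions on the phase space. -/
def limitLax (z : ℂ) : Matrix (ZMod N) (ZMod N) (MvPolynomial (Mode N) ℂ) :=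
  Matrix.of fun i j => ∑ x : Mode N, C (limitLaxCoeff N p z x * sinBasis N x i j) * X x

/-- The coordinates in the standard basis, `S̃_{ij} = ∑ s̃_{mn} (T_{mn})_{ij}`. -/
def stdCoord (i j : ZMod N) : MvPolynomial (Mode N) ℂ :=
  ∑ x : Mode N, C (sinBasis N x i j) * X x

/-- The pairs `(i, j)` with `0 ≤ (j - i) mod N ≤ p` or `N - p ≤ (j - i) mod N < N`. -/
abbrev BandPair : Type :=
  {a : ZMod N × ZMod N // (a.2 - a.1).val ≤ p ∨ N - p ≤ (a.2 - a.1).val}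

/-- The generators `S̃_{ij}` of the subalgebra `𝒮₂`. -/
def bandCoord (a : BandPair N p) : MvPolynomial (Mode N) ℂ := stdCoord N a.1.1 a.1.2

/-- The subalgebra `𝒮₂`. -/
def bandAlgebra : Subalgebra ℂ (MvPolynomial (Mode N) ℂ) :=
  Algebra.adjoin ℂ (Set.range (bandCoord N p))

/-- The labels `(k, j)`, `2 ≤ k ≤ N`, `|j| ≤ p`, `⌈|j| N / p⌉ < k`. -/
def hamiltonianLabels (N p : ℕ) : Finset (ℕ × ℤ) :=
  (Finset.Icc 2 N ×ˢ Finset.Icc (-(p : ℤ)) p).filter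
    fun a => ⌈((a.2.natAbs : ℚ) * N) / p⌉₊ < a.1

end EllipticTop

end

open EllipticTop

/-!
The limit `Im τ → +∞` of the scaled elliptic top is computed term by term, and the limiting system is
then recognised as a truncated Lie-Poisson system with a banded Lax matrix.

**Limits.** The scaled Poisson tensor differs from its limit only by powers of `q` with non-negative
exponents `g(b) + g(d) - g(b + d)` (`scaledTensor_eq`). For the Lax matrix and the Hamiltonian, the
theta series and the series `E₂` are multiplied by the inverse of their leading power of `q` and the
limit is taken termwise by dominated convergence (`tendsto_theta`, `tendsto_eisensteinE2`).

**The Poisson structure.** A discrete Fourier transform turns the sin-algebra into `𝔤𝔩(N)`: the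
coordinates `s_{mn}` are the linear functions `Tr (A S)` of the matrices `A` dual to `T_{mn}`, and
the bracket of two linear functions is the one of a commutator. The limit keeps the commutator of
matrices supported on the diagonals `m` and `n` exactly when `g(m) + g(n) = g(m + n)`
(`poissonBracket_linForm`). As `g` is subadditive, an iterated bracket survives iff `g` is additive
on the three degrees, a condition symmetric in them, whence the Jacobi identity
(`isPoissonTensor_limitTensor`).

**The Lax matrix.** With `w = 𝐞(-z/N)`, the limiting Lax matrix is `M = ∑_{|n| ≤ p} w^n B_n`, where
`B_n` is supported on the `n`-th diagonal (`limitLax_eq_map`). A trace of such a graded matrix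
contains only powers of `λ = w^N`, and the degree of `M^k` is at most `k p`; this gives the expansion
of `Tr M^k` in `𝐞(jz)`, `|j| ≤ ⌊k p / N⌋` (`trace_limitLax_pow`). In terms of the entries of `M` the
bracket consists of two truncated algebras of shifts with opposite signs, coupled by the diagonal
(`bracket_laxCoord`). Hence the flow of `H_{kj}`, whose gradient `X = k λ^j M^{k-1}` commutes with
`M`, is given by a Lax equation (`lax_equation`) whose second member is the part of `X` in
non-positive degrees plus a diagonal matrix. Traces of powers of `M` are therefore preserved
(`involution`).

**Independence.** The Hamiltonian vector fields are compared at the point where `M` is a cyclic shift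
by `-p` plus a shift by `p` with one entry removed. There `e_0` is a cyclic vector, so the matrices
that commute with `M` are polynomials in `M` over `ℂ[λ, λ⁻¹]` (`exists_centralizer_expansion`), and,
since `N` and `p` are coprime, the terms `λ^j M^k`, `k < N`, have distinct extreme degrees
(`coeff_eq_zero_of_degree`). A vanishing combination of the vector fields gives a combination of
gradients that is a sum of two elements of the centralizer, one of non-positive and one of
non-negative degrees; no term `λ^j M^k` with `|j| N < p k` can occur in either, and these are all the
terms of the chosen coefficients (`eq_zero_of_sum_laxCoord_eq_zero`). Independence at one point
implies it wherever a suitable minor does not vanish (`exists_polynomial_linearIndependent`).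

**The rank.** An involutive family of `p (N - 1)` functions with independent Hamiltonian vectors
forces the rank of the Poisson tensor to be at least `2 p (N - 1)` (`two_mul_card_le_rank`). For the
upper bound, the rows of the tensor of shift `p` or more vanish on all non-zero shifts, and for
each remaining non-zero shift an explicit linear relation among the rows, the differential of a
Casimir function, removes one more row (`exists_chainForm_relation`, `rank_chainForm_le`).
-/

noncomputable section

set_option linter.unusedSectionVars false

/-! ### Brackets given by a tensor -/

section PoissonLemmas

variable {σ : Type*} [Fintype σ]

/-- The derivation `{f, ·}`. -/
def hamDerivation (P : σ → σ → MvPolynomial σ ℂ) (f : MvPolynomial σ ℂ) :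
    Derivation ℂ (MvPolynomial σ ℂ) (MvPolynomial σ ℂ) :=
  ∑ x, ∑ y, (P x y * pderiv x f) • pderiv y

/-- The derivation `{·, g}`. -/
def hamDerivationLeft (P : σ → σ → MvPolynomial σ ℂ) (g : MvPolynomial σ ℂ) :
    Derivation ℂ (MvPolynomial σ ℂ) (MvPolynomial σ ℂ) :=
  ∑ x, ∑ y, (P x y * pderiv y g) • pderiv x

lemma derivation_sum_apply {ι R A M : Type*} [CommSemiring R] [CommSemiring A] [AddCommMonoid M]
    [Algebra R A] [Module A M] [Module R M] (t : Finset ι) (D : ι → Derivation R A M) (a : A) :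
    (∑ i ∈ t, D i) a = ∑ i ∈ t, D i a := by
  have := congrFun (map_sum (Derivation.coeFnAddMonoidHom (R := R) (A := A) (M := M)) D t) a
  rw [Finset.sum_apply] at this
  exact this

lemma hamDerivation_apply (P : σ → σ → MvPolynomial σ ℂ) (f g : MvPolynomial σ ℂ) :
    hamDerivation P f g = poissonBracket P f g := by
  simp only [hamDerivation, poissonBracket, derivation_sum_apply,
    Derivation.coe_smul, Pi.smul_apply, smul_eq_mul]

lemma hamDerivationLeft_apply (P : σ → σ → MvPolynomial σ ℂ) (f g : MvPolynomial σ ℂ) :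
    hamDerivationLeft P g f = poissonBracket P f g := by
  simp only [hamDerivationLeft, poissonBracket, derivation_sum_apply,
    Derivation.coe_smul, Pi.smul_apply, smul_eq_mul]
  exact Finset.sum_congr rfl fun x _ => Finset.sum_congr rfl fun y _ => by ring

lemma poissonBracket_sum_right {ι : Type*} (P : σ → σ → MvPolynomial σ ℂ) (f : MvPolynomial σ ℂ)
    (t : Finset ι) (g : ι → MvPolynomial σ ℂ) :
    poissonBracket P f (∑ a ∈ t, g a) = ∑ a ∈ t, poissonBracket P f (g a) := by
  simp only [← hamDerivation_apply, map_sum]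

lemma poissonBracket_sum_left {ι : Type*} (P : σ → σ → MvPolynomial σ ℂ) (g : MvPolynomial σ ℂ)
    (t : Finset ι) (f : ι → MvPolynomial σ ℂ) :
    poissonBracket P (∑ a ∈ t, f a) g = ∑ a ∈ t, poissonBracket P (f a) g := by
  simp only [← hamDerivationLeft_apply, map_sum]

lemma poissonBracket_C_mul_right (P : σ → σ → MvPolynomial σ ℂ) (f g : MvPolynomial σ ℂ) (a : ℂ) :
    poissonBracket P f (C a * g) = C a * poissonBracket P f g := by
  rw [← smul_eq_C_mul, ← smul_eq_C_mul, ← hamDerivation_apply, ← hamDerivation_apply,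
    Derivation.map_smul]

lemma poissonBracket_C_mul_left (P : σ → σ → MvPolynomial σ ℂ) (f g : MvPolynomial σ ℂ) (a : ℂ) :
    poissonBracket P (C a * f) g = C a * poissonBracket P f g := by
  rw [← smul_eq_C_mul, ← smul_eq_C_mul, ← hamDerivationLeft_apply, ← hamDerivationLeft_apply,
    Derivation.map_smul]

lemma poissonBracket_X_right (P : σ → σ → MvPolynomial σ ℂ) (f : MvPolynomial σ ℂ) (y : σ) :
    poissonBracket P f (X y) = ∑ x, pderiv x f * P x y := by
  classical
  unfold poissonBracket
  refine Finset.sum_congr rfl fun x _ => ?_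
  rw [Finset.sum_eq_single y]
  · rw [pderiv_X_self, mul_one, mul_comm]
  · intro b _ hb
    rw [pderiv_X_of_ne hb.symm, mul_zero]
  · simp

lemma poissonBracket_X_X (P : σ → σ → MvPolynomial σ ℂ) (x y : σ) :
    poissonBracket P (X x) (X y) = P x y := by
  classical
  rw [poissonBracket_X_right, Finset.sum_eq_single x]
  · rw [pderiv_X_self, one_mul]
  · intro b _ hb
    rw [pderiv_X_of_ne hb.symm, zero_mul]
  · simp

lemma poissonBracket_antisymm {P : σ → σ → MvPolynomial σ ℂ} (hP : ∀ x y, P x y = -P y x)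
    (f g : MvPolynomial σ ℂ) : poissonBracket P f g = -poissonBracket P g f := by
  unfold poissonBracket
  rw [Finset.sum_comm, ← Finset.sum_neg_distrib]
  refine Finset.sum_congr rfl fun x _ => ?_
  rw [← Finset.sum_neg_distrib]
  refine Finset.sum_congr rfl fun y _ => ?_
  rw [hP y x]
  ring

/-- The Jacobiator of an antisymmetric bracket is a derivation in each argument, so it vanishes as
soon as it vanishes on coordinate functions. -/
lemma isPoissonTensor_of_X {P : σ → σ → MvPolynomial σ ℂ} (hP : ∀ x y, P x y = -P y x)
    (hJ : ∀ x y z, poissonBracket P (X x) (poissonBracket P (X y) (X z))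
      + poissonBracket P (X y) (poissonBracket P (X z) (X x))
      + poissonBracket P (X z) (poissonBracket P (X x) (X y)) = 0) : IsPoissonTensor P := by
  have anti := poissonBracket_antisymm hP
  have neg_r : ∀ f g, poissonBracket P f (-g) = -poissonBracket P f g := fun f g => by
    rw [← hamDerivation_apply, map_neg, hamDerivation_apply]
  -- `J f g` is the derivation `[D_f, D_g] - D_{f, g}`, where `D_f = {f, ·}`
  let J := fun f g h : MvPolynomial σ ℂ => poissonBracket P f (poissonBracket P g h)
    + poissonBracket P g (poissonBracket P h f) + poissonBracket P h (poissonBracket P f g)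
  have hD : ∀ f g h, J f g h =
      (⁅hamDerivation P f, hamDerivation P g⁆ - hamDerivation P (poissonBracket P f g)) h := by
    intro f g h
    simp only [J, Derivation.sub_apply, Derivation.commutator_apply, hamDerivation_apply]
    rw [anti h f, neg_r, anti h (poissonBracket P f g)]
    ring
  have key : ∀ f g, (∀ z, J f g (X z) = 0) → ∀ h, J f g h = 0 := by
    intro f g hz h
    rw [hD]
    have : ⁅hamDerivation P f, hamDerivation P g⁆ - hamDerivation P (poissonBracket P f g) = 0 := by
      apply MvPolynomial.derivation_ext
      intro z
      rw [← hD, hz]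
      rfl
    rw [this]
    rfl
  -- by cyclicity each of the three arguments is reduced to a coordinate
  have cyc : ∀ f g h, J f g h = J h f g := fun f g h => by simp only [J]; ring
  refine ⟨anti, ?_⟩
  intro f g h
  refine key f g (fun z => ?_) h
  rw [cyc]
  refine key (X z) f (fun y => ?_) g
  rw [cyc]
  refine key (X y) (X z) (fun x => ?_) f
  exact hJ y z x

end PoissonLemmas

namespace EllipticTop

/-! ### The exponential and characters of `ℤ/N` -/

lemma ex_add (z w : ℂ) : ex (z + w) = ex z * ex w := by
  rw [ex, ex, ex, ← Complex.exp_add, mul_add]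

lemma ex_zero : ex 0 = 1 := by simp [ex]

lemma ex_ne_zero (z : ℂ) : ex z ≠ 0 := Complex.exp_ne_zero _

lemma ex_neg (z : ℂ) : ex (-z) = (ex z)⁻¹ := by
  rw [ex, ex, ← Complex.exp_neg, mul_neg]

lemma ex_sub (z w : ℂ) : ex (z - w) = ex z / ex w := by
  rw [sub_eq_add_neg, ex_add, ex_neg, div_eq_mul_inv]

lemma two_I_sin (z : ℂ) : 2 * Complex.I * Complex.sin (Real.pi * z) = ex (z / 2) - ex (-(z / 2)) := by
  have := Complex.two_sin (Real.pi * z)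
  rw [mul_comm 2 Complex.I, mul_assoc, this, ex, ex]
  have h1 : 2 * (Real.pi : ℂ) * Complex.I * (z / 2) = Real.pi * z * Complex.I := by ring
  have h2 : 2 * (Real.pi : ℂ) * Complex.I * (-(z / 2)) = -(Real.pi * z) * Complex.I := by ring
  rw [h1, h2]
  linear_combination (Complex.exp (-(Real.pi * z) * Complex.I)
    - Complex.exp (Real.pi * z * Complex.I)) * Complex.I_sq

variable (N : ℕ) [NeZero N]

/-- The standard character `t ↦ 𝐞(t / N)` of `ℤ/N`. -/
abbrev chr : AddChar (ZMod N) ℂ := ZMod.stdAddChar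

lemma natCast_ne_zero' : (N : ℂ) ≠ 0 := Nat.cast_ne_zero.mpr (NeZero.ne N)

lemma chr_intCast (a : ℤ) : chr N (a : ZMod N) = ex ((a : ℂ) / N) := by
  rw [ZMod.stdAddChar_coe, ex, mul_div_assoc]

lemma chr_natCast (a : ℕ) : chr N (a : ZMod N) = ex ((a : ℂ) / N) := by
  have := chr_intCast N a
  rwa [Int.cast_natCast, Int.cast_natCast] at this

lemma chr_sum (t : ZMod N) : ∑ m : ZMod N, chr N (t * m) = if t = 0 then (N : ℂ) else 0 := by
  have := AddChar.sum_mulShift t (ZMod.isPrimitive_stdAddChar N)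
  simp_rw [mul_comm _ t] at this
  rw [this, ZMod.card]
  split_ifs <;> simp

lemma sum_mode {M : Type*} [AddCommGroup M] (f : ZMod N × ZMod N → M) :
    ∑ x : Mode N, f x.1 = ∑ x, f x - f 0 := by
  classical
  rw [eq_sub_iff_add_eq, ← Finset.sum_erase_add _ _ (Finset.mem_univ (0 : ZMod N × ZMod N))]
  congr 1
  symm
  apply Finset.sum_subtype
  simp

lemma mode_natCast_m (x : Mode N) : ((x.m : ℕ) : ZMod N) = x.1.1 := ZMod.natCast_zmod_val _

lemma mode_natCast_n (x : Mode N) : ((x.n : ℕ) : ZMod N) = x.1.2 := ZMod.natCast_zmod_val _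

lemma sinBasis_apply (x : Mode N) (i j : ZMod N) : sinBasis N x i j =
    if j - i = x.1.2 then ex ((x.m : ℂ) * x.n / (2 * N)) * chr N (i * x.1.1) else 0 := by
  rw [sinBasis, Matrix.of_apply]
  congr 2
  have := chr_natCast N (i.val * x.m)
  push_cast at this
  rw [ZMod.natCast_zmod_val, mode_natCast_m] at this
  exact this.symm

/-! ### The dual basis and linear functions -/

/-- The matrix `N⁻¹ T_{ab}⁻¹`, for arbitrary integers `a, b`. -/
def dualMatrix (a b : ℤ) : Matrix (ZMod N) (ZMod N) ℂ :=
  Matrix.of fun k l =>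
    if k - l = b then (N : ℂ)⁻¹ * ex (-((a : ℂ) * b / (2 * N))) * chr N (-(l * a)) else 0

/-- The basis of `𝔰𝔩(N, ℂ)` dual to the sin-algebra basis with respect to the trace form. -/
def dualBasis (x : Mode N) : Matrix (ZMod N) (ZMod N) ℂ := dualMatrix N x.m x.n

lemma dualBasis_apply (x : Mode N) (k l : ZMod N) : dualBasis N x k l =
    if k - l = x.1.2 then
      (N : ℂ)⁻¹ * ex (-((x.m : ℂ) * x.n / (2 * N))) * chr N (-(l * x.1.1)) else 0 := by
  rw [dualBasis, dualMatrix, Matrix.of_apply]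
  push_cast
  rw [mode_natCast_m, mode_natCast_n]

lemma sinBasis_mul_dualBasis (x : Mode N) (i j k l : ZMod N) :
    sinBasis N x i j * dualBasis N x k l =
      if j - i = x.1.2 then if k - l = x.1.2 then (N : ℂ)⁻¹ * chr N ((i - l) * x.1.1) else 0
      else 0 := by
  rw [sinBasis_apply, dualBasis_apply]
  split_ifs
  · rw [ex_neg, sub_mul, sub_eq_add_neg, AddChar.map_add_eq_mul]
    field_simp [ex_ne_zero]
  all_goals simp

/-- Completeness of the sin-algebra basis. -/
lemma sum_sinBasis_mul_dualBasis (i j k l : ZMod N) :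
    ∑ x : Mode N, sinBasis N x i j * dualBasis N x k l =
      (if i = l ∧ j = k then 1 else 0) - (if i = j ∧ k = l then (N : ℂ)⁻¹ else 0) := by
  simp_rw [sinBasis_mul_dualBasis]
  rw [sum_mode N fun y : ZMod N × ZMod N => if j - i = y.2 then if k - l = y.2 then
    (N : ℂ)⁻¹ * chr N ((i - l) * y.1) else 0 else 0, Fintype.sum_prod_type]
  congr 1
  · simp only [Finset.sum_ite_eq, Finset.mem_univ, if_true]
    by_cases h : k - l = j - i
    · simp only [h, if_true]
      rw [← Finset.mul_sum, chr_sum]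
      by_cases hil : i = l
      · have hjk : j = k := by rw [hil] at h; exact (sub_left_injective h).symm
        simp [hil, hjk, NeZero.ne N]
      · simp [hil, sub_ne_zero.mpr hil]
    · have : ¬ (i = l ∧ j = k) := by rintro ⟨rfl, rfl⟩; exact h rfl
      simp [h, this]
  · simp only [Prod.fst_zero, Prod.snd_zero, mul_zero, AddChar.map_zero_eq_one, mul_one, sub_eq_zero]
    by_cases h1 : j = i
    · simp [h1]
    · simp [h1, Ne.symm h1]

lemma trace_dualBasis_mul_sinBasis (x y : Mode N) :
    Matrix.trace (dualBasis N x * sinBasis N y) = if y = x then 1 else 0 := by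
  rw [Matrix.trace_mul_comm]
  simp only [Matrix.trace, Matrix.diag, Matrix.mul_apply]
  have h1 : ∀ i : ZMod N, ∑ j, sinBasis N y i j * dualBasis N x j i =
      if y.1.2 = x.1.2 then ex ((y.m : ℂ) * y.n / (2 * N)) *
        ((N : ℂ)⁻¹ * ex (-((x.m : ℂ) * x.n / (2 * N)))) * chr N ((y.1.1 - x.1.1) * i) else 0 := by
    intro i
    rw [Finset.sum_eq_single (i + y.1.2)]
    · rw [sinBasis_apply, dualBasis_apply]
      simp only [add_sub_cancel_left, if_true]
      split_ifs
      · rw [show (y.1.1 - x.1.1) * i = i * y.1.1 + -(i * x.1.1) by ring, AddChar.map_add_eq_mul]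
        ring
      · simp
    · intro b _ hb
      rw [sinBasis_apply, if_neg, zero_mul]
      intro h
      exact hb (by rw [← h]; ring)
    · simp
  simp_rw [h1]
  by_cases hn : y.1.2 = x.1.2
  · simp only [hn, if_true]
    rw [← Finset.mul_sum, chr_sum]
    by_cases hm : y.1.1 = x.1.1
    · have : y = x := Subtype.ext (Prod.ext hm hn)
      subst this
      simp only [sub_self, if_true]
      rw [ex_neg]
      have := natCast_ne_zero' N
      field_simp [ex_ne_zero]
    · have : y ≠ x := fun h => hm (by rw [h])
      simp [this, sub_ne_zero.mpr hm]
  · have : y ≠ x := fun h => hn (by rw [h])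
    simp [hn, this]

lemma trace_sinBasis (y : Mode N) : Matrix.trace (sinBasis N y) = 0 := by
  simp only [Matrix.trace, Matrix.diag, sinBasis_apply, sub_self]
  by_cases hn : y.1.2 = 0
  · have hm : y.1.1 ≠ 0 := fun h => y.2 (Prod.ext h hn)
    simp only [hn, if_true]
    rw [← Finset.mul_sum]
    simp_rw [mul_comm _ y.1.1]
    rw [chr_sum, if_neg hm, mul_zero]
  · simp [Ne.symm hn]

/-- The linear function `Tr (A S)` on the phase space, where `S = ∑ s_{mn} T_{mn}`. -/
def linForm : Matrix (ZMod N) (ZMod N) ℂ →ₗ[ℂ] MvPolynomial (Mode N) ℂ where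
  toFun A := ∑ x : Mode N, C (Matrix.trace (A * sinBasis N x)) * X x
  map_add' A B := by
    simp only [add_mul, Matrix.trace_add, map_add, add_mul, Finset.sum_add_distrib]
  map_smul' a A := by
    simp only [Matrix.smul_mul, Matrix.trace_smul, smul_eq_mul, map_mul, RingHom.id_apply,
      smul_eq_C_mul, Finset.mul_sum, mul_assoc]

lemma linForm_apply (A : Matrix (ZMod N) (ZMod N) ℂ) :
    linForm N A = ∑ x : Mode N, C (Matrix.trace (A * sinBasis N x)) * X x := rfl

lemma linForm_one : linForm N 1 = 0 := by
  rw [linForm_apply]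
  exact Finset.sum_eq_zero fun x _ => by rw [Matrix.one_mul, trace_sinBasis, C_0, zero_mul]

lemma linForm_dualBasis (x : Mode N) : linForm N (dualBasis N x) = X x := by
  classical
  rw [linForm_apply, Finset.sum_eq_single x]
  · rw [trace_dualBasis_mul_sinBasis, if_pos rfl, C_1, one_mul]
  · intro b _ hb
    rw [trace_dualBasis_mul_sinBasis, if_neg hb, C_0, zero_mul]
  · simp

lemma trace_mul_apply {n R : Type*} [Fintype n] [CommRing R] (A B : Matrix n n R) :
    Matrix.trace (A * B) = ∑ i, ∑ j, A i j * B j i := by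
  simp only [Matrix.trace, Matrix.diag, Matrix.mul_apply]

lemma stdCoord_eq (i j : ZMod N) : stdCoord N i j = linForm N (Matrix.single j i 1) := by
  classical
  rw [linForm_apply, stdCoord]
  refine Finset.sum_congr rfl fun x _ => ?_
  rw [Matrix.trace_single_mul, one_smul]

lemma linForm_eq_sum (A : Matrix (ZMod N) (ZMod N) ℂ) :
    linForm N A = ∑ i, ∑ j, C (A i j) * stdCoord N j i := by
  conv_lhs => rw [Matrix.matrix_eq_sum_single A]
  simp only [map_sum, stdCoord_eq]
  refine Finset.sum_congr rfl fun i _ => Finset.sum_congr rfl fun j _ => ?_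
  rw [← smul_eq_C_mul, ← map_smul, Matrix.smul_single, smul_eq_mul, mul_one]

/-- Every matrix is recovered, up to its trace, from its pairings with the sin-algebra basis. -/
lemma sum_trace_smul_dualBasis (A : Matrix (ZMod N) (ZMod N) ℂ) :
    ∑ x : Mode N, Matrix.trace (A * sinBasis N x) • dualBasis N x
      = A - (Matrix.trace A * (N : ℂ)⁻¹) • 1 := by
  ext k l
  rw [Matrix.sum_apply]
  simp only [Matrix.smul_apply, smul_eq_mul, trace_mul_apply, Finset.sum_mul, mul_assoc]
  rw [Finset.sum_comm]
  simp_rw [Finset.sum_comm (γ := Mode N), ← Finset.mul_sum, sum_sinBasis_mul_dualBasis]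
  simp only [mul_sub, Finset.sum_sub_distrib, Matrix.sub_apply, Matrix.smul_apply, smul_eq_mul]
  congr 1
  · rw [Finset.sum_eq_single k, Finset.sum_eq_single l]
    · simp
    · intro b _ hb; simp [hb]
    · simp
    · intro b _ hb; simp [hb]
    · simp
  · rw [Matrix.trace, Finset.sum_mul, Finset.sum_mul]
    refine Finset.sum_congr rfl fun i _ => ?_
    rw [Finset.sum_eq_single i]
    · by_cases h : k = l <;> simp [h, Matrix.one_apply]
    · intro b _ hb; simp [hb]
    · simp

/-- The other half of the duality: every traceless matrix is a value of `∑ s_{mn} T_{mn}`. -/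
lemma sum_dualBasis_smul_sinBasis (A : Matrix (ZMod N) (ZMod N) ℂ) :
    ∑ x : Mode N, Matrix.trace (A * dualBasis N x) • sinBasis N x
      = A - (Matrix.trace A * (N : ℂ)⁻¹) • 1 := by
  ext k l
  rw [Matrix.sum_apply]
  simp only [Matrix.smul_apply, smul_eq_mul, trace_mul_apply, Finset.sum_mul, mul_assoc]
  rw [Finset.sum_comm]
  simp_rw [Finset.sum_comm (γ := Mode N), ← Finset.mul_sum, mul_comm (dualBasis N _ _ _),
    sum_sinBasis_mul_dualBasis]
  simp only [mul_sub, Finset.sum_sub_distrib, Matrix.sub_apply, Matrix.smul_apply, smul_eq_mul]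
  congr 1
  · rw [Finset.sum_eq_single k, Finset.sum_eq_single l]
    · simp
    · intro b _ hb; simp [Ne.symm hb]
    · simp
    · intro b _ hb; simp [Ne.symm hb]
    · simp
  · rw [Matrix.trace, Finset.sum_mul, Finset.sum_mul]
    refine Finset.sum_congr rfl fun i _ => ?_
    rw [Finset.sum_eq_single i]
    · by_cases h : k = l <;> simp [h, Matrix.one_apply]
    · intro b _ hb; simp [hb]
    · simp

variable (N : ℕ) [NeZero N]

/-! ### The limiting Lie-Poisson bracket on linear functions -/

lemma dualMatrix_mul (a b c d : ℤ) : dualMatrix N a b * dualMatrix N c d =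
    ((N : ℂ)⁻¹ * ex (((b : ℂ) * c - a * d) / (2 * N))) • dualMatrix N (a + c) (b + d) := by
  have hN := natCast_ne_zero' N
  ext k r
  rw [Matrix.mul_apply, Finset.sum_eq_single (r + d)]
  · simp only [dualMatrix, Matrix.of_apply, Matrix.smul_apply, smul_eq_mul, add_sub_cancel_left,
      if_true]
    have hiff : k - (r + (d : ZMod N)) = b ↔ k - r = ((b + d : ℤ) : ZMod N) := by
      push_cast
      rw [sub_eq_iff_eq_add, sub_eq_iff_eq_add]
      constructor <;> (intro h; rw [h]; ring)
    simp only [hiff]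
    split_ifs
    · have h1 : chr N (-((r + d) * a)) * chr N (-(r * c)) =
          ex (-((a : ℂ) * d / N)) * chr N (-(r * ((a + c : ℤ) : ZMod N))) := by
        rw [← AddChar.map_add_eq_mul, show -((r + (d : ZMod N)) * a) + -(r * c) =
          ((-(a * d) : ℤ) : ZMod N) + -(r * ((a + c : ℤ) : ZMod N)) by push_cast; ring,
          AddChar.map_add_eq_mul, chr_intCast]
        congr 2
        push_cast
        ring
      have h2 : ex (-((a : ℂ) * b / (2 * N))) * ex (-((c : ℂ) * d / (2 * N))) * ex (-((a : ℂ) * d / N))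
          = ex (((b : ℂ) * c - a * d) / (2 * N)) *
            ex (-(((a + c : ℤ) : ℂ) * ((b + d : ℤ) : ℂ) / (2 * N))) := by
        rw [← ex_add, ← ex_add, ← ex_add]
        congr 1
        push_cast
        field_simp
        ring
      linear_combination ((N : ℂ)⁻¹ * (N : ℂ)⁻¹ * ex (-((a : ℂ) * b / (2 * N))) *
        ex (-((c : ℂ) * d / (2 * N)))) * h1 + ((N : ℂ)⁻¹ * (N : ℂ)⁻¹ *
          chr N (-(r * ((a + c : ℤ) : ZMod N)))) * h2
    · simp
  · intro l _ hl
    simp only [dualMatrix, Matrix.of_apply]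
    rw [if_neg (fun h : l - r = d => hl (by rw [← h]; ring)), mul_zero]
  · simp

/-- The extension of the coordinates to arbitrary integer labels agrees with the one of the matrices
`N⁻¹ T_{ab}⁻¹`; for `a ≡ b ≡ 0` the latter are scalar and `Tr S = 0`. -/
lemma coord_eq_linForm (a b : ℤ) : coord N a b = linForm N (dualMatrix N a b) := by
  have hN := natCast_ne_zero' N
  unfold coord
  split_ifs with h
  · set x : Mode N := ⟨((a : ZMod N), (b : ZMod N)), h⟩ with hx
    rw [← linForm_dualBasis, ← smul_eq_C_mul, ← map_smul]
    congr 1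
    have hm : ((x.m : ℕ) : ℤ) = a % N := ZMod.val_intCast a
    have hn : ((x.n : ℕ) : ℤ) = b % N := ZMod.val_intCast b
    rw [dualBasis, hm, hn]
    ext k l
    simp only [dualMatrix, Matrix.of_apply, Matrix.smul_apply, smul_eq_mul, ZMod.intCast_mod]
    split_ifs
    · rw [← mul_assoc, mul_left_comm, ← ex_add]
      congr 3
      push_cast
      ring
    · simp
  · have h' : ((a : ZMod N), (b : ZMod N)) = 0 := not_not.mp h
    have ha : (a : ZMod N) = 0 := congrArg Prod.fst h'
    have hb : (b : ZMod N) = 0 := congrArg Prod.snd h'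
    have : dualMatrix N a b =
        ((N : ℂ)⁻¹ * ex (-((a : ℂ) * b / (2 * N)))) • (1 : Matrix (ZMod N) (ZMod N) ℂ) := by
      ext k l
      simp only [dualMatrix, Matrix.of_apply, Matrix.smul_apply, smul_eq_mul, ha, hb, mul_zero,
        neg_zero, AddChar.map_zero_eq_one, mul_one, sub_eq_zero, Matrix.one_apply, mul_ite]
    rw [this, map_smul, linForm_one, smul_zero]

/-- The brackets of the elliptic top are the Lie-Poisson brackets of `𝔤𝔩(N)`. -/
lemma topTensor_eq (x y : Mode N) : topTensor N x y =
    C (N : ℂ) * linForm N (dualBasis N x * dualBasis N y - dualBasis N y * dualBasis N x) := by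
  have hN := natCast_ne_zero' N
  rw [topTensor, coord_eq_linForm, dualBasis, dualBasis, dualMatrix_mul, dualMatrix_mul,
    add_comm (y.m : ℤ), add_comm (y.n : ℤ), ← sub_smul, map_smul, smul_eq_C_mul, ← mul_assoc,
    ← C_mul]
  congr 2
  rw [sinConst, show (Real.pi : ℂ) / N * ((x.n : ℂ) * y.m - x.m * y.n) =
    Real.pi * (((x.n : ℂ) * y.m - x.m * y.n) / N) by ring, two_I_sin]
  push_cast
  rw [← mul_sub, ← mul_assoc, mul_inv_cancel₀ hN, one_mul]
  congr 2
  · field_simp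
  · field_simp
    ring

/-- `A` is supported on the positions `(i, j)` with `i - j = n`. -/
def IsHomog (n : ZMod N) (A : Matrix (ZMod N) (ZMod N) ℂ) : Prop :=
  ∀ i j, i - j ≠ n → A i j = 0

variable {N}

lemma IsHomog.trace_mul_sinBasis {n : ZMod N} {A : Matrix (ZMod N) (ZMod N) ℂ}
    (hA : IsHomog N n A) (x : Mode N) (hx : x.1.2 ≠ n) : Matrix.trace (A * sinBasis N x) = 0 := by
  rw [trace_mul_apply]
  refine Finset.sum_eq_zero fun i _ => Finset.sum_eq_zero fun j _ => ?_
  by_cases h : i - j = n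
  · rw [sinBasis_apply, if_neg (fun h' => hx (by rw [← h', h])), mul_zero]
  · rw [hA i j h, zero_mul]

lemma isHomog_single (i j : ZMod N) (a : ℂ) : IsHomog N (i - j) (Matrix.single i j a) := by
  intro k l h
  rw [Matrix.single_apply_of_ne]
  rintro ⟨rfl, rfl⟩
  exact h rfl

lemma isHomog_dualBasis (x : Mode N) : IsHomog N x.1.2 (dualBasis N x) := by
  intro k l h
  rw [dualBasis_apply, if_neg h]

lemma IsHomog.mul {m n : ZMod N} {A B : Matrix (ZMod N) (ZMod N) ℂ} (hA : IsHomog N m A)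
    (hB : IsHomog N n B) : IsHomog N (m + n) (A * B) := by
  intro i j h
  rw [Matrix.mul_apply]
  refine Finset.sum_eq_zero fun k _ => ?_
  by_cases hk : i - k = m
  · rw [hB k j, mul_zero]
    intro h'
    apply h
    rw [← hk, ← h']
    ring
  · rw [hA i k hk, zero_mul]

lemma IsHomog.sub {n : ZMod N} {A B : Matrix (ZMod N) (ZMod N) ℂ} (hA : IsHomog N n A)
    (hB : IsHomog N n B) : IsHomog N n (A - B) := by
  intro i j h
  rw [Matrix.sub_apply, hA i j h, hB i j h, sub_zero]

lemma IsHomog.commutator {m n : ZMod N} {A B : Matrix (ZMod N) (ZMod N) ℂ} (hA : IsHomog N m A)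
    (hB : IsHomog N n B) : IsHomog N (m + n) (A * B - B * A) :=
  (hA.mul hB).sub (by rw [add_comm]; exact hB.mul hA)

variable (N) (p : ℕ)

/-- The limiting bracket keeps the commutator of homogeneous matrices of degrees `m`, `n` exactly
when `g(m) + g(n) = g(m + n)`. -/
lemma poissonBracket_linForm {m n : ZMod N} {A B : Matrix (ZMod N) (ZMod N) ℂ}
    (hA : IsHomog N m A) (hB : IsHomog N n B) :
    poissonBracket (limitTensor N p) (linForm N A) (linForm N B) =
      if scalingExp N p m + scalingExp N p n = scalingExp N p (m + n) then
        C (N : ℂ) * linForm N (A * B - B * A) else 0 := by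
  have h1 : poissonBracket (limitTensor N p) (linForm N A) (linForm N B) =
      ∑ x : Mode N, ∑ y : Mode N, C (Matrix.trace (A * sinBasis N x)) *
        (C (Matrix.trace (B * sinBasis N y)) * limitTensor N p x y) := by
    rw [linForm_apply, poissonBracket_sum_left]
    refine Finset.sum_congr rfl fun x _ => ?_
    rw [poissonBracket_C_mul_left, linForm_apply, poissonBracket_sum_right, Finset.mul_sum]
    refine Finset.sum_congr rfl fun y _ => ?_
    rw [poissonBracket_C_mul_right, poissonBracket_X_X]
  have h2 : ∀ x y : Mode N, C (Matrix.trace (A * sinBasis N x)) *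
        (C (Matrix.trace (B * sinBasis N y)) * limitTensor N p x y) =
      if scalingExp N p m + scalingExp N p n = scalingExp N p (m + n) then
        C (Matrix.trace (A * sinBasis N x)) *
          (C (Matrix.trace (B * sinBasis N y)) * topTensor N x y) else 0 := by
    intro x y
    by_cases hx : x.1.2 = m
    · by_cases hy : y.1.2 = n
      · rw [limitTensor, hx, hy]
        split_ifs <;> simp
      · rw [hB.trace_mul_sinBasis y hy]; simp
    · rw [hA.trace_mul_sinBasis x hx]; simp
  rw [h1]
  simp_rw [h2]
  split_ifs
  · have h3 : ∀ x y : Mode N, C (Matrix.trace (A * sinBasis N x)) *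
          (C (Matrix.trace (B * sinBasis N y)) * topTensor N x y) =
        C (N : ℂ) * linForm N
          ((Matrix.trace (A * sinBasis N x) • dualBasis N x) *
            (Matrix.trace (B * sinBasis N y) • dualBasis N y) -
          (Matrix.trace (B * sinBasis N y) • dualBasis N y) *
            (Matrix.trace (A * sinBasis N x) • dualBasis N x)) := by
      intro x y
      rw [topTensor_eq]
      simp only [smul_mul_smul_comm]
      rw [mul_comm (Matrix.trace (B * _)), ← smul_sub, map_smul, smul_eq_C_mul, C_mul]
      ring
    simp_rw [h3, ← Finset.mul_sum, ← map_sum]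
    congr 2
    simp_rw [Finset.sum_sub_distrib, ← Finset.mul_sum, ← Finset.sum_mul, ← Finset.mul_sum,
      sum_trace_smul_dualBasis]
    simp only [sub_mul, mul_sub, smul_mul_assoc, mul_smul_comm, one_mul, mul_one, smul_sub]
    rw [smul_comm (Matrix.trace B * (N : ℂ)⁻¹)]
    abel
  · simp

lemma limitTensor_antisymm (x y : Mode N) : limitTensor N p x y = -limitTensor N p y x := by
  unfold limitTensor
  rw [add_comm (scalingExp N p y.1.2), add_comm y.1.2]
  split_ifs
  · rw [topTensor_eq, topTensor_eq, ← mul_neg, ← map_neg, neg_sub]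
  · simp

lemma poissonBracket_limit_antisymm (f g : MvPolynomial (Mode N) ℂ) :
    poissonBracket (limitTensor N p) f g = -poissonBracket (limitTensor N p) g f :=
  poissonBracket_antisymm (limitTensor_antisymm N p) f g

/-- The limiting brackets of the matrix entries `S̃_{ij}`. -/
lemma poissonBracket_stdCoord (i j k l : ZMod N) :
    poissonBracket (limitTensor N p) (stdCoord N i j) (stdCoord N k l) =
      if scalingExp N p (j - i) + scalingExp N p (l - k) = scalingExp N p (j - i + (l - k)) then
        C (N : ℂ) * ((if i = l then stdCoord N k j else 0) - if k = j then stdCoord N i l else 0)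
      else 0 := by
  rw [stdCoord_eq, stdCoord_eq, poissonBracket_linForm N p (isHomog_single j i 1)
    (isHomog_single l k 1)]
  congr 2
  rw [map_sub]
  congr 1
  · split_ifs with h
    · subst h
      rw [Matrix.single_mul_single_same, mul_one, stdCoord_eq]
    · rw [Matrix.single_mul_single_of_ne _ _ _ _ h, map_zero]
  · split_ifs with h
    · subst h
      rw [Matrix.single_mul_single_same, mul_one, stdCoord_eq]
    · rw [Matrix.single_mul_single_of_ne _ _ _ _ h, map_zero]

variable (N : ℕ) [NeZero N] (p : ℕ)

/-! ### The scaling exponent and the Jacobi identity -/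

/-- The integer `2 N g(n)`: the distance from `n` to `0` in `ℤ/N`, cut off at `p`. -/
def shiftLen (n : ZMod N) : ℕ := min (min n.val (N - n.val)) p

variable {N p}

/-- For `2p < N` the scaling exponent `g` is `1/(2N)` times the truncated distance from zero. -/
lemma scalingExp_eq (hpN : 2 * p < N) (n : ZMod N) :
    scalingExp N p n = (shiftLen N p n : ℝ) / (2 * N) := by
  have hn := ZMod.val_lt n
  unfold scalingExp shiftLen
  split_ifs with h1 h2
  · rw [min_eq_left, min_eq_left] <;> omega
  · rw [min_eq_right]
    omega
  · rw [min_eq_left, min_eq_right, Nat.cast_sub hn.le] <;> omega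

lemma scalingExp_add_eq_iff (hpN : 2 * p < N) (a b c : ZMod N) :
    scalingExp N p a + scalingExp N p b = scalingExp N p c ↔
      shiftLen N p a + shiftLen N p b = shiftLen N p c := by
  have hN : (2 * (N : ℝ)) ≠ 0 := by
    have := NeZero.ne N
    positivity
  rw [scalingExp_eq hpN, scalingExp_eq hpN, scalingExp_eq hpN, ← add_div, div_left_inj' hN]
  norm_cast

lemma shiftLen_add_le (a b : ZMod N) :
    shiftLen N p (a + b) ≤ shiftLen N p a + shiftLen N p b := by
  have ha := ZMod.val_lt a
  have hb := ZMod.val_lt b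
  unfold shiftLen
  rcases lt_or_ge (a.val + b.val) N with h | h
  · rw [ZMod.val_add_of_lt h]
    omega
  · have := ZMod.val_add_val_of_le h
    omega

lemma shiftLen_intCast {n : ℤ} (hn : n.natAbs < N) :
    shiftLen N p (n : ZMod N) = min (min n.natAbs (N - n.natAbs)) p := by
  have key : ∀ a : ℕ, a < N → shiftLen N p (a : ZMod N) = min (min a (N - a)) p := by
    intro a ha
    rw [shiftLen, ZMod.val_natCast_of_lt ha]
  rcases Int.natAbs_eq n with h | h
  · rw [h, Int.cast_natCast, key _ hn, Int.natAbs_natCast]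
  · rw [h, Int.cast_neg, Int.cast_natCast, Int.natAbs_neg, Int.natAbs_natCast]
    have h2 : shiftLen N p (-(n.natAbs : ZMod N)) = shiftLen N p (n.natAbs : ZMod N) := by
      unfold shiftLen
      rw [ZMod.neg_val]
      have := ZMod.val_lt (n.natAbs : ZMod N)
      split_ifs with h0
      · simp [h0]
      · omega
    rw [h2, key _ hn]

/-- Two consecutive brackets of homogeneous elements survive in the limit iff `g` is additive on
all three degrees, a condition symmetric in the degrees. -/
lemma shiftLen_add_three (a b c : ZMod N) :
    (shiftLen N p b + shiftLen N p c = shiftLen N p (b + c) ∧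
      shiftLen N p a + shiftLen N p (b + c) = shiftLen N p (a + (b + c))) ↔
    shiftLen N p a + shiftLen N p b + shiftLen N p c = shiftLen N p (a + b + c) := by
  have h1 := shiftLen_add_le (p := p) b c
  have h2 := shiftLen_add_le (p := p) a (b + c)
  rw [add_assoc a b c]
  omega

/-- The Jacobiator of homogeneous elements is either zero term by term or that of the full matrix
algebra. -/
lemma isPoissonTensor_limitTensor (hpN : 2 * p < N) : IsPoissonTensor (limitTensor N p) := by
  have key : ∀ x y z : Mode N, poissonBracket (limitTensor N p) (X x)
      (poissonBracket (limitTensor N p) (X y) (X z)) =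
      if shiftLen N p x.1.2 + shiftLen N p y.1.2 + shiftLen N p z.1.2 =
        shiftLen N p (x.1.2 + y.1.2 + z.1.2) then
      C (N : ℂ) * (C (N : ℂ) * linForm N (dualBasis N x * (dualBasis N y * dualBasis N z
        - dualBasis N z * dualBasis N y) - (dualBasis N y * dualBasis N z
        - dualBasis N z * dualBasis N y) * dualBasis N x)) else 0 := by
    intro x y z
    simp only [← shiftLen_add_three]
    rw [← linForm_dualBasis N x, ← linForm_dualBasis N y, ← linForm_dualBasis N z,
      poissonBracket_linForm N p (isHomog_dualBasis y) (isHomog_dualBasis z)]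
    simp only [scalingExp_add_eq_iff hpN]
    by_cases h1 : shiftLen N p y.1.2 + shiftLen N p z.1.2 = shiftLen N p (y.1.2 + z.1.2)
    · rw [if_pos h1, poissonBracket_C_mul_right, poissonBracket_linForm N p (isHomog_dualBasis x)
        ((isHomog_dualBasis y).commutator (isHomog_dualBasis z))]
      simp only [scalingExp_add_eq_iff hpN, h1, true_and]
      split_ifs <;> simp
    · rw [if_neg h1, if_neg (fun h => h1 h.1), ← hamDerivation_apply, map_zero]
  refine isPoissonTensor_of_X (limitTensor_antisymm N p) fun x y z => ?_
  rw [key x y z, key y z x, key z x y]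
  have e1 : shiftLen N p y.1.2 + shiftLen N p z.1.2 + shiftLen N p x.1.2 =
    shiftLen N p x.1.2 + shiftLen N p y.1.2 + shiftLen N p z.1.2 := by ring
  have e2 : shiftLen N p z.1.2 + shiftLen N p x.1.2 + shiftLen N p y.1.2 =
    shiftLen N p x.1.2 + shiftLen N p y.1.2 + shiftLen N p z.1.2 := by ring
  have e3 : y.1.2 + z.1.2 + x.1.2 = x.1.2 + y.1.2 + z.1.2 := by ring
  have e4 : z.1.2 + x.1.2 + y.1.2 = x.1.2 + y.1.2 + z.1.2 := by ring
  rw [e1, e2, e3, e4]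
  split_ifs
  · rw [← mul_add, ← mul_add, ← mul_add, ← mul_add, ← map_add, ← map_add]
    convert mul_zero _
    convert mul_zero _
    convert (linForm N).map_zero
    noncomm_ring
  · simp

/-- In the band `|n|, |n'| ≤ p` the bracket of opposite non-zero shifts vanishes, and the bracket of
shifts of the same sign survives iff the total shift stays in the band. -/
lemma scalingExp_add_of_pos (hpN : 2 * p < N) {n n' : ℤ} (h : (0 < n ∧ 0 < n') ∨ (n < 0 ∧ n' < 0))
    (hn : n.natAbs ≤ p) (hn' : n'.natAbs ≤ p) :
    scalingExp N p n + scalingExp N p n' = scalingExp N p ((n : ZMod N) + n') ↔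
      (n + n').natAbs ≤ p := by
  rw [scalingExp_add_eq_iff hpN, ← Int.cast_add, shiftLen_intCast (by omega),
    shiftLen_intCast (by omega), shiftLen_intCast (by omega)]
  omega

lemma scalingExp_add_of_neg (hpN : 2 * p < N) {n n' : ℤ} (h : (0 < n ∧ n' < 0) ∨ (n < 0 ∧ 0 < n'))
    (hn : n.natAbs ≤ p) (hn' : n'.natAbs ≤ p) :
    ¬ scalingExp N p n + scalingExp N p n' = scalingExp N p ((n : ZMod N) + n') := by
  rw [scalingExp_add_eq_iff hpN, ← Int.cast_add, shiftLen_intCast (by omega),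
    shiftLen_intCast (by omega), shiftLen_intCast (by omega)]
  omega

omit [NeZero N] in
lemma scalingExp_zero : scalingExp N p 0 = 0 := by
  simp [scalingExp]

/-! ### Banded matrices of Laurent polynomials -/

section Laurent

open AddMonoidAlgebra

variable {R : Type*} [CommRing R]

lemma matrix_laurent_ext {ι : Type*} {Y Z : Matrix ι ι (LaurentPolynomial R)}
    (h : ∀ i j n, (Y i j).coeff n = (Z i j).coeff n) : Y = Z := by
  ext i j n
  exact h i j n

lemma laurent_coeff_single (m n : ℤ) (r : R) :
    (single m r : LaurentPolynomial R).coeff n = if m = n then r else 0 := Finsupp.single_apply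

/-- The coefficientwise extension of a derivation to Laurent polynomials. -/
def Derivation.laurent {S : Type*} [CommRing S] [Algebra S R] (D : Derivation S R R) :
    Derivation S (LaurentPolynomial R) (LaurentPolynomial R) :=
  Derivation.mk'
    { toFun := fun f => ofCoeff (f.coeff.mapRange D (map_zero D))
      map_add' := fun f g => by ext n; simp
      map_smul' := fun a f => by ext n; simp }
    (by
      intro f g
      induction f using AddMonoidAlgebra.induction_linear with
      | zero => ext n; simp
      | add f₁ f₂ h₁ h₂ =>
        rw [add_mul, map_add, h₁, h₂, map_add, add_smul, smul_add]
        abel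
      | single m r =>
        induction g using AddMonoidAlgebra.induction_linear with
        | zero => ext n; simp
        | add g₁ g₂ h₁ h₂ =>
          rw [mul_add, map_add, h₁, h₂, map_add, add_smul, smul_add]
          abel
        | single m' r' =>
          ext n
          simp [AddMonoidAlgebra.single_mul_single, Finsupp.single_apply, add_comm m' m,
            -LaurentPolynomial.single_eq_C_mul_T]
          split_ifs <;> simp)

lemma Derivation.laurent_coeff {S : Type*} [CommRing S] [Algebra S R] (D : Derivation S R R)
    (f : LaurentPolynomial R) (n : ℤ) : (D.laurent f).coeff n = D (f.coeff n) := by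
  simp [Derivation.laurent]

lemma Derivation.map_matrix_mul {S A ι : Type*} [CommRing S] [CommRing A] [Algebra S A] [Fintype ι]
    (D : Derivation S A A) (Y Z : Matrix ι ι A) :
    (Y * Z).map D = Y.map D * Z + Y * Z.map D := by
  ext i j
  simp only [Matrix.map_apply, Matrix.mul_apply, Matrix.add_apply, map_sum, Derivation.leibniz,
    Finset.sum_add_distrib, smul_eq_mul]
  rw [add_comm]
  congr 1
  exact Finset.sum_congr rfl fun k _ => mul_comm _ _

lemma Derivation.map_trace {S A ι : Type*} [CommRing S] [CommRing A] [Algebra S A] [Fintype ι]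
    (D : Derivation S A A) (Y : Matrix ι ι A) : D (Matrix.trace Y) = Matrix.trace (Y.map D) := by
  simp [Matrix.trace]

/-- By cyclicity of the trace all factors of the power contribute equally. -/
lemma Derivation.trace_pow {S A ι : Type*} [CommRing S] [CommRing A] [Algebra S A] [Fintype ι]
    [DecidableEq ι] (D : Derivation S A A) (Y : Matrix ι ι A) (k : ℕ) :
    D (Matrix.trace (Y ^ k)) = k * Matrix.trace (Y ^ (k - 1) * Y.map D) := by
  rw [D.map_trace]
  have key : ∀ (k : ℕ) (Z : Matrix ι ι A), Commute Z Y →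
      Matrix.trace (Z * (Y ^ k).map D) = k * Matrix.trace (Z * Y ^ (k - 1) * Y.map D) := by
    intro k
    induction k with
    | zero =>
      intro Z _
      have : (1 : Matrix ι ι A).map D = 0 := by
        ext i j
        by_cases h : i = j <;> simp [h]
      simp [this]
    | succ k ih =>
      intro Z hZ
      have h1 : Matrix.trace (Z * ((Y ^ k).map D * Y)) = Matrix.trace ((Z * Y) * (Y ^ k).map D) := by
        rw [← mul_assoc, Matrix.trace_mul_comm, ← mul_assoc, hZ.eq]
      rw [pow_succ, D.map_matrix_mul, mul_add, Matrix.trace_add, h1,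
        ih (Z * Y) (hZ.mul_left (Commute.refl Y)), ← mul_assoc]
      rcases k with _ | k
      · simp
      · rw [Nat.add_sub_cancel, Nat.add_sub_cancel, mul_assoc Z Y, ← pow_succ']
        push_cast
        ring
  have := key k 1 (Commute.one_left Y)
  rwa [one_mul, one_mul] at this

end Laurent

open AddMonoidAlgebra

variable {N : ℕ} [NeZero N] (p : ℕ) {R : Type*} [CommRing R]

/-- The matrix `∑_{|m| ≤ p} w ^ m B_m`, where `B_m` has the entries `b_m(k)` at the positions
`(k, k + m)`, over the Laurent polynomials in the variable `w`. -/
def bandMatrix (b : ℤ → ZMod N → R) : Matrix (ZMod N) (ZMod N) (LaurentPolynomial R) :=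
  Matrix.of fun k l => ∑ m ∈ Finset.Icc (-(p : ℤ)) p,
    if l = k + m then (single m (b m k) : LaurentPolynomial R) else 0

/-- A matrix of Laurent polynomials is graded if `w ^ n` occurs only at the positions `(k, k + n)`.
-/
def IsGraded (Y : Matrix (ZMod N) (ZMod N) (LaurentPolynomial R)) : Prop :=
  ∀ (k l : ZMod N) (n : ℤ), l ≠ k + n → (Y k l).coeff n = 0

variable {p}

lemma coeff_bandMatrix (b : ℤ → ZMod N → R) (k l : ZMod N) (n : ℤ) :
    (bandMatrix p b k l).coeff n =
      if n ∈ Finset.Icc (-(p : ℤ)) p then if l = k + n then b n k else 0 else 0 := by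
  rw [bandMatrix, Matrix.of_apply, AddMonoidAlgebra.coeff_sum, Finset.sum_apply']
  have : ∀ m : ℤ, ((if l = k + m then (single m (b m k) : LaurentPolynomial R) else 0).coeff n) =
      if m = n then if l = k + m then b m k else 0 else 0 := by
    intro m
    split_ifs with h1 h2 h2 <;> simp [h2, -LaurentPolynomial.single_eq_C_mul_T]
  simp_rw [this]
  rw [Finset.sum_ite_eq']

lemma coeff_bandMatrix_mul (b : ℤ → ZMod N → R) (Y : Matrix (ZMod N) (ZMod N) (LaurentPolynomial R))
    (k l : ZMod N) (n : ℤ) : ((bandMatrix p b * Y) k l).coeff n =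
      ∑ m ∈ Finset.Icc (-(p : ℤ)) p, b m k * (Y (k + m) l).coeff (n - m) := by
  rw [Matrix.mul_apply]
  simp only [bandMatrix, Matrix.of_apply, Finset.sum_mul, ite_mul, zero_mul]
  rw [Finset.sum_comm, AddMonoidAlgebra.coeff_sum, Finset.sum_apply']
  refine Finset.sum_congr rfl fun m _ => ?_
  rw [Finset.sum_ite_eq' Finset.univ (k + (m : ZMod N)), if_pos (Finset.mem_univ _),
    coeff_single_mul_apply, neg_add_eq_sub]

lemma coeff_mul_bandMatrix (b : ℤ → ZMod N → R) (Y : Matrix (ZMod N) (ZMod N) (LaurentPolynomial R))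
    (k l : ZMod N) (n : ℤ) : ((Y * bandMatrix p b) k l).coeff n =
      ∑ m ∈ Finset.Icc (-(p : ℤ)) p, (Y k (l - m)).coeff (n - m) * b m (l - m) := by
  rw [Matrix.mul_apply]
  simp only [bandMatrix, Matrix.of_apply, Finset.mul_sum, mul_ite, mul_zero]
  rw [Finset.sum_comm, AddMonoidAlgebra.coeff_sum, Finset.sum_apply']
  refine Finset.sum_congr rfl fun m _ => ?_
  have : ∀ j : ZMod N, l = j + m ↔ j = l - m := fun j =>
    ⟨fun h => by rw [h]; ring, fun h => by rw [h]; ring⟩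
  simp_rw [this]
  rw [Finset.sum_ite_eq' Finset.univ (l - (m : ZMod N)), if_pos (Finset.mem_univ _),
    coeff_mul_single_apply, ← sub_eq_add_neg n]

lemma isGraded_bandMatrix (b : ℤ → ZMod N → R) : IsGraded (bandMatrix p b) := by
  intro k l n h
  rw [coeff_bandMatrix]
  simp [h]

lemma isGraded_one : IsGraded (1 : Matrix (ZMod N) (ZMod N) (LaurentPolynomial R)) := by
  intro k l n h
  rw [Matrix.one_apply]
  split_ifs with hkl
  · rw [AddMonoidAlgebra.one_def, laurent_coeff_single, if_neg]
    rintro rfl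
    simp [hkl] at h
  · simp

lemma isGraded_bandMatrix_pow (b : ℤ → ZMod N → R) (k : ℕ) : IsGraded (bandMatrix p b ^ k) := by
  induction k with
  | zero => rw [pow_zero]; exact isGraded_one
  | succ k ih =>
    intro i j n h
    rw [pow_succ', coeff_bandMatrix_mul]
    refine Finset.sum_eq_zero fun m _ => ?_
    rw [ih, mul_zero]
    intro h'
    apply h
    rw [h']
    push_cast
    ring

lemma coeff_single_smul (Y : Matrix (ZMod N) (ZMod N) (LaurentPolynomial R)) (m : ℤ) (r : R)
    (k l : ZMod N) (n : ℤ) :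
    (((single m r : LaurentPolynomial R) • Y) k l).coeff n = r * (Y k l).coeff (n - m) := by
  rw [Matrix.smul_apply, smul_eq_mul, coeff_single_mul_apply, neg_add_eq_sub]

lemma IsGraded.single_smul {Y : Matrix (ZMod N) (ZMod N) (LaurentPolynomial R)} (hY : IsGraded Y)
    (j : ℤ) (r : R) : IsGraded ((single (j * N) r : LaurentPolynomial R) • Y) := by
  intro k l n h
  rw [coeff_single_smul, hY, mul_zero]
  intro h'
  apply h
  rw [h']
  simp

/-- The `k`-th power of a banded matrix has degrees between `-k p` and `k p`. -/
lemma coeff_bandMatrix_pow_eq_zero (b : ℤ → ZMod N → R) (k : ℕ) (i l : ZMod N) (n : ℤ)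
    (h : k * p < n.natAbs) : ((bandMatrix p b ^ k) i l).coeff n = 0 := by
  induction k generalizing i n with
  | zero =>
    rw [pow_zero, Matrix.one_apply]
    split_ifs
    · rw [AddMonoidAlgebra.one_def, laurent_coeff_single, if_neg]
      rintro rfl
      simp at h
    · simp
  | succ k ih =>
    rw [pow_succ', coeff_bandMatrix_mul]
    refine Finset.sum_eq_zero fun m hm => ?_
    rw [Finset.mem_Icc] at hm
    rw [ih, mul_zero]
    rw [add_mul] at h
    omega

/-- The extreme coefficient of `w ^ (± k p)` in the `k`-th power of a banded matrix. -/
lemma coeff_bandMatrix_pow_extreme (b : ℤ → ZMod N → R) {ε : ℤ} (hε : ε = 1 ∨ ε = -1) (k : ℕ)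
    (i : ZMod N) : ((bandMatrix p b ^ k) i (i + (ε * (k * p) : ℤ))).coeff (ε * (k * p)) =
      ∏ t ∈ Finset.range k, b (ε * p) (i + (ε * (t * p) : ℤ)) := by
  induction k generalizing i with
  | zero => simp [AddMonoidAlgebra.one_def, -LaurentPolynomial.single_eq_C_mul_T]
  | succ k ih =>
    rw [pow_succ', coeff_bandMatrix_mul, Finset.sum_eq_single (ε * p), Finset.prod_range_succ']
    · rw [mul_comm]
      congr 1
      · have e1 : ε * (((k + 1 : ℕ) : ℤ) * p) - ε * p = ε * (k * p) := by push_cast; ring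
        have e2 : i + ((ε * (((k + 1 : ℕ) : ℤ) * p) : ℤ) : ZMod N) =
          (i + (ε * p : ℤ)) + (ε * (k * p) : ℤ) := by push_cast; ring
        rw [e1, e2, ih]
        refine Finset.prod_congr rfl fun t _ => ?_
        congr 1
        push_cast
        ring
      · simp
    · intro m hm hne
      rw [Finset.mem_Icc] at hm
      rw [coeff_bandMatrix_pow_eq_zero, mul_zero]
      rcases hε with rfl | rfl
      · push_cast
        rw [add_mul]
        zify
        rw [abs_of_nonneg] <;> nlinarith [lt_of_le_of_ne hm.2 (by simpa using hne), hm.1]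
      · push_cast
        have : -(p : ℤ) < m := lt_of_le_of_ne hm.1 (by simpa using Ne.symm hne)
        zify
        rw [abs_of_nonpos] <;> nlinarith
    · intro h
      rw [Finset.mem_Icc] at h
      rcases hε with rfl | rfl <;> omega

open AddMonoidAlgebra (single)

variable {N : ℕ} [NeZero N] {p : ℕ}

variable (N : ℕ) [NeZero N] (p : ℕ)

/-! ### The limiting Lax matrix as a banded matrix -/

/-- The constant `2πi`. -/
def twoPiI : ℂ := 2 * Real.pi * Complex.I

/-- The inverse Fourier transform of the coefficients of the modes `(m, 0)` in the limiting Lax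
matrix. -/
def kernelFn (t : ZMod N) : ℂ :=
  (N : ℂ)⁻¹ * ∑ m : ZMod N, if m = 0 then 0 else
    -(Real.pi * ex ((m.val : ℂ) / (2 * N)) / Complex.sin (Real.pi * m.val / N)) * chr N (t * m)

lemma sin_ne_zero_of_zmod {m : ZMod N} (hm : m ≠ 0) : Complex.sin (Real.pi * m.val / N) ≠ 0 := by
  have hN := natCast_ne_zero' N
  have hpi : (Real.pi : ℂ) ≠ 0 := by exact_mod_cast Real.pi_ne_zero
  rw [Complex.sin_ne_zero_iff]
  intro k hk
  have h1 : (m.val : ℂ) = k * N := by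
    field_simp at hk
    linear_combination hk
  have h2 : (m.val : ℤ) = k * N := by exact_mod_cast h1
  apply hm
  have h3 := congrArg (Int.cast : ℤ → ZMod N) h2
  rw [Int.cast_natCast, ZMod.natCast_zmod_val] at h3
  simpa using h3

/-- The discrete derivative of the kernel is a delta function, up to a constant. -/
lemma kernelFn_sub (t : ZMod N) : kernelFn N (t - 1) =
    kernelFn N t + twoPiI * ((if t = 0 then 1 else 0) - (N : ℂ)⁻¹) := by
  have hN := natCast_ne_zero' N
  have h : ∀ m : ZMod N, (if m = 0 then 0 else
      -(Real.pi * ex ((m.val : ℂ) / (2 * N)) / Complex.sin (Real.pi * m.val / N)) *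
        chr N ((t - 1) * m)) =
      (if m = 0 then 0 else
      -(Real.pi * ex ((m.val : ℂ) / (2 * N)) / Complex.sin (Real.pi * m.val / N)) * chr N (t * m))
      + twoPiI * (chr N (t * m) - if m = 0 then 1 else 0) := by
    intro m
    split_ifs with hm
    · simp [hm]
    · have hs := sin_ne_zero_of_zmod N hm
      have h1 : chr N (-m) = ex (-((m.val : ℂ) / N)) := by
        have := chr_intCast N (-(m.val : ℤ))
        push_cast at this
        rw [ZMod.natCast_zmod_val] at this
        rw [this, neg_div]
      have h2 := two_I_sin ((m.val : ℂ) / N)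
      rw [← mul_div_assoc] at h2
      have h3 : ex ((m.val : ℂ) / (2 * N)) * chr N (-m) = ex (-((m.val : ℂ) / N / 2)) := by
        rw [h1, ← ex_add]
        congr 1
        field_simp
        ring
      have h4 : ex ((m.val : ℂ) / N / 2) = ex ((m.val : ℂ) / (2 * N)) := by
        congr 1
        field_simp
      rw [h4, ← h3] at h2
      rw [show (t - 1) * m = t * m + -m by ring, AddChar.map_add_eq_mul, sub_zero, twoPiI]
      field_simp
      linear_combination (-chr N (t * m)) * h2
  rw [kernelFn, Finset.sum_congr rfl fun m _ => h m, Finset.sum_add_distrib, mul_add, kernelFn,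
    ← Finset.mul_sum, Finset.sum_sub_distrib, chr_sum]
  congr 1
  rw [Finset.sum_ite_eq' Finset.univ (0 : ZMod N), if_pos (Finset.mem_univ _)]
  split_ifs
  · field_simp
  · field_simp
    ring

/-- The kernel is inverse to the Fourier transform. -/
lemma sum_kernelFn (i m : ZMod N) (hm : m ≠ 0) : ∑ l, kernelFn N (i - l) * chr N (l * m) =
    -(Real.pi * ex ((m.val : ℂ) / (2 * N)) / Complex.sin (Real.pi * m.val / N)) * chr N (i * m) := by
  have hN := natCast_ne_zero' N
  simp only [kernelFn, mul_assoc, Finset.sum_mul, ite_mul, zero_mul]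
  rw [← Finset.mul_sum, Finset.sum_comm]
  have h : ∀ m' : ZMod N, (∑ l : ZMod N, if m' = 0 then (0 : ℂ) else
      -(Real.pi * ex ((m'.val : ℂ) / (2 * N)) / Complex.sin (Real.pi * m'.val / N)) *
        (chr N ((i - l) * m') * chr N (l * m))) = if m' = m then
      -(Real.pi * ex ((m.val : ℂ) / (2 * N)) / Complex.sin (Real.pi * m.val / N)) *
        chr N (i * m) * N else 0 := by
    intro m'
    by_cases h0 : m' = 0
    · rw [if_neg (by rw [h0]; exact Ne.symm hm)]
      simp [h0]
    · simp only [h0, if_false]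
      have : ∀ l : ZMod N, chr N ((i - l) * m') * chr N (l * m) =
          chr N (i * m') * chr N ((m - m') * l) := by
        intro l
        rw [← AddChar.map_add_eq_mul, ← AddChar.map_add_eq_mul]
        congr 1
        ring
      simp_rw [this, ← Finset.mul_sum]
      rw [chr_sum]
      simp only [sub_eq_zero, eq_comm (a := m)]
      split_ifs with h1
      · rw [h1]; ring
      · simp
  rw [Finset.sum_congr rfl fun m' _ => h m', Finset.sum_ite_eq' Finset.univ m,
    if_pos (Finset.mem_univ _)]
  field_simp

/-- The entries `b_n(i)`, at the positions `(i, i + n)`, of the shift-`n` part of the limiting Lax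
matrix without its spectral parameter: up to a constant, they are the coordinates `S̃` shifted
diagonally by one step above the diagonal, and unshifted below it. The diagonal part interpolates
between the two by inverting the difference operator of this shift. -/
def laxCoord (n : ℤ) (i : ZMod N) : MvPolynomial (Mode N) ℂ :=
  if n.natAbs ≤ p then
    if n = 0 then ∑ l, C (kernelFn N (i - l)) * stdCoord N l l
    else if 0 < n then C twoPiI * stdCoord N (i + 1) (i + n + 1)
    else -(C twoPiI * stdCoord N i (i + n))
  else 0

/-- The limiting Lax matrix with the spectral variable `w = 𝐞(-z/N)` as an indeterminate. -/
def laxMatrix : Matrix (ZMod N) (ZMod N) (LaurentPolynomial (MvPolynomial (Mode N) ℂ)) :=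
  bandMatrix p (laxCoord N p)

/-- The substitution `w = 𝐞(-z/N)`. -/
def specialize (z : ℂ) :
    LaurentPolynomial (MvPolynomial (Mode N) ℂ) →+* MvPolynomial (Mode N) ℂ :=
  LaurentPolynomial.eval₂ (RingHom.id _)
    (Units.map (C : ℂ →+* MvPolynomial (Mode N) ℂ).toMonoidHom
      (Units.mk0 (ex (-(z / N))) (ex_ne_zero _)))

lemma specialize_single (z : ℂ) (n : ℤ) (f : MvPolynomial (Mode N) ℂ) :
    specialize N z (single n f) = C (ex (-(n * z / N))) * f := by
  rw [LaurentPolynomial.single_eq_C_mul_T, specialize, LaurentPolynomial.eval₂_C_mul_T,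
    RingHom.id_apply, mul_comm, ← map_zpow]
  congr 1
  rw [Units.coe_map, Units.val_zpow_eq_zpow_val, Units.val_mk0]
  change C (ex (-(z / N)) ^ n) = _
  congr 1
  rw [ex, ex, ← Complex.exp_int_mul]
  congr 1
  ring

variable {N p}

lemma int_eq_of_cast_eq (hpN : 2 * p < N) {m n : ℤ} (hm : m.natAbs ≤ p) (hn : n.natAbs ≤ p)
    (h : (m : ZMod N) = n) : m = n := by
  rw [ZMod.intCast_eq_intCast_iff] at h
  have h2 := h.dvd
  by_contra hne
  have := Nat.le_of_dvd (by omega) (Int.natAbs_dvd_natAbs.mpr h2)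
  omega

lemma specialize_laxMatrix_apply (hpN : 2 * p < N) (z : ℂ) (i : ZMod N) (n : ℤ)
    (hn : n.natAbs ≤ p) : specialize N z (laxMatrix N p i (i + n)) =
      C (ex (-(n * z / N))) * laxCoord N p n i := by
  rw [laxMatrix, bandMatrix, Matrix.of_apply, map_sum, Finset.sum_eq_single n]
  · rw [if_pos rfl, specialize_single]
  · intro m hm hne
    rw [if_neg, map_zero]
    intro h
    rw [Finset.mem_Icc] at hm
    exact hne (int_eq_of_cast_eq hpN (by omega) hn (add_left_cancel h).symm)
  · intro h
    rw [Finset.mem_Icc] at h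
    omega

/-- Translation along the diagonal multiplies a basis matrix by a character; this accounts for the
factor `𝐞(m/N)` in the upper half of the band. -/
lemma sinBasis_add_one (x : Mode N) (i j : ZMod N) :
    sinBasis N x (i + 1) (j + 1) = ex ((x.m : ℂ) / N) * sinBasis N x i j := by
  rw [sinBasis_apply, sinBasis_apply, add_sub_add_right_eq_sub, ← chr_natCast, mode_natCast_m,
    add_mul, one_mul, AddChar.map_add_eq_mul]
  split_ifs <;> ring

/-- The limiting Lax matrix is a banded matrix of Laurent polynomials in `w = 𝐞(-z/N)`. -/
lemma limitLax_eq_map (hpN : 2 * p < N) (z : ℂ) :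
    limitLax N p z = (laxMatrix N p).map (specialize N z) := by
  have hN := natCast_ne_zero' N
  ext1 i j
  rw [Matrix.map_apply, limitLax, Matrix.of_apply]
  set v := (j - i).val with hv
  have hvN : v < N := ZMod.val_lt _
  have hj : j = i + (v : ZMod N) := by rw [hv, ZMod.natCast_zmod_val]; ring
  have hx : ∀ x : Mode N, sinBasis N x i j ≠ 0 → x.n = v := by
    intro x h
    rw [sinBasis_apply] at h
    have : j - i = x.1.2 := by
      by_contra h'
      exact h (if_neg h')
    rw [hv, this]
    rfl
  -- the diagonal, the upper band, the lower band and the complement of the band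
  by_cases h0 : v = 0
  · have hji : j = i + ((0 : ℤ) : ZMod N) := by rw [hj, h0]; simp
    rw [hji, specialize_laxMatrix_apply hpN z i 0 (by simp)]
    simp only [Int.cast_zero, add_zero, zero_mul, zero_div, neg_zero, ex_zero, C_1, one_mul]
    rw [laxCoord, if_pos (by simp), if_pos rfl]
    simp only [stdCoord, Finset.mul_sum, ← mul_assoc, ← C_mul]
    rw [Finset.sum_comm]
    simp only [← Finset.sum_mul, ← map_sum]
    refine Finset.sum_congr rfl fun x _ => ?_
    congr 2
    simp only [sinBasis_apply, sub_self]
    by_cases hn : x.1.2 = 0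
    · have hm : x.1.1 ≠ 0 := fun h => x.2 (Prod.ext h hn)
      have hxn : x.n = 0 := by rw [Mode.n, hn, ZMod.val_zero]
      simp only [hn, if_true, hxn, Nat.cast_zero, mul_zero, zero_div, ex_zero, one_mul]
      rw [sum_kernelFn N i _ hm, limitLaxCoeff, if_pos hxn]
      rfl
    · simp [Ne.symm hn]
  by_cases h1 : v ≤ p
  · have hji : j = i + ((v : ℤ) : ZMod N) := by rw [hj]; simp
    rw [hji, specialize_laxMatrix_apply hpN z i v (by simpa using h1), ← hji,
      laxCoord, if_pos (by simpa using h1), if_neg (by omega), if_pos (by omega), ← hji]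
    simp only [stdCoord, Finset.mul_sum, ← mul_assoc, ← C_mul]
    refine Finset.sum_congr rfl fun x _ => ?_
    congr 2
    rw [sinBasis_add_one]
    by_cases hs : sinBasis N x i j = 0
    · simp [hs]
    · rw [limitLaxCoeff, hx x hs, if_neg h0, if_pos h1, ex_add, twoPiI, Int.cast_natCast]
      ring
  by_cases h2 : N - p ≤ v
  · have hji : j = i + (((v : ℤ) - N : ℤ) : ZMod N) := by rw [hj]; simp
    rw [hji, specialize_laxMatrix_apply hpN z i _ (by omega), ← hji,
      laxCoord, if_pos (by omega), if_neg (by omega), if_neg (by omega), ← hji]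
    simp only [stdCoord, Finset.mul_sum, ← mul_assoc, ← C_mul, mul_neg, ← Finset.sum_neg_distrib]
    refine Finset.sum_congr rfl fun x _ => ?_
    rw [← neg_mul, ← C_neg]
    congr 2
    by_cases hs : sinBasis N x i j = 0
    · simp [hs]
    · rw [limitLaxCoeff, hx x hs, if_neg h0, if_neg h1, if_pos h2, twoPiI]
      have : -((((v : ℤ) - N : ℤ) : ℂ) * z / N) = ((N : ℂ) - v) * z / N := by push_cast; ring
      rw [this]
      ring
  · have hz : laxMatrix N p i j = 0 := by
      rw [laxMatrix, bandMatrix, Matrix.of_apply]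
      refine Finset.sum_eq_zero fun m hm => if_neg fun h => ?_
      rw [Finset.mem_Icc] at hm
      have h3 : ((v : ℤ) : ZMod N) = m := by
        rw [hj] at h
        simpa using add_left_cancel h
      rw [ZMod.intCast_eq_intCast_iff] at h3
      obtain ⟨c, hc⟩ := h3.dvd
      have : c = 0 ∨ c = -1 ∨ 1 ≤ c ∨ c ≤ -2 := by omega
      rcases this with rfl | rfl | h4 | h4
      · omega
      · omega
      · nlinarith
      · nlinarith
    rw [hz, map_zero]
    refine Finset.sum_eq_zero fun x _ => ?_
    by_cases hs : sinBasis N x i j = 0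
    · simp [hs]
    · rw [limitLaxCoeff, hx x hs, if_neg h0, if_neg h1, if_neg h2, zero_mul, C_0, zero_mul]

variable (N p)

/-- The coefficient of `𝐞(jz)` in the trace of the `k`-th power of the limiting Lax matrix. -/
def laxHamiltonian (k : ℕ) (j : ℤ) : MvPolynomial (Mode N) ℂ :=
  (Matrix.trace (laxMatrix N p ^ k)).coeff (-(j * N))

variable {N p}

lemma trace_coeff {R : Type*} [CommRing R] (Y : Matrix (ZMod N) (ZMod N) (LaurentPolynomial R))
    (n : ℤ) : (Matrix.trace Y).coeff n = ∑ i, (Y i i).coeff n := by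
  rw [Matrix.trace, AddMonoidAlgebra.coeff_sum, Finset.sum_apply']
  rfl

/-- The trace of a graded matrix contains only the powers `w ^ (j N) = 𝐞(-jz)`, and the degree bound
`k p` of the `k`-th power leaves those with `|j| ≤ ⌊k p / N⌋`. -/
lemma trace_limitLax_pow (hpN : 2 * p < N) (k : ℕ) (z : ℂ) : Matrix.trace (limitLax N p z ^ k) =
    ∑ j ∈ Finset.Icc (-((k * p / N : ℕ) : ℤ)) ((k * p / N : ℕ) : ℤ),
      C (ex (j * z)) * laxHamiltonian N p k j := by
  have hN := natCast_ne_zero' N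
  have hN0 : 0 < N := Nat.pos_of_ne_zero (NeZero.ne N)
  have h1 : Matrix.trace (limitLax N p z ^ k) =
      specialize N z (Matrix.trace (laxMatrix N p ^ k)) := by
    rw [limitLax_eq_map hpN, ← Matrix.map_pow, Matrix.trace, Matrix.trace, map_sum]
    rfl
  -- the trace as a Laurent polynomial in `w`
  have h2 : Matrix.trace (laxMatrix N p ^ k) =
      ∑ j ∈ Finset.Icc (-((k * p / N : ℕ) : ℤ)) ((k * p / N : ℕ) : ℤ),
        single (-(j * N)) (laxHamiltonian N p k j) := by
    ext1 n
    rw [AddMonoidAlgebra.coeff_sum, Finset.sum_apply']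
    simp only [laurent_coeff_single]
    by_cases hn : ∃ j ∈ Finset.Icc (-((k * p / N : ℕ) : ℤ)) ((k * p / N : ℕ) : ℤ), -(j * N) = n
    · obtain ⟨j, hj, rfl⟩ := hn
      rw [Finset.sum_eq_single j]
      · rw [if_pos rfl, laxHamiltonian]
      · intro j' _ hne
        rw [if_neg]
        intro h
        have : j' * (N : ℤ) = j * N := by linarith
        exact hne (mul_right_cancel₀ (by exact_mod_cast NeZero.ne N) this)
      · intro h; exact absurd hj h
    · rw [Finset.sum_eq_zero (fun j hj => if_neg fun h => hn ⟨j, hj, h⟩), trace_coeff]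
      refine Finset.sum_eq_zero fun i _ => ?_
      by_cases hd : (N : ℤ) ∣ n
      · obtain ⟨c, rfl⟩ := hd
        apply coeff_bandMatrix_pow_eq_zero
        by_contra hle
        apply hn
        refine ⟨-c, ?_, by ring⟩
        have : c.natAbs ≤ k * p / N := by
          rw [Nat.le_div_iff_mul_le hN0]
          rw [Int.natAbs_mul, Int.natAbs_natCast] at hle
          linarith
        rw [Finset.mem_Icc]
        omega
      · apply isGraded_bandMatrix_pow
        intro h
        apply hd
        rw [← ZMod.intCast_zmod_eq_zero_iff_dvd]
        simpa using h
  rw [h1, h2, map_sum]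
  refine Finset.sum_congr rfl fun j _ => ?_
  rw [specialize_single]
  congr 3
  push_cast
  field_simp

/-! ### Brackets of the entries of the Lax matrix -/

lemma laxCoord_eq_zero {n : ℤ} (h : ¬ n.natAbs ≤ p) (i : ZMod N) : laxCoord N p n i = 0 := if_neg h

lemma laxCoord_pos {n : ℤ} (h : n.natAbs ≤ p) (h0 : 0 < n) (i : ZMod N) :
    laxCoord N p n i = C twoPiI * stdCoord N (i + 1) (i + n + 1) := by
  rw [laxCoord, if_pos h, if_neg h0.ne', if_pos h0]

lemma laxCoord_neg {n : ℤ} (h : n.natAbs ≤ p) (h0 : n < 0) (i : ZMod N) :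
    laxCoord N p n i = -(C twoPiI * stdCoord N i (i + n)) := by
  rw [laxCoord, if_pos h, if_neg h0.ne, if_neg (not_lt.mpr h0.le)]

lemma laxCoord_zero (i : ZMod N) :
    laxCoord N p 0 i = ∑ l, C (kernelFn N (i - l)) * stdCoord N l l := by
  rw [laxCoord, if_pos (by simp), if_pos rfl]

lemma bracket_laxCoord_pos (hpN : 2 * p < N) {n n' : ℤ} (hn : n.natAbs ≤ p) (hn' : n'.natAbs ≤ p)
    (h0 : 0 < n) (h0' : 0 < n') (i k : ZMod N) :
    poissonBracket (limitTensor N p) (laxCoord N p n i) (laxCoord N p n' k) =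
      C (twoPiI * N) * ((if i = k + n' then laxCoord N p (n + n') k else 0) -
        if k = i + n then laxCoord N p (n + n') i else 0) := by
  rw [laxCoord_pos hn h0, laxCoord_pos hn' h0', poissonBracket_C_mul_left,
    poissonBracket_C_mul_right, poissonBracket_stdCoord]
  have e1 : i + n + 1 - (i + 1) = (n : ZMod N) := by ring
  have e2 : k + n' + 1 - (k + 1) = (n' : ZMod N) := by ring
  rw [e1, e2]
  simp only [scalingExp_add_of_pos hpN (Or.inl ⟨h0, h0'⟩) hn hn', add_left_inj]
  by_cases h : (n + n').natAbs ≤ p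
  · rw [if_pos h, laxCoord_pos h (by omega), laxCoord_pos h (by omega)]
    have e3 : i = k + n' → i + n + 1 = k + ((n + n' : ℤ) : ZMod N) + 1 := by
      rintro rfl; push_cast; ring
    have e4 : k = i + n → k + n' + 1 = i + ((n + n' : ℤ) : ZMod N) + 1 := by
      rintro rfl; push_cast; ring
    split_ifs with h1 h2 h2
    · rw [e3 h1, e4 h2, C_mul]; ring
    · rw [e3 h1, C_mul]; ring
    · rw [e4 h2, C_mul]; ring
    · simp
  · rw [if_neg h, laxCoord_eq_zero h, laxCoord_eq_zero h]
    simp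

lemma bracket_laxCoord_neg (hpN : 2 * p < N) {n n' : ℤ} (hn : n.natAbs ≤ p) (hn' : n'.natAbs ≤ p)
    (h0 : n < 0) (h0' : n' < 0) (i k : ZMod N) :
    poissonBracket (limitTensor N p) (laxCoord N p n i) (laxCoord N p n' k) =
      -(C (twoPiI * N) * ((if i = k + n' then laxCoord N p (n + n') k else 0) -
        if k = i + n then laxCoord N p (n + n') i else 0)) := by
  rw [laxCoord_neg hn h0, laxCoord_neg hn' h0', ← neg_mul, ← neg_mul, ← C_neg,
    poissonBracket_C_mul_left, poissonBracket_C_mul_right, poissonBracket_stdCoord]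
  have e1 : i + n - i = (n : ZMod N) := by ring
  have e2 : k + n' - k = (n' : ZMod N) := by ring
  rw [e1, e2]
  simp only [scalingExp_add_of_pos hpN (Or.inr ⟨h0, h0'⟩) hn hn']
  by_cases h : (n + n').natAbs ≤ p
  · rw [if_pos h, laxCoord_neg h (by omega), laxCoord_neg h (by omega)]
    have e3 : i = k + n' → i + n = k + ((n + n' : ℤ) : ZMod N) := by
      rintro rfl; push_cast; ring
    have e4 : k = i + n → k + n' = i + ((n + n' : ℤ) : ZMod N) := by
      rintro rfl; push_cast; ring
    split_ifs with h1 h2 h2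
    · rw [e3 h1, e4 h2, C_mul, C_neg]; ring
    · rw [e3 h1, C_mul, C_neg]; ring
    · rw [e4 h2, C_mul, C_neg]; ring
    · simp
  · rw [if_neg h, laxCoord_eq_zero h, laxCoord_eq_zero h]
    simp

lemma bracket_laxCoord_opposite (hpN : 2 * p < N) {n n' : ℤ} (hn : n.natAbs ≤ p)
    (hn' : n'.natAbs ≤ p) (h : (0 < n ∧ n' < 0) ∨ (n < 0 ∧ 0 < n')) (i k : ZMod N) :
    poissonBracket (limitTensor N p) (laxCoord N p n i) (laxCoord N p n' k) = 0 := by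
  have key : ∀ u v u' v' : ZMod N, v - u = n → v' - u' = n' →
      poissonBracket (limitTensor N p) (stdCoord N u v) (stdCoord N u' v') = 0 := by
    intro u v u' v' h1 h2
    rw [poissonBracket_stdCoord, h1, h2, if_neg (scalingExp_add_of_neg hpN h hn hn')]
  rcases h with ⟨h0, h0'⟩ | ⟨h0, h0'⟩
  · rw [laxCoord_pos hn h0, laxCoord_neg hn' h0', ← neg_mul, ← C_neg, poissonBracket_C_mul_left,
      poissonBracket_C_mul_right, key _ _ _ _ (by ring) (by ring), mul_zero, mul_zero]
  · rw [laxCoord_neg hn h0, laxCoord_pos hn' h0', ← neg_mul, ← C_neg, poissonBracket_C_mul_left,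
      poissonBracket_C_mul_right, key _ _ _ _ (by ring) (by ring), mul_zero, mul_zero]

/-- The diagonal entries of the Lax matrix act on the coordinates by weights. -/
lemma bracket_diag_stdCoord (i k l : ZMod N) :
    poissonBracket (limitTensor N p) (laxCoord N p 0 i) (stdCoord N k l) =
      C (N * (kernelFn N (i - l) - kernelFn N (i - k))) * stdCoord N k l := by
  have h : ∀ t : ZMod N, C (kernelFn N (i - t)) *
      poissonBracket (limitTensor N p) (stdCoord N t t) (stdCoord N k l) =
      (if t = l then C (N * kernelFn N (i - l)) * stdCoord N k l else 0) -
        if t = k then C (N * kernelFn N (i - k)) * stdCoord N k l else 0 := by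
    intro t
    rw [poissonBracket_stdCoord, sub_self, zero_add, scalingExp_zero, zero_add, if_pos rfl]
    simp only [eq_comm (a := k)]
    split_ifs with h1 h2 h2
    · subst h1; subst h2; simp
    · subst h1; rw [C_mul]; ring
    · subst h2; rw [C_mul]; ring
    · simp
  rw [laxCoord_zero, poissonBracket_sum_left]
  simp_rw [poissonBracket_C_mul_left, h]
  rw [Finset.sum_sub_distrib, Finset.sum_ite_eq' Finset.univ l, Finset.sum_ite_eq' Finset.univ k,
    if_pos (Finset.mem_univ _), if_pos (Finset.mem_univ _), mul_sub, C_sub]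
  ring

/-- The brackets with a diagonal entry. The difference of the weights on an entry above the diagonal,
which is shifted by one step, is corrected by delta functions (`kernelFn_sub`), and these are the
terms of an algebra of shifts. -/
lemma bracket_laxCoord_diag {n' : ℤ} (hn' : n'.natAbs ≤ p) (i k : ZMod N) :
    poissonBracket (limitTensor N p) (laxCoord N p 0 i) (laxCoord N p n' k) =
      C (twoPiI * N) * (if 0 ≤ n' then ((if i = k + n' then laxCoord N p n' k else 0) -
        if k = i then laxCoord N p n' i else 0) else 0) +
      C (N * (kernelFn N (i - k - n') - kernelFn N (i - k))) * laxCoord N p n' k := by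
  rcases lt_trichotomy n' 0 with h0 | h0 | h0
  · rw [laxCoord_neg hn' h0, ← neg_mul, ← C_neg, poissonBracket_C_mul_right, bracket_diag_stdCoord,
      if_neg (by omega), ← sub_sub]
    ring
  · subst h0
    have h1 : poissonBracket (limitTensor N p) (laxCoord N p 0 i) (laxCoord N p 0 k) = 0 := by
      conv_lhs => rw [laxCoord_zero k, poissonBracket_sum_right]
      refine Finset.sum_eq_zero fun t _ => ?_
      rw [poissonBracket_C_mul_right, bracket_diag_stdCoord, sub_self, mul_zero, C_0, zero_mul,
        mul_zero]
    rw [h1]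
    simp only [le_refl, if_true, Int.cast_zero, add_zero, sub_zero, sub_self, mul_zero, C_0,
      zero_mul]
    by_cases h : i = k
    · subst h; simp
    · simp [h, Ne.symm h]
  · rw [laxCoord_pos hn' h0, poissonBracket_C_mul_right, bracket_diag_stdCoord, if_pos h0.le,
      show i - (k + n' + 1) = i - k - n' - 1 by ring, show i - (k + 1) = i - k - 1 by ring,
      kernelFn_sub, kernelFn_sub]
    have e1 : (i - k - (n' : ZMod N) = 0) ↔ i = k + n' := by
      rw [sub_sub, sub_eq_zero]
    have e2 : (i - k = 0) ↔ k = i := by rw [sub_eq_zero, eq_comm]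
    simp only [e1, e2]
    have e3 : k = i → laxCoord N p n' i = C twoPiI * stdCoord N (k + 1) (k + n' + 1) := by
      rintro rfl; exact laxCoord_pos hn' h0 _
    split_ifs with h1 h2 h2
    · rw [e3 h2]; simp only [map_mul, map_sub, map_add, map_one]; ring
    · simp only [map_mul, map_sub, map_add, map_one, map_zero]; ring
    · rw [e3 h2]; simp only [map_mul, map_sub, map_add, map_one, map_zero]; ring
    · simp only [map_mul, map_sub, map_add, map_zero]; ring

/-- The brackets of the entries of the Lax matrix: the parts of non-negative and of negative shift
form two copies of a truncated algebra of shifts, with opposite signs, and the diagonal part acts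
on both. -/
lemma bracket_laxCoord (hpN : 2 * p < N) {n n' : ℤ} (hn : n.natAbs ≤ p)
    (hn' : n'.natAbs ≤ p) (i k : ZMod N) :
    poissonBracket (limitTensor N p) (laxCoord N p n i) (laxCoord N p n' k) =
      C (twoPiI * N) * ((if 0 ≤ n ∧ 0 ≤ n' then 1 else if n < 0 ∧ n' < 0 then -1 else 0) *
        ((if i = k + n' then laxCoord N p (n + n') k else 0) -
          if k = i + n then laxCoord N p (n + n') i else 0)) +
      (if n = 0 then C (N * (kernelFn N (i - k - n') - kernelFn N (i - k))) * laxCoord N p n' k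
        else 0) -
      (if n' = 0 then C (N * (kernelFn N (k - i - n) - kernelFn N (k - i))) * laxCoord N p n i
        else 0) := by
  by_cases h0 : n = 0
  · subst h0
    rw [bracket_laxCoord_diag hn']
    have e : (n' = 0 → C (N * (kernelFn N (k - i - ((0 : ℤ) : ZMod N)) - kernelFn N (k - i))) *
      laxCoord N p 0 i = 0) := by intro _; simp
    rw [show (if n' = 0 then C (N * (kernelFn N (k - i - ((0 : ℤ) : ZMod N)) - kernelFn N (k - i)))
      * laxCoord N p 0 i else 0) = 0 by split_ifs with h; exacts [e h, rfl]]
    by_cases h1 : 0 ≤ n'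
    · simp [h1]
    · simp [h1]
  by_cases h0' : n' = 0
  · subst h0'
    rw [poissonBracket_limit_antisymm, bracket_laxCoord_diag hn, if_neg h0, if_pos rfl]
    by_cases h1 : 0 ≤ n
    · simp only [h1, le_refl, and_self, if_true, add_zero, Int.cast_zero, one_mul]
      ring
    · simp [h1]
  rw [if_neg h0, if_neg h0']
  rcases lt_or_gt_of_ne h0 with h1 | h1 <;> rcases lt_or_gt_of_ne h0' with h2 | h2
  · rw [bracket_laxCoord_neg hpN hn hn' h1 h2]
    have h3 : ¬ (0 ≤ n ∧ 0 ≤ n') := by omega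
    simp only [h3, h1, h2, and_self, if_true, if_false]
    ring
  · rw [bracket_laxCoord_opposite hpN hn hn' (Or.inr ⟨h1, h2⟩)]
    have h3 : ¬ (0 ≤ n ∧ 0 ≤ n') := by omega
    have h4 : ¬ (n < 0 ∧ n' < 0) := by omega
    simp only [h3, h4, if_false]
    ring
  · rw [bracket_laxCoord_opposite hpN hn hn' (Or.inl ⟨h1, h2⟩)]
    have h3 : ¬ (0 ≤ n ∧ 0 ≤ n') := by omega
    have h4 : ¬ (n < 0 ∧ n' < 0) := by omega
    simp only [h3, h4, if_false]
    ring
  · rw [bracket_laxCoord_pos hpN hn hn' h1 h2]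
    simp only [h1.le, h2.le, and_self, if_true]
    ring

/-! ### The Lax equation and the involution of the coefficients -/

variable (N p) in
/-- The gradient `k λ^j M^{k-1}`, `λ = w^N`, of the coefficient `H_{kj}` with respect to the Lax
matrix `M`. -/
def laxGradient (k : ℕ) (j : ℤ) :
    Matrix (ZMod N) (ZMod N) (LaurentPolynomial (MvPolynomial (Mode N) ℂ)) :=
  (single (j * N) (k : MvPolynomial (Mode N) ℂ) : LaurentPolynomial _) • laxMatrix N p ^ (k - 1)

lemma laxGradient_commute (k : ℕ) (j : ℤ) :
    laxMatrix N p * laxGradient N p k j = laxGradient N p k j * laxMatrix N p := by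
  rw [laxGradient, mul_smul_comm, smul_mul_assoc, ← pow_succ, ← pow_succ']

lemma isGraded_laxGradient (k : ℕ) (j : ℤ) : IsGraded (laxGradient N p k j) :=
  (isGraded_bandMatrix_pow _ _).single_smul _ _

/-- The chain rule for `H_{kj}` as a function of the entries of the Lax matrix. -/
lemma derivation_laxHamiltonian
    (D : Derivation ℂ (MvPolynomial (Mode N) ℂ) (MvPolynomial (Mode N) ℂ)) (k : ℕ) (j : ℤ) :
    D (laxHamiltonian N p k j) = ∑ m ∈ Finset.Icc (-(p : ℤ)) p, ∑ i : ZMod N,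
      (laxGradient N p k j (i + m) i).coeff (-m) * D (laxCoord N p m i) := by
  have h1 : (laxMatrix N p).map D.laurent = bandMatrix p (fun m i => D (laxCoord N p m i)) := by
    apply matrix_laurent_ext
    intro i l n
    rw [Matrix.map_apply, Derivation.laurent_coeff, laxMatrix, coeff_bandMatrix, coeff_bandMatrix]
    split_ifs <;> simp
  rw [laxHamiltonian, ← Derivation.laurent_coeff, Derivation.trace_pow, h1, Matrix.trace_mul_comm]
  have h2 : ∀ (f : LaurentPolynomial (MvPolynomial (Mode N) ℂ)) (n : ℤ),
      ((k : LaurentPolynomial (MvPolynomial (Mode N) ℂ)) * f).coeff n = k * f.coeff n := by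
    intro f n
    rw [← nsmul_eq_mul, ← nsmul_eq_mul]
    rfl
  rw [h2, trace_coeff]
  simp_rw [coeff_bandMatrix_mul]
  rw [Finset.sum_comm, Finset.mul_sum]
  refine Finset.sum_congr rfl fun m _ => ?_
  rw [Finset.mul_sum]
  refine Finset.sum_congr rfl fun i _ => ?_
  rw [laxGradient, coeff_single_smul, show -m - j * (N : ℤ) = -(j * N) - m by ring]
  ring

/-- The part of a Laurent polynomial in non-positive degrees. -/
def truncNonpos {R : Type*} [CommRing R] (f : LaurentPolynomial R) : LaurentPolynomial R :=
  AddMonoidAlgebra.ofCoeff (f.coeff.filter (· ≤ 0))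

lemma coeff_truncNonpos {R : Type*} [CommRing R] (f : LaurentPolynomial R) (n : ℤ) :
    (truncNonpos f).coeff n = if n ≤ 0 then f.coeff n else 0 := by
  rw [truncNonpos, AddMonoidAlgebra.coeff_ofCoeff, Finsupp.filter_apply]

variable (N p) in
/-- The diagonal correction to the second member of the Lax pair. -/
def laxPotential (k : ℕ) (j : ℤ) (u : ZMod N) : MvPolynomial (Mode N) ℂ :=
  ∑ i, (laxGradient N p k j i i).coeff 0 * C (kernelFn N (i - u))

variable (N p) in
/-- The second member of the Lax pair of the flow of `H_{kj}`: the non-positive part of the gradient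
with a diagonal correction. -/
def laxPartner (k : ℕ) (j : ℤ) :
    Matrix (ZMod N) (ZMod N) (LaurentPolynomial (MvPolynomial (Mode N) ℂ)) :=
  Matrix.of fun u v => single 0 (C (twoPiI * N)) * truncNonpos (laxGradient N p k j u v) +
    if u = v then single 0 (C (N : ℂ) * laxPotential N p k j u) else 0

lemma coeff_laxPartner (k : ℕ) (j : ℤ) (u v : ZMod N) (n : ℤ) :
    (laxPartner N p k j u v).coeff n = C (twoPiI * N) *
      (if n ≤ 0 then (laxGradient N p k j u v).coeff n else 0) +
      if u = v then if n = 0 then C (N : ℂ) * laxPotential N p k j u else 0 else 0 := by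
  rw [laxPartner, Matrix.of_apply, AddMonoidAlgebra.coeff_add, Finsupp.add_apply,
    AddMonoidAlgebra.coeff_single_mul_apply, neg_zero, zero_add, coeff_truncNonpos]
  congr 1
  split_ifs with _ h2
  · rw [laurent_coeff_single, if_pos h2.symm]
  · rw [laurent_coeff_single, if_neg (Ne.symm h2)]
  · rfl

lemma isGraded_laxPartner (k : ℕ) (j : ℤ) : IsGraded (laxPartner N p k j) := by
  intro u v n h
  rw [coeff_laxPartner, isGraded_laxGradient k j u v n h]
  have : u = v → n ≠ 0 := by
    rintro rfl rfl
    simp at h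
  by_cases huv : u = v
  · simp [this huv]
  · simp [huv]

/-- Reindexing of a sum over a symmetric interval by a translation. -/
lemma sum_Icc_shift {M : Type*} [AddCommMonoid M] (F : ℤ → M) (n : ℤ)
    (h1 : ∀ m, F m ≠ 0 → m ∈ Finset.Icc (-(p : ℤ)) p)
    (h2 : ∀ m, F (m - n) ≠ 0 → m ∈ Finset.Icc (-(p : ℤ)) p) :
    ∑ m ∈ Finset.Icc (-(p : ℤ)) p, F m = ∑ m ∈ Finset.Icc (-(p : ℤ)) p, F (m - n) := by
  rw [← finsum_eq_sum_of_support_subset F (fun m hm => h1 m hm),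
    ← finsum_eq_sum_of_support_subset (fun m => F (m - n)) (fun m hm => h2 m hm)]
  exact (finsum_comp_equiv (Equiv.subRight n)).symm

/-- The coefficients of the commutator of the Lax matrix with the non-positive part of the gradient.
-/
lemma coeff_commutator_laxPartner (k : ℕ) (j : ℤ) (u : ZMod N) (n : ℤ) :
    ((laxMatrix N p * laxPartner N p k j - laxPartner N p k j * laxMatrix N p) u (u + n)).coeff n =
      C (twoPiI * N) * ∑ m ∈ Finset.Icc (-(p : ℤ)) p, (if n - m ≤ 0 then
        laxCoord N p m u * (laxGradient N p k j (u + m) (u + n)).coeff (n - m) -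
        (laxGradient N p k j u (u + n - m)).coeff (n - m) * laxCoord N p m (u + n - m) else 0) +
      C (N : ℂ) * (laxPotential N p k j (u + n) - laxPotential N p k j u) * laxCoord N p n u := by
  rw [Matrix.sub_apply, AddMonoidAlgebra.coeff_sub, Finsupp.sub_apply, laxMatrix,
    coeff_bandMatrix_mul, coeff_mul_bandMatrix]
  simp_rw [coeff_laxPartner, mul_add, add_mul]
  rw [Finset.sum_add_distrib, Finset.sum_add_distrib]
  have h1 : ∑ m ∈ Finset.Icc (-(p : ℤ)) p, laxCoord N p m u *
      (if u + (m : ZMod N) = u + n then if n - m = 0 then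
        C (N : ℂ) * laxPotential N p k j (u + m) else 0 else 0) =
      C (N : ℂ) * laxPotential N p k j (u + n) * laxCoord N p n u := by
    rw [Finset.sum_eq_single n]
    · rw [if_pos rfl, if_pos (sub_self n)]; ring
    · intro m _ hm
      rw [if_neg (c := n - m = 0) (by omega)]; simp
    · intro h
      rw [laxCoord_eq_zero (by rw [Finset.mem_Icc] at h; omega), zero_mul]
  have h2 : ∑ m ∈ Finset.Icc (-(p : ℤ)) p, (if u = u + (n : ZMod N) - m then if n - m = 0 then
        C (N : ℂ) * laxPotential N p k j u else 0 else 0) * laxCoord N p m (u + n - m) =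
      C (N : ℂ) * laxPotential N p k j u * laxCoord N p n u := by
    rw [Finset.sum_eq_single n]
    · rw [add_sub_cancel_right, if_pos rfl, if_pos (sub_self n)]
    · intro m _ hm
      rw [if_neg (c := n - m = 0) (by omega)]; simp
    · intro h
      rw [laxCoord_eq_zero (by rw [Finset.mem_Icc] at h; omega), mul_zero]
  rw [h1, h2, add_sub_add_comm, ← Finset.sum_sub_distrib, Finset.mul_sum]
  congr 1
  · refine Finset.sum_congr rfl fun m _ => ?_
    split_ifs <;> ring
  · ring

/-- The entries of the identity `M X = X M` for the gradient `X`. -/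
lemma sum_commute_laxGradient (k : ℕ) (j : ℤ) (u v : ZMod N) (n : ℤ) :
    ∑ m ∈ Finset.Icc (-(p : ℤ)) p,
      (laxCoord N p m u * (laxGradient N p k j (u + m) v).coeff (n - m) -
        (laxGradient N p k j u (v - m)).coeff (n - m) * laxCoord N p m (v - m)) = 0 := by
  rw [Finset.sum_sub_distrib, ← coeff_bandMatrix_mul, ← coeff_mul_bandMatrix, ← laxMatrix,
    laxGradient_commute, sub_self]

/-- The Lax equation `{H_{kj}, M} = [M, Q]` for the entries of `M`. The brackets of the entries cut
the gradient `X` into its non-negative and negative parts; as `X` commutes with `M`, one of the two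
parts suffices. -/
lemma bracket_laxHamiltonian_laxCoord (hpN : 2 * p < N) (k : ℕ) (j : ℤ) (u : ZMod N) (n : ℤ)
    (hn : n.natAbs ≤ p) :
    poissonBracket (limitTensor N p) (laxHamiltonian N p k j) (laxCoord N p n u) =
    ((laxMatrix N p * laxPartner N p k j - laxPartner N p k j * laxMatrix N p)
      u (u + n)).coeff n := by
  rw [← hamDerivationLeft_apply, derivation_laxHamiltonian, coeff_commutator_laxPartner]
  set G := laxGradient N p k j with hG
  have hmem : ∀ m : ℤ, m ∈ Finset.Icc (-(p : ℤ)) p ↔ m.natAbs ≤ p := by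
    intro m
    rw [Finset.mem_Icc]
    omega
  -- the sum over the positions of the first entry
  have h1 : ∀ m ∈ Finset.Icc (-(p : ℤ)) p, (∑ i : ZMod N, (G (i + m) i).coeff (-m) *
      hamDerivationLeft (limitTensor N p) (laxCoord N p n u) (laxCoord N p m i)) =
      C (twoPiI * N) * ((if 0 ≤ m ∧ 0 ≤ n then 1 else if m < 0 ∧ n < 0 then -1 else 0) *
        ((G (u + n + m) (u + n)).coeff (-m) * laxCoord N p (m + n) u -
          (G u (u - m)).coeff (-m) * laxCoord N p (m + n) (u - m))) +
      (if m = 0 then C (N : ℂ) * (laxPotential N p k j (u + n) - laxPotential N p k j u) *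
        laxCoord N p n u else 0) -
      (if n = 0 then ∑ i : ZMod N, (G (i + m) i).coeff (-m) *
        (C (N * (kernelFn N (u - i - m) - kernelFn N (u - i))) * laxCoord N p m i) else 0) := by
    intro m hm
    simp_rw [hamDerivationLeft_apply]
    simp_rw [bracket_laxCoord hpN ((hmem m).mp hm) hn, mul_sub, mul_add]
    rw [Finset.sum_sub_distrib, Finset.sum_add_distrib]
    congr 1
    · congr 1
      · have e : ∀ i : ZMod N, u = i + (m : ZMod N) ↔ i = u - m := fun i =>
          ⟨fun h => by rw [h]; ring, fun h => by rw [h]; ring⟩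
        simp only [e, mul_sub, Finset.sum_sub_distrib, mul_ite, mul_zero]
        rw [Finset.sum_ite_eq' Finset.univ (u + (n : ZMod N)),
          Finset.sum_ite_eq' Finset.univ (u - (m : ZMod N)), if_pos (Finset.mem_univ _),
          if_pos (Finset.mem_univ _), sub_add_cancel]
        ring
      · split_ifs with h
        · subst h
          simp only [Int.cast_zero, add_zero, neg_zero, laxPotential, ← hG]
          rw [sub_mul, Finset.mul_sum, Finset.mul_sum, Finset.sum_mul, Finset.sum_mul,
            ← Finset.sum_sub_distrib]
          refine Finset.sum_congr rfl fun i _ => ?_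
          rw [C_sub, C_mul, C_mul, sub_sub i]
          ring
        · simp
    · split_ifs
      · rfl
      · simp
  rw [Finset.sum_congr rfl h1, Finset.sum_sub_distrib, Finset.sum_add_distrib,
    Finset.sum_ite_eq' _ (0 : ℤ), if_pos (by rw [hmem]; simp)]
  -- the terms in which the second entry is diagonal cancel because `M X = X M`
  have h2 : (∑ m ∈ Finset.Icc (-(p : ℤ)) p, if n = 0 then ∑ i : ZMod N, (G (i + m) i).coeff (-m) *
        (C (N * (kernelFn N (u - i - m) - kernelFn N (u - i))) * laxCoord N p m i) else 0) = 0 := by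
    by_cases h : n = 0
    swap
    · simp [h]
    simp only [h, if_true]
    have e1 : ∀ m : ℤ, ∑ i : ZMod N, (G (i + m) i).coeff (-m) *
        (C (N * (kernelFn N (u - i - m) - kernelFn N (u - i))) * laxCoord N p m i) =
        ∑ i : ZMod N, C (N * kernelFn N (u - i)) * -(laxCoord N p m i * (G (i + m) i).coeff (0 - m)
          - (G i (i - m)).coeff (0 - m) * laxCoord N p m (i - m)) := by
      intro m
      have e2 : ∑ i : ZMod N, C ((N : ℂ) * kernelFn N (u - i)) *
          ((G i (i - m)).coeff (0 - m) * laxCoord N p m (i - m)) =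
          ∑ i : ZMod N, C ((N : ℂ) * kernelFn N (u - i - m)) *
          ((G (i + m) i).coeff (0 - m) * laxCoord N p m i) := by
        rw [← Equiv.sum_comp (Equiv.addRight (m : ZMod N))]
        refine Finset.sum_congr rfl fun i _ => ?_
        simp only [Equiv.coe_addRight, add_sub_cancel_right, ← sub_sub]
      simp_rw [neg_sub, mul_sub]
      rw [Finset.sum_sub_distrib, e2, ← Finset.sum_sub_distrib]
      refine Finset.sum_congr rfl fun i _ => ?_
      rw [C_sub, zero_sub]
      ring
    simp_rw [e1]
    rw [Finset.sum_comm]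
    refine Finset.sum_eq_zero fun i _ => ?_
    rw [← Finset.mul_sum, Finset.sum_neg_distrib, sum_commute_laxGradient, neg_zero, mul_zero]
  rw [h2, sub_zero, ← Finset.mul_sum]
  congr 2
  rcases le_or_gt 0 n with h0 | h0
  -- an entry of non-negative shift is moved by the non-positive part of the gradient
  · rw [sum_Icc_shift _ n]
    · refine Finset.sum_congr rfl fun m _ => ?_
      have e3 : (0 ≤ m - n ∧ 0 ≤ n) ↔ n - m ≤ 0 := by omega
      have e4 : ¬ (m - n < 0 ∧ n < 0) := by omega
      simp only [e3, e4, if_false]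
      split_ifs
      · have e5 : u + (n : ZMod N) + ((m - n : ℤ) : ZMod N) = u + m := by push_cast; ring
        have e6 : u - ((m - n : ℤ) : ZMod N) = u + n - m := by push_cast; ring
        rw [e5, e6, sub_add_cancel, neg_sub]
        ring
      · simp
    · intro m hm
      by_contra hne
      rw [hmem] at hne
      apply hm
      have e4 : ¬ (m < 0 ∧ n < 0) := by omega
      by_cases h3 : 0 ≤ m ∧ 0 ≤ n
      · rw [laxCoord_eq_zero (by omega), laxCoord_eq_zero (by omega)]; simp
      · simp [h3, e4]
    · intro m hm
      by_contra hne
      rw [hmem] at hne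
      apply hm
      rw [sub_add_cancel, laxCoord_eq_zero hne, laxCoord_eq_zero hne]; simp
  -- an entry of negative shift is moved by minus the positive part, and `M X = X M`
  · have h5 := sum_commute_laxGradient (p := p) k j u (u + (n : ZMod N)) n
    rw [← hG] at h5
    rw [sum_Icc_shift _ n]
    · refine Eq.trans ?_ ((congrArg (_ - ·) h5).trans (sub_zero _))
      rw [← Finset.sum_sub_distrib]
      refine Finset.sum_congr rfl fun m _ => ?_
      have e3 : ¬ (0 ≤ m - n ∧ 0 ≤ n) := by omega
      have e4 : (m - n < 0 ∧ n < 0) ↔ ¬ (n - m ≤ 0) := by omega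
      have e5 : u + (n : ZMod N) + ((m - n : ℤ) : ZMod N) = u + m := by push_cast; ring
      have e6 : u - ((m - n : ℤ) : ZMod N) = u + n - m := by push_cast; ring
      simp only [e3, e4, if_false]
      rw [e5, e6, sub_add_cancel, neg_sub]
      by_cases h6 : n - m ≤ 0
      · simp [h6]
      · simp only [h6, not_false_eq_true, if_true, if_false]
        ring
    · intro m hm
      by_contra hne
      rw [hmem] at hne
      apply hm
      have e4 : ¬ (0 ≤ m ∧ 0 ≤ n) := by omega
      by_cases h3 : m < 0 ∧ n < 0
      · rw [laxCoord_eq_zero (by omega), laxCoord_eq_zero (by omega)]; simp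
      · simp [h3, e4]
    · intro m hm
      by_contra hne
      rw [hmem] at hne
      apply hm
      rw [sub_add_cancel, laxCoord_eq_zero hne, laxCoord_eq_zero hne]; simp

lemma IsGraded.bandMatrix_mul {R : Type*} [CommRing R] (b : ℤ → ZMod N → R)
    {Y : Matrix (ZMod N) (ZMod N) (LaurentPolynomial R)} (hY : IsGraded Y) :
    IsGraded (bandMatrix p b * Y) := by
  intro u v n h
  rw [coeff_bandMatrix_mul]
  refine Finset.sum_eq_zero fun m _ => ?_
  rw [hY, mul_zero]
  intro h'
  apply h
  rw [h']
  push_cast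
  ring

lemma IsGraded.mul_bandMatrix {R : Type*} [CommRing R] (b : ℤ → ZMod N → R)
    {Y : Matrix (ZMod N) (ZMod N) (LaurentPolynomial R)} (hY : IsGraded Y) :
    IsGraded (Y * bandMatrix p b) := by
  intro u v n h
  rw [coeff_mul_bandMatrix]
  refine Finset.sum_eq_zero fun m _ => ?_
  rw [hY, zero_mul]
  intro h'
  apply h
  rw [← sub_add_cancel v (m : ZMod N), h']
  push_cast
  ring

/-- The Lax equation of the flow of `H_{kj}`. -/
lemma lax_equation (hpN : 2 * p < N) (k : ℕ) (j : ℤ) :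
    (laxMatrix N p).map (hamDerivation (limitTensor N p) (laxHamiltonian N p k j)).laurent =
      laxMatrix N p * laxPartner N p k j - laxPartner N p k j * laxMatrix N p := by
  apply matrix_laurent_ext
  intro u v n
  rw [Matrix.map_apply, Derivation.laurent_coeff]
  by_cases hv : v = u + n
  · subst hv
    by_cases hn : n.natAbs ≤ p
    · rw [← bracket_laxHamiltonian_laxCoord hpN k j u n hn, laxMatrix, coeff_bandMatrix, if_pos,
        if_pos rfl, hamDerivation_apply]
      rw [Finset.mem_Icc]
      omega
    · have h1 : n ∉ Finset.Icc (-(p : ℤ)) p := by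
        rw [Finset.mem_Icc]
        omega
      rw [coeff_commutator_laxPartner, laxCoord_eq_zero hn, mul_zero, add_zero, laxMatrix,
        coeff_bandMatrix, if_neg h1, map_zero]
      rcases lt_or_ge n 0 with h0 | h0
      · rw [Finset.sum_congr rfl (g := fun m => laxCoord N p m u *
          (laxGradient N p k j (u + m) (u + n)).coeff (n - m) -
          (laxGradient N p k j u (u + n - m)).coeff (n - m) * laxCoord N p m (u + n - m)),
          sum_commute_laxGradient, mul_zero]
        intro m hm
        rw [Finset.mem_Icc] at hm
        rw [if_pos (by omega)]
      · rw [Finset.sum_eq_zero, mul_zero]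
        intro m hm
        rw [Finset.mem_Icc] at hm
        rw [if_neg (by omega)]
  · rw [laxMatrix, isGraded_bandMatrix _ u v n hv, map_zero, Matrix.sub_apply,
      AddMonoidAlgebra.coeff_sub, Finsupp.sub_apply,
      (isGraded_laxPartner k j).bandMatrix_mul _ u v n hv,
      (isGraded_laxPartner k j).mul_bandMatrix _ u v n hv, sub_zero]

/-- A matrix that evolves by commutators has constant traces of powers. -/
lemma involution (hpN : 2 * p < N) (k k' : ℕ) (j j' : ℤ) :
    poissonBracket (limitTensor N p) (laxHamiltonian N p k j) (laxHamiltonian N p k' j') = 0 := by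
  rw [← hamDerivation_apply]
  conv_lhs => rw [laxHamiltonian.eq_1 N p k' j']
  rw [← Derivation.laurent_coeff, Derivation.trace_pow, lax_equation hpN]
  have : Matrix.trace (laxMatrix N p ^ (k' - 1) * (laxMatrix N p * laxPartner N p k j -
      laxPartner N p k j * laxMatrix N p)) = 0 := by
    rw [mul_sub, Matrix.trace_sub, sub_eq_zero, ← mul_assoc, ← pow_succ, ← mul_assoc,
      Matrix.trace_mul_comm (_ * _) (laxMatrix N p), ← mul_assoc, ← pow_succ']
  rw [this, mul_zero]
  rfl

/-! ### The Poisson subalgebra of the band -/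

/-- The band consists of the residues of the integers of absolute value at most `p`. -/
lemma band_iff (hpN : 2 * p < N) (v : ZMod N) :
    (v.val ≤ p ∨ N - p ≤ v.val) ↔ ∃ m : ℤ, m.natAbs ≤ p ∧ v = m := by
  have hv := ZMod.val_lt v
  constructor
  · rintro (h | h)
    · exact ⟨v.val, by omega, by rw [Int.cast_natCast, ZMod.natCast_zmod_val]⟩
    · refine ⟨(v.val : ℤ) - N, by omega, ?_⟩
      rw [Int.cast_sub, Int.cast_natCast, ZMod.natCast_zmod_val]
      simp
  · rintro ⟨m, hm, rfl⟩
    rcases le_or_gt 0 m with h | h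
    · left
      obtain ⟨a, rfl⟩ := Int.eq_ofNat_of_zero_le h
      rw [Int.cast_natCast, ZMod.val_natCast_of_lt (by omega)]
      omega
    · right
      have : ((m : ℤ) : ZMod N) = ((N - m.natAbs : ℕ) : ZMod N) := by
        have h2 : m = ((N - m.natAbs : ℕ) : ℤ) - N := by omega
        conv_lhs => rw [h2]
        rw [Int.cast_sub, Int.cast_natCast]
        simp
      rw [this, ZMod.val_natCast_of_lt (by omega)]
      omega

lemma stdCoord_mem_bandAlgebra (hpN : 2 * p < N) {u v : ZMod N} {m : ℤ} (hm : m.natAbs ≤ p)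
    (h : v - u = m) : stdCoord N u v ∈ bandAlgebra N p :=
  Algebra.subset_adjoin ⟨⟨(u, v), (band_iff hpN _).mpr ⟨m, hm, h⟩⟩, rfl⟩

lemma C_mem_bandAlgebra (a : ℂ) : C a ∈ bandAlgebra N p := (bandAlgebra N p).algebraMap_mem a

lemma laxCoord_mem_bandAlgebra (hpN : 2 * p < N) (n : ℤ) (i : ZMod N) :
    laxCoord N p n i ∈ bandAlgebra N p := by
  by_cases hn : n.natAbs ≤ p
  · rcases lt_trichotomy n 0 with h0 | rfl | h0
    · rw [laxCoord_neg hn h0]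
      exact neg_mem (mul_mem (C_mem_bandAlgebra _) (stdCoord_mem_bandAlgebra hpN hn (by ring)))
    · rw [laxCoord_zero]
      exact sum_mem fun l _ => mul_mem (C_mem_bandAlgebra _)
        (stdCoord_mem_bandAlgebra hpN hn (by simp))
    · rw [laxCoord_pos hn h0]
      exact mul_mem (C_mem_bandAlgebra _) (stdCoord_mem_bandAlgebra hpN hn (by ring))
  · rw [laxCoord_eq_zero hn]
    exact zero_mem _

lemma laxHamiltonian_mem_bandAlgebra (hpN : 2 * p < N) (k : ℕ) (j : ℤ) :
    laxHamiltonian N p k j ∈ bandAlgebra N p := by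
  have key : ∀ (k : ℕ) (u v : ZMod N) (n : ℤ),
      ((laxMatrix N p ^ k) u v).coeff n ∈ bandAlgebra N p := by
    intro k
    induction k with
    | zero =>
      intro u v n
      rw [pow_zero, Matrix.one_apply]
      split_ifs
      · rw [AddMonoidAlgebra.one_def, laurent_coeff_single]
        split_ifs
        · exact one_mem _
        · exact zero_mem _
      · exact zero_mem _
    | succ k ih =>
      intro u v n
      rw [pow_succ', laxMatrix, coeff_bandMatrix_mul]
      exact sum_mem fun m _ => mul_mem (laxCoord_mem_bandAlgebra hpN m u) (ih _ _ _)
  rw [laxHamiltonian, trace_coeff]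
  exact sum_mem fun i _ => key _ _ _ _

lemma bracket_bandCoord_mem (hpN : 2 * p < N) (a b : BandPair N p) :
    poissonBracket (limitTensor N p) (bandCoord N p a) (bandCoord N p b) ∈ bandAlgebra N p := by
  obtain ⟨⟨u, v⟩, ha⟩ := a
  obtain ⟨⟨u', v'⟩, hb⟩ := b
  obtain ⟨m, hm, h1⟩ := (band_iff hpN _).mp ha
  obtain ⟨m', hm', h2⟩ := (band_iff hpN _).mp hb
  simp only at h1 h2
  simp only [bandCoord]
  rw [poissonBracket_stdCoord, h1, h2]
  by_cases h : scalingExp N p m + scalingExp N p m' = scalingExp N p ((m : ZMod N) + m')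
  swap
  · rw [if_neg h]
    exact zero_mem _
  · rw [if_pos h]
    have hsum : (m + m').natAbs ≤ p := by
      rcases lt_trichotomy m 0 with h0 | h0 | h0 <;> rcases lt_trichotomy m' 0 with h0' | h0' | h0'
      · exact (scalingExp_add_of_pos hpN (Or.inr ⟨h0, h0'⟩) hm hm').mp h
      · omega
      · exact absurd h (scalingExp_add_of_neg hpN (Or.inr ⟨h0, h0'⟩) hm hm')
      · omega
      · omega
      · omega
      · exact absurd h (scalingExp_add_of_neg hpN (Or.inl ⟨h0, h0'⟩) hm hm')
      · omega
      · exact (scalingExp_add_of_pos hpN (Or.inl ⟨h0, h0'⟩) hm hm').mp h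
    refine mul_mem (C_mem_bandAlgebra _) (sub_mem ?_ ?_)
    · split_ifs with h3
      · refine stdCoord_mem_bandAlgebra hpN hsum ?_
        rw [Int.cast_add, ← h1, ← h2, h3]
        ring
      · exact zero_mem _
    · split_ifs with h3
      · refine stdCoord_mem_bandAlgebra hpN hsum ?_
        rw [Int.cast_add, ← h1, ← h2, h3]
        ring
      · exact zero_mem _

lemma bracket_mem_bandAlgebra (hpN : 2 * p < N) {f g : MvPolynomial (Mode N) ℂ}
    (hf : f ∈ bandAlgebra N p) (hg : g ∈ bandAlgebra N p) :
    poissonBracket (limitTensor N p) f g ∈ bandAlgebra N p := by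
  induction hg using Algebra.adjoin_induction with
  | mem g hg =>
    obtain ⟨b, rfl⟩ := hg
    induction hf using Algebra.adjoin_induction with
    | mem f hf =>
      obtain ⟨a, rfl⟩ := hf
      exact bracket_bandCoord_mem hpN a b
    | algebraMap r =>
      rw [← hamDerivationLeft_apply, Derivation.map_algebraMap]
      exact zero_mem _
    | add f₁ f₂ _ _ h₁ h₂ =>
      rw [← hamDerivationLeft_apply, map_add, hamDerivationLeft_apply, hamDerivationLeft_apply]
      exact add_mem h₁ h₂
    | mul f₁ f₂ hf₁ hf₂ h₁ h₂ =>
      rw [← hamDerivationLeft_apply, Derivation.leibniz, hamDerivationLeft_apply,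
        hamDerivationLeft_apply]
      exact add_mem (mul_mem hf₁ h₂) (mul_mem hf₂ h₁)
  | algebraMap r =>
    rw [← hamDerivation_apply, Derivation.map_algebraMap]
    exact zero_mem _
  | add f₁ f₂ _ _ h₁ h₂ =>
    rw [← hamDerivation_apply, map_add, hamDerivation_apply, hamDerivation_apply]
    exact add_mem h₁ h₂
  | mul f₁ f₂ hf₁ hf₂ h₁ h₂ =>
    rw [← hamDerivation_apply, Derivation.leibniz, hamDerivation_apply,
      hamDerivation_apply]
    exact add_mem (mul_mem hf₁ h₂) (mul_mem hf₂ h₁)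

/-! ### A banded matrix whose centralizer is generated by its powers -/

variable (N p) in
/-- The entries of the sum of a cyclic shift by `-p` and of a shift by `p` with one entry removed.
For `p` prime to `N`, the reordering `t ↦ t p` of the indices makes this matrix tridiagonal. -/
def openChain (n : ℤ) (i : ZMod N) : ℂ :=
  if n = -(p : ℤ) then 1 else if n = p then if i = -(p : ZMod N) then 0 else 1 else 0

lemma openChain_neg (i : ZMod N) : openChain N p (-(p : ℤ)) i = 1 := if_pos rfl

lemma openChain_pos (hp : 0 < p) (i : ZMod N) :
    openChain N p p i = if i = -(p : ZMod N) then 0 else 1 := by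
  rw [openChain, if_neg (by omega), if_pos rfl]

lemma chain_mul_apply (hp : 0 < p) (Y : Matrix (ZMod N) (ZMod N) (LaurentPolynomial ℂ))
    (i l : ZMod N) : (bandMatrix p (openChain N p) * Y) i l =
      single (-(p : ℤ)) 1 * Y (i - p) l +
        (if i = -(p : ZMod N) then 0 else single (p : ℤ) 1 * Y (i + p) l) := by
  ext n
  rw [coeff_bandMatrix_mul, Finset.sum_eq_add (-(p : ℤ)) p (by omega)]
  · rw [openChain_neg, openChain_pos hp, AddMonoidAlgebra.coeff_add, Finsupp.add_apply,
      AddMonoidAlgebra.coeff_single_mul_apply]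
    have e : i + ((-(p : ℤ) : ℤ) : ZMod N) = i - p := by push_cast; ring
    rw [e, neg_neg, sub_neg_eq_add, add_comm n]
    congr 1
    split_ifs
    · simp
    · rw [AddMonoidAlgebra.coeff_single_mul_apply, Int.cast_natCast, neg_add_eq_sub]
  · intro m _ hm
    rw [openChain, if_neg hm.1, if_neg hm.2, zero_mul]
  · intro h
    rw [Finset.mem_Icc] at h
    omega
  · intro h
    rw [Finset.mem_Icc] at h
    omega

lemma natCast_mul_injOn (hcop : Nat.Coprime N p) {a b : ℕ} (hab : a ≤ b) (hb : b - a < N)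
    (h : (a : ZMod N) * p = b * p) : a = b := by
  have hu : IsUnit (p : ZMod N) := (ZMod.isUnit_iff_coprime p N).mpr hcop.symm
  have h1 : (a : ZMod N) = b := hu.mul_right_cancel h
  rw [ZMod.natCast_eq_natCast_iff] at h1
  have h2 := (Nat.modEq_iff_dvd' hab).mp h1
  have h3 := Nat.eq_zero_of_dvd_of_lt h2 hb
  omega

lemma exists_mul_eq (hcop : Nat.Coprime N p) (i : ZMod N) :
    ∃ t < N, i = (t : ZMod N) * p := by
  have hu : IsUnit (p : ZMod N) := (ZMod.isUnit_iff_coprime p N).mpr hcop.symm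
  obtain ⟨q, hq⟩ := hu.exists_left_inv
  refine ⟨(i * q).val, ZMod.val_lt _, ?_⟩
  rw [ZMod.natCast_zmod_val, mul_assoc, hq, mul_one]

/-- The `k`-th Krylov vector of the basis vector `e_0` is supported on `0, p, …, k p`. -/
lemma krylov_support (hp : 0 < p) (k : ℕ) (i : ZMod N)
    (h : (bandMatrix p (openChain N p) ^ k) i 0 ≠ 0) : ∃ t ≤ k, i = (t : ZMod N) * p := by
  induction k generalizing i with
  | zero =>
    refine ⟨0, le_refl _, ?_⟩
    by_contra hi
    apply h
    rw [pow_zero, Matrix.one_apply_ne]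
    simpa using hi
  | succ k ih =>
    rw [pow_succ', chain_mul_apply hp] at h
    by_cases h1 : (bandMatrix p (openChain N p) ^ k) (i - p) 0 = 0
    · rw [h1, mul_zero, zero_add] at h
      split_ifs at h with h2
      · exact absurd rfl h
      · obtain ⟨t, ht, hi⟩ := ih (i + p) (fun h0 => h (by rw [h0, mul_zero]))
        rcases t with _ | t
        · exact absurd (by rw [eq_neg_iff_add_eq_zero, hi]; simp) h2
        · refine ⟨t, by omega, ?_⟩
          rw [← add_left_inj (p : ZMod N), hi]
          push_cast
          ring
    · obtain ⟨t, ht, hi⟩ := ih _ h1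
      refine ⟨t + 1, by omega, ?_⟩
      rw [← sub_add_cancel i (p : ZMod N), hi]
      push_cast
      ring

/-- The component of the `k`-th Krylov vector at the new position `k p` is a unit. It comes from the
cyclic shift alone: the removed entry blocks the walk from `0` in the opposite direction. -/
lemma krylov_top (hp : 0 < p) (hcop : Nat.Coprime N p) (k : ℕ) (hk : k < N) :
    (bandMatrix p (openChain N p) ^ k) (k * p) 0 = single (-(k * p : ℤ)) 1 := by
  induction k with
  | zero =>
    have h0 : ((0 : ℕ) : ZMod N) * p = 0 := by rw [Nat.cast_zero, zero_mul]
    rw [h0, pow_zero, Matrix.one_apply_eq, Nat.cast_zero, zero_mul, neg_zero,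
      AddMonoidAlgebra.one_def]
  | succ k ih =>
    have e : ((k + 1 : ℕ) : ZMod N) * p - p = k * p := by push_cast; ring
    rw [pow_succ', chain_mul_apply hp, e, ih (by omega), AddMonoidAlgebra.single_mul_single]
    have h2 : (if ((k + 1 : ℕ) : ZMod N) * p = -(p : ZMod N) then 0 else
        (single (p : ℤ) (1 : ℂ) : LaurentPolynomial ℂ) *
          (bandMatrix p (openChain N p) ^ k) (((k + 1 : ℕ) : ZMod N) * p + p) 0) = 0 := by
      split_ifs with h
      · rfl
      · by_contra h0
        obtain ⟨t, ht, hi⟩ := krylov_support hp k _ (fun h1 => h0 (by rw [h1, mul_zero]))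
        have h3 : ((t : ℕ) : ZMod N) * p = ((k + 2 : ℕ) : ZMod N) * p := by
          rw [← hi]
          push_cast
          ring
        by_cases ht0 : k + 2 - t < N
        · have := natCast_mul_injOn hcop (by omega) ht0 h3
          omega
        · have ht1 : t = 0 := by omega
          apply h
          rw [eq_neg_iff_add_eq_zero, hi, ht1]
          simp
    rw [h2, add_zero, one_mul]
    congr 1
    push_cast
    ring

/-- The Krylov vectors of `e_0` form a basis of the graded vectors over `ℂ[λ, λ⁻¹]`,
`λ = w ^ N`. -/
lemma exists_krylov_expansion (hp : 0 < p) (hcop : Nat.Coprime N p) (r : ℕ) (hr : r ≤ N)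
    (v : ZMod N → LaurentPolynomial ℂ)
    (hv : ∀ i n, (v i).coeff n ≠ 0 → i + (n : ZMod N) = 0)
    (hs : ∀ i, v i ≠ 0 → ∃ t < r, i = (t : ZMod N) * p) :
    ∃ F : ℕ → LaurentPolynomial ℂ, (∀ k n, (F k).coeff n ≠ 0 → (N : ℤ) ∣ n) ∧
      ∀ i, v i = ∑ k ∈ Finset.range r, F k * (bandMatrix p (openChain N p) ^ k) i 0 := by
  induction r generalizing v with
  | zero =>
    refine ⟨0, fun k n h => absurd rfl h, fun i => ?_⟩
    by_contra h
    rw [Finset.range_zero, Finset.sum_empty] at h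
    obtain ⟨t, ht, _⟩ := hs i h
    omega
  | succ r ih =>
    -- subtracting `f` times the `r`-th Krylov vector removes the component of `v` at `r p`
    set f : LaurentPolynomial ℂ := v (r * p) * single (r * p : ℤ) 1 with hf
    have hfN : ∀ n, f.coeff n ≠ 0 → (N : ℤ) ∣ n := by
      intro n hn
      rw [hf, AddMonoidAlgebra.coeff_mul_single_apply, mul_one] at hn
      have := hv _ _ hn
      rw [← ZMod.intCast_zmod_eq_zero_iff_dvd, ← this]
      push_cast
      ring
    have hv' : ∀ i n, (v i - f * (bandMatrix p (openChain N p) ^ r) i 0).coeff n ≠ 0 →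
        i + (n : ZMod N) = 0 := by
      intro i n h
      by_contra hne
      apply h
      rw [AddMonoidAlgebra.coeff_sub, Finsupp.sub_apply, sub_eq_zero]
      have h1 : (v i).coeff n = 0 := by
        by_contra h1
        exact hne (hv i n h1)
      rw [h1, AddMonoidAlgebra.coeff_mul_apply_left, Finsupp.sum, Finset.sum_eq_zero]
      intro m hm
      rw [isGraded_bandMatrix_pow, mul_zero]
      intro h2
      apply hne
      rw [Finsupp.mem_support_iff] at hm
      have h3 := (ZMod.intCast_zmod_eq_zero_iff_dvd _ _).mpr (hfN m hm)
      rw [h2]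
      push_cast
      rw [h3]
      ring
    have hs' : ∀ i, v i - f * (bandMatrix p (openChain N p) ^ r) i 0 ≠ 0 →
        ∃ t < r, i = (t : ZMod N) * p := by
      intro i h
      by_contra hne
      have h1 : i ≠ r * p → (bandMatrix p (openChain N p) ^ r) i 0 = 0 := by
        intro hi
        by_contra h2
        obtain ⟨t, ht, hit⟩ := krylov_support hp r i h2
        rcases ht.lt_or_eq with ht | rfl
        · exact hne ⟨t, ht, hit⟩
        · exact hi hit
      by_cases hi : i = r * p
      · apply h
        rw [hi, krylov_top hp hcop r (by omega), hf, mul_assoc, AddMonoidAlgebra.single_mul_single,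
          add_neg_cancel, mul_one, ← AddMonoidAlgebra.one_def, mul_one, sub_self]
      · apply h
        rw [h1 hi, mul_zero, sub_zero]
        by_contra h2
        obtain ⟨t, ht, hit⟩ := hs i h2
        rcases (Nat.lt_succ_iff.mp ht).lt_or_eq with ht | rfl
        · exact hne ⟨t, ht, hit⟩
        · exact hi hit
    obtain ⟨F, hF, hFv⟩ := ih (by omega)
      (fun i => v i - f * (bandMatrix p (openChain N p) ^ r) i 0) hv' hs'
    refine ⟨Function.update F r f, ?_, ?_⟩
    · intro k n h
      by_cases hk : k = r
      · subst hk
        rw [Function.update_self] at h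
        exact hfN n h
      · rw [Function.update_of_ne hk] at h
        exact hF k n h
    · intro i
      rw [Finset.sum_range_succ, Function.update_self, ← sub_eq_iff_eq_add, hFv i]
      refine Finset.sum_congr rfl fun k hk => ?_
      rw [Function.update_of_ne (Finset.mem_range.mp hk).ne]

/-- The graded centralizer of the open chain consists of the polynomials of degree less than `N` in
the chain with coefficients in `ℂ[λ, λ⁻¹]`, `λ = w ^ N`, because `e_0` is a cyclic vector. -/
lemma exists_centralizer_expansion (hp : 0 < p) (hcop : Nat.Coprime N p)
    (Z : Matrix (ZMod N) (ZMod N) (LaurentPolynomial ℂ)) (hZ : IsGraded Z)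
    (hcomm : bandMatrix p (openChain N p) * Z = Z * bandMatrix p (openChain N p)) :
    ∃ F : ℕ → LaurentPolynomial ℂ, (∀ k n, (F k).coeff n ≠ 0 → (N : ℤ) ∣ n) ∧
      Z = ∑ k ∈ Finset.range N, F k • bandMatrix p (openChain N p) ^ k := by
  obtain ⟨F, hF, hFv⟩ := exists_krylov_expansion hp hcop N le_rfl (fun i => Z i 0)
    (fun i n h => by
      by_contra hne
      exact h (hZ i 0 n (Ne.symm hne)))
    (fun i _ => exists_mul_eq hcop i)
  refine ⟨F, hF, ?_⟩
  set M := bandMatrix p (openChain N p) with hM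
  -- `W` commutes with `M` and kills `e_0`, hence it kills all Krylov vectors of `e_0`
  set W := Z - ∑ k ∈ Finset.range N, F k • M ^ k with hW
  have hWM : Commute W M := by
    refine Commute.sub_left hcomm.symm ?_
    exact Commute.sum_left _ _ _ fun k _ => ((Commute.refl M).pow_left k).smul_left _
  have hW0 : ∀ i, W i 0 = 0 := by
    intro i
    rw [hW, Matrix.sub_apply, sub_eq_zero, hFv i, Matrix.sum_apply]
    rfl
  have hcol : ∀ t < N, ∀ i, W i ((t : ZMod N) * p) = 0 := by
    intro t
    induction t using Nat.strong_induction_on with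
    | _ t ih =>
      intro ht i
      have h1 : (W * M ^ t) i 0 = 0 := by
        rw [(hWM.pow_right t).eq, Matrix.mul_apply]
        exact Finset.sum_eq_zero fun j _ => by rw [hW0, mul_zero]
      rw [Matrix.mul_apply, Finset.sum_eq_single ((t : ZMod N) * p)] at h1
      · rw [krylov_top hp hcop t ht] at h1
        have h2 := congrArg (· * (single (t * p : ℤ) (1 : ℂ) : LaurentPolynomial ℂ)) h1
        simpa [mul_assoc, AddMonoidAlgebra.single_mul_single, ← AddMonoidAlgebra.one_def,
          -LaurentPolynomial.single_eq_C_mul_T] using h2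
      · intro j _ hj
        by_cases h2 : (M ^ t) j 0 = 0
        · rw [h2, mul_zero]
        · obtain ⟨t', ht', hjt⟩ := krylov_support hp t j h2
          rcases ht'.lt_or_eq with h3 | h3
          · rw [hjt, ih t' h3 (h3.trans ht), zero_mul]
          · exact absurd (by rw [hjt, h3]) hj
      · intro h
        exact absurd (Finset.mem_univ _) h
  rw [← sub_eq_zero]
  ext1 i l
  obtain ⟨t, ht, rfl⟩ := exists_mul_eq hcop l
  exact hcol t ht i

/-- The extreme coefficients of the powers `M^k`, `k < N`, of the open chain do not vanish and the
extreme degrees of the `λ^j M^k` are distinct, so the degree of a polynomial in the chain is the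
largest of the degrees of its terms; likewise for the lowest degree. -/
lemma coeff_eq_zero_of_degree (hp : 0 < p) (hcop : Nat.Coprime N p) {ε : ℤ}
    (hε : ε = 1 ∨ ε = -1) (F : ℕ → LaurentPolynomial ℂ)
    (hF : ∀ k n, (F k).coeff n ≠ 0 → (N : ℤ) ∣ n)
    (hZ : ∀ i l n, 0 < ε * n →
      ((∑ k ∈ Finset.range N, F k • bandMatrix p (openChain N p) ^ k) i l).coeff n = 0)
    (k : ℕ) (hk : k < N) (n : ℤ) (hn : 0 < ε * n + p * k) : (F k).coeff n = 0 := by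
  have hεε : ε * ε = 1 := by rcases hε with rfl | rfl <;> norm_num
  by_contra hne
  -- among the terms `w ^ n M ^ k` with non-zero coefficients, take one of extreme degree
  let T : Finset (ℕ × ℤ) := (Finset.range N).biUnion fun k => (F k).coeff.support.image (Prod.mk k)
  have hT : ∀ a : ℕ × ℤ, a ∈ T ↔ a.1 < N ∧ (F a.1).coeff a.2 ≠ 0 := by
    rintro ⟨a1, a2⟩
    simp only [T, Finset.mem_biUnion, Finset.mem_range, Finset.mem_image, Finsupp.mem_support_iff,
      Prod.mk.injEq]
    constructor
    · rintro ⟨_, h, _, h', rfl, rfl⟩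
      exact ⟨h, h'⟩
    · rintro ⟨h, h'⟩
      exact ⟨a1, h, a2, h', rfl, rfl⟩
  obtain ⟨⟨k₀, n₀⟩, hmem, hmax⟩ := T.exists_max_image (fun a => ε * a.2 + p * a.1)
    ⟨(k, n), (hT _).mpr ⟨hk, hne⟩⟩
  have hd : 0 < ε * n₀ + p * k₀ := lt_of_lt_of_le hn (hmax (k, n) ((hT _).mpr ⟨hk, hne⟩))
  rw [hT] at hmem
  obtain ⟨hk₀, hne₀⟩ := hmem
  simp only at hk₀ hne₀
  -- the coefficient of the term of extreme degree
  have h1 := hZ 0 (0 + (ε * (k₀ * p) : ℤ)) (n₀ + ε * (k₀ * p)) (by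
    rw [mul_add, ← mul_assoc, hεε]
    linarith)
  rw [Matrix.sum_apply, AddMonoidAlgebra.coeff_sum, Finset.sum_apply', Finset.sum_eq_single k₀] at h1
  · rw [Matrix.smul_apply, smul_eq_mul, AddMonoidAlgebra.coeff_mul_apply_left, Finsupp.sum,
      Finset.sum_eq_single n₀, neg_add_cancel_left, coeff_bandMatrix_pow_extreme _ hε,
      Finset.prod_eq_one, mul_one] at h1
    · exact hne₀ h1
    · intro t ht
      rw [Finset.mem_range] at ht
      rcases hε with rfl | rfl
      · rw [one_mul, openChain_pos hp, if_neg]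
        intro h
        have h2 : ((0 : ℕ) : ZMod N) * p = ((t + 1 : ℕ) : ZMod N) * p := by
          rw [eq_neg_iff_add_eq_zero] at h
          rw [Nat.cast_zero, zero_mul, ← h]
          push_cast
          ring
        have := natCast_mul_injOn hcop (Nat.zero_le _) (by omega) h2
        omega
      · rw [neg_one_mul, openChain_neg]
    · intro m hm hmn
      rw [Finsupp.mem_support_iff] at hm
      have h2 := hmax (k₀, m) ((hT _).mpr ⟨hk₀, hm⟩)
      simp only at h2
      rw [coeff_bandMatrix_pow_eq_zero, mul_zero]
      have h3 : k₀ * (p : ℤ) < ε * (-m + (n₀ + ε * (k₀ * p))) := by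
        have : ε * m ≠ ε * n₀ := fun h => hmn (by
          have := congrArg (ε * ·) h
          simpa [← mul_assoc, hεε] using this)
        rw [mul_add, mul_add, ← mul_assoc ε ε, hεε]
        have : ε * m < ε * n₀ := lt_of_le_of_ne (by linarith) this
        linarith
      zify
      rcases hε with rfl | rfl
      · exact lt_of_lt_of_le h3 (by rw [one_mul]; exact le_abs_self _)
      · exact lt_of_lt_of_le h3 (by rw [neg_one_mul]; exact neg_le_abs _)
    · intro h
      rw [Finsupp.mem_support_iff, not_not] at h
      rw [h, zero_mul]
  · intro k' hk' hkk
    rw [Matrix.smul_apply, smul_eq_mul, AddMonoidAlgebra.coeff_mul_apply_left, Finsupp.sum,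
      Finset.sum_eq_zero]
    intro m hm
    rw [Finset.mem_range] at hk'
    rw [Finsupp.mem_support_iff] at hm
    have h2 := hmax (k', m) ((hT _).mpr ⟨hk', hm⟩)
    simp only at h2
    rw [coeff_bandMatrix_pow_eq_zero, mul_zero]
    have h3 : ε * m + p * k' ≠ ε * n₀ + p * k₀ := by
      intro h
      have h4 := congrArg (Int.cast : ℤ → ZMod N) h
      push_cast at h4
      rw [(ZMod.intCast_zmod_eq_zero_iff_dvd _ _).mpr (hF k' m hm),
        (ZMod.intCast_zmod_eq_zero_iff_dvd _ _).mpr (hF k₀ n₀ hne₀), mul_zero, zero_add, zero_add,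
        mul_comm, mul_comm (p : ZMod N)] at h4
      rcases le_total k' k₀ with h5 | h5
      · exact hkk (natCast_mul_injOn hcop h5 (by omega) h4)
      · exact hkk (natCast_mul_injOn hcop h5 (by omega) h4.symm).symm
    have h4 : k' * (p : ℤ) < ε * (-m + (n₀ + ε * (k₀ * p))) := by
      rw [mul_add, mul_add, ← mul_assoc ε ε, hεε]
      have : ε * m + p * k' < ε * n₀ + p * k₀ := lt_of_le_of_ne h2 h3
      linarith
    zify
    rcases hε with rfl | rfl
    · exact lt_of_lt_of_le h4 (by rw [one_mul]; exact le_abs_self _)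
    · exact lt_of_lt_of_le h4 (by rw [neg_one_mul]; exact neg_le_abs _)
  · intro h
    exact absurd (Finset.mem_range.mpr hk₀) h

/-! ### The labels of the Hamiltonians -/

lemma not_dvd_mul (hcop : Nat.Coprime N p) {k : ℕ} (h1 : 0 < k) (h2 : k < N) : ¬ N ∣ p * k :=
  fun h => absurd (Nat.le_of_dvd h1 (hcop.dvd_of_dvd_mul_left h)) (by omega)

/-- As `p` and `N` are coprime, `k > ⌈|j| N / p⌉` means `|j| N < p (k - 1)`, that is, the gradient
`λ^j M^{k-1}` has both positive and negative degrees. -/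
lemma mem_hamiltonianLabels_iff (hp : 0 < p) (hcop : Nat.Coprime N p) (a : ℕ × ℤ) :
    a ∈ hamiltonianLabels N p ↔ 2 ≤ a.1 ∧ a.1 ≤ N ∧ a.2.natAbs * N < p * (a.1 - 1) := by
  obtain ⟨k, j⟩ := a
  have hN0 : 0 < N := Nat.pos_of_ne_zero (NeZero.ne N)
  have hp' : (0 : ℚ) < p := by exact_mod_cast hp
  simp only [hamiltonianLabels, Finset.mem_filter, Finset.mem_product, Finset.mem_Icc]
  have hceil : 1 ≤ k → (⌈((j.natAbs : ℚ) * N) / p⌉₊ < k ↔ j.natAbs * N ≤ p * (k - 1)) := by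
    intro hk
    obtain ⟨k, rfl⟩ : ∃ k', k = k' + 1 := ⟨k - 1, by omega⟩
    rw [Nat.lt_succ_iff, Nat.ceil_le, div_le_iff₀ hp', Nat.add_sub_cancel, mul_comm (k : ℚ)]
    norm_cast
  constructor
  · rintro ⟨⟨⟨h1, h2⟩, -⟩, h3⟩
    refine ⟨h1, h2, lt_of_le_of_ne ((hceil (by omega)).mp h3) fun h => ?_⟩
    exact not_dvd_mul hcop (k := k - 1) (by omega) (by omega) ⟨j.natAbs, by rw [← h, mul_comm]⟩
  · rintro ⟨h1, h2, h3⟩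
    refine ⟨⟨⟨h1, h2⟩, ?_⟩, (hceil (by omega)).mpr h3.le⟩
    have h4 : j.natAbs * N < p * N := h3.trans_le (Nat.mul_le_mul_left _ (by omega))
    have := Nat.lt_of_mul_lt_mul_right h4
    omega

lemma card_hamiltonianLabels (hp : 0 < p) (hcop : Nat.Coprime N p) :
    (hamiltonianLabels N p).card = p * (N - 1) := by
  have hN0 : 0 < N := Nat.pos_of_ne_zero (NeZero.ne N)
  rw [Finset.card_eq_sum_card_fiberwise (f := Prod.fst) (t := Finset.Ico 2 (N + 1))]
  swap
  · intro a ha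
    have := (mem_hamiltonianLabels_iff hp hcop a).mp ha
    simp only [Finset.coe_Ico, Set.mem_Ico]
    omega
  have hfib : ∀ k ∈ Finset.Ico 2 (N + 1),
      ((hamiltonianLabels N p).filter (fun a => a.1 = k)).card = 2 * (p * (k - 1) / N) + 1 := by
    intro k hk
    rw [Finset.mem_Ico] at hk
    set q := p * (k - 1) / N with hq
    have : (hamiltonianLabels N p).filter (fun a => a.1 = k) =
        (Finset.Icc (-(q : ℤ)) q).image (Prod.mk k) := by
      ext ⟨k', j⟩
      rw [Finset.mem_filter, mem_hamiltonianLabels_iff hp hcop, Finset.mem_image]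
      have hlt : j.natAbs * N < p * (k - 1) ↔ j.natAbs ≤ q := by
        rw [hq, Nat.le_div_iff_mul_le hN0]
        refine ⟨le_of_lt, fun h => lt_of_le_of_ne h fun h' => ?_⟩
        exact not_dvd_mul hcop (k := k - 1) (by omega) (by omega) ⟨j.natAbs, by rw [← h', mul_comm]⟩
      simp only [Finset.mem_Icc, Prod.mk.injEq]
      constructor
      · rintro ⟨⟨_, _, h3⟩, rfl⟩
        rw [hlt] at h3
        exact ⟨j, by omega, rfl, rfl⟩
      · rintro ⟨j', hj, rfl, rfl⟩
        exact ⟨⟨by omega, by omega, hlt.mpr (by omega)⟩, rfl⟩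
    rw [this, Finset.card_image_of_injective _ (Prod.mk_right_injective k), Int.card_Icc]
    omega
  rw [Finset.sum_congr rfl hfib, Finset.sum_Ico_eq_sum_range]
  have hsum : ∑ t ∈ Finset.range (N + 1 - 2), 2 * (p * (2 + t - 1) / N) =
      ∑ t ∈ Finset.range (N + 1 - 2), (p * (2 + t - 1) / N +
        p * (2 + (N + 1 - 2 - 1 - t) - 1) / N) := by
    rw [Finset.sum_add_distrib,
      Finset.sum_range_reflect (fun t => p * (2 + t - 1) / N) (N + 1 - 2), ← two_mul,
      Finset.mul_sum]
  rw [Finset.sum_add_distrib, hsum, ← Finset.sum_add_distrib,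
    Finset.sum_congr rfl (g := fun _ => p), Finset.sum_const, Finset.card_range, smul_eq_mul,
    mul_comm]
  · rfl
  · intro t ht
    rw [Finset.mem_range] at ht
    -- `⌊pk/N⌋ + ⌊p(N - k)/N⌋ = p - 1` for `0 < k < N`
    obtain ⟨k, hk⟩ : ∃ k, 2 + t - 1 = k := ⟨_, rfl⟩
    have hk' : 2 + (N + 1 - 2 - 1 - t) - 1 = N - k := by omega
    have hk0 : 0 < k := by omega
    have hkN : k < N := by omega
    rw [hk, hk']
    obtain ⟨l, rfl⟩ : ∃ l, N = k + l := ⟨N - k, by omega⟩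
    rw [Nat.add_sub_cancel_left]
    have h2 : 0 < p * k % (k + l) :=
      Nat.pos_of_ne_zero fun h => not_dvd_mul hcop hk0 hkN (Nat.dvd_of_mod_eq_zero h)
    have h3 := Nat.mod_lt (p * k) hN0
    have h4 := Nat.div_add_mod (p * k) (k + l)
    have h6 : p * k / (k + l) < p := Nat.div_lt_of_lt_mul (by rw [mul_comm (k + l)]; gcongr)
    generalize p * k / (k + l) = q at *
    generalize p * k % (k + l) = m at *
    have h5 : p * l = (k + l - m) + (k + l) * (p - 1 - q) := by
      zify [h3.le, (show 1 ≤ p by omega), (show q ≤ p - 1 by omega)]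
      have h4' : ((k : ℤ) + l) * q + m = p * k := by exact_mod_cast h4
      linear_combination h4'
    rw [h5, Nat.add_mul_div_left _ _ hN0, Nat.div_eq_of_lt (show k + l - m < k + l by omega)]
    omega

/-! ### Independence of the Hamiltonian vector fields at a point -/

lemma twoPiI_ne_zero : twoPiI ≠ 0 := by
  simp [twoPiI, Real.pi_ne_zero]

lemma eval_stdCoord (s : Mode N → ℂ) (u v : ZMod N) :
    eval s (stdCoord N u v) = (∑ x : Mode N, s x • sinBasis N x) u v := by
  rw [stdCoord, map_sum, Matrix.sum_apply]
  refine Finset.sum_congr rfl fun x _ => ?_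
  rw [map_mul, eval_C, eval_X, Matrix.smul_apply, smul_eq_mul, mul_comm]

lemma exists_eval_stdCoord (A : Matrix (ZMod N) (ZMod N) ℂ) (hA : Matrix.trace A = 0) :
    ∃ s : Mode N → ℂ, ∀ u v, eval s (stdCoord N u v) = A u v := by
  refine ⟨fun x => Matrix.trace (A * dualBasis N x), fun u v => ?_⟩
  rw [eval_stdCoord, sum_dualBasis_smul_sinBasis, hA, zero_mul, zero_smul, sub_zero]

/-- There is a point of the phase space at which the Lax matrix is the open chain. Its matrix `S̃` is
traceless since it has no diagonal entries. -/
lemma exists_eval_laxCoord (hp : 0 < p) (hpN : 2 * p < N) : ∃ s : Mode N → ℂ,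
    ∀ (n : ℤ) (i : ZMod N), n.natAbs ≤ p → eval s (laxCoord N p n i) = openChain N p n i := by
  have hne : ∀ m n : ℤ, m.natAbs ≤ p → n.natAbs ≤ p → m ≠ n → (m : ZMod N) ≠ n :=
    fun m n hm hn h h' => h (int_eq_of_cast_eq hpN hm hn h')
  let A : Matrix (ZMod N) (ZMod N) ℂ := Matrix.of fun u v =>
    if v - u = ((p : ℤ) : ZMod N) then twoPiI⁻¹ * openChain N p p (u - 1)
    else if v - u = ((-(p : ℤ) : ℤ) : ZMod N) then -twoPiI⁻¹ else 0
  have hA : ∀ n : ℤ, n.natAbs ≤ p → ∀ u v : ZMod N, v - u = n → A u v =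
      if n = p then twoPiI⁻¹ * openChain N p p (u - 1) else if n = -(p : ℤ) then -twoPiI⁻¹ else 0 := by
    intro n hn u v h
    simp only [A, Matrix.of_apply, h]
    by_cases h1 : n = p
    · rw [if_pos h1, if_pos (by rw [h1])]
    · rw [if_neg h1, if_neg (hne n p hn (by omega) h1)]
      by_cases h2 : n = -(p : ℤ)
      · rw [if_pos h2, if_pos (by rw [h2])]
      · rw [if_neg h2, if_neg (hne n _ hn (by omega) h2)]
  obtain ⟨s, hs⟩ := exists_eval_stdCoord A (by
    refine Finset.sum_eq_zero fun i _ => ?_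
    rw [Matrix.diag_apply, hA 0 (by simp) i i (by simp), if_neg (by omega), if_neg (by omega)])
  refine ⟨s, fun n i hn => ?_⟩
  have hc := twoPiI_ne_zero
  rcases lt_trichotomy n 0 with h0 | h0 | h0
  · rw [laxCoord_neg hn h0, map_neg, map_mul, eval_C, hs, hA n hn _ _ (by ring),
      if_neg (show ¬ n = p by omega)]
    simp only [openChain, if_neg (show ¬ n = p by omega)]
    by_cases h2 : n = -(p : ℤ)
    · simp only [if_pos h2]
      field_simp
      try simp
    · simp only [if_neg h2]
      simp
  · subst h0
    rw [laxCoord_zero, map_sum, openChain, if_neg (by omega), if_neg (by omega)]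
    refine Finset.sum_eq_zero fun l _ => ?_
    rw [map_mul, hs, hA 0 (by simp) l l (by simp), if_neg (by omega), if_neg (by omega), mul_zero]
  · rw [laxCoord_pos hn h0, map_mul, eval_C, hs, hA n hn _ _ (by ring)]
    by_cases h1 : n = p
    · rw [if_pos h1, h1, add_sub_cancel_right]
      field_simp
    · rw [if_neg h1, if_neg (by omega), openChain, if_neg (by omega), if_neg h1, mul_zero]

variable (N) in
/-- Evaluation of the coefficients at a point of the phase space. -/
def evalLaurent (s : Mode N → ℂ) :
    LaurentPolynomial (MvPolynomial (Mode N) ℂ) →+* LaurentPolynomial ℂ :=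
  AddMonoidAlgebra.mapRingHom ℤ (eval s)

lemma coeff_evalLaurent (s : Mode N → ℂ) (f : LaurentPolynomial (MvPolynomial (Mode N) ℂ)) (n : ℤ) :
    (evalLaurent N s f).coeff n = eval s (f.coeff n) := by
  simp [evalLaurent]

/-- Independence of the Lax flows at a point where the Lax matrix is the open chain: if a
combination `X = ∑ c_a X_a` of the gradients gives a zero vector field then `X` is a sum of elements
of the centralizer of non-positive and of non-negative degrees, which only involve terms
`λ^j M^k` with `|j| N ≥ p k`. -/
lemma eq_zero_of_sum_laxCoord_eq_zero (hp : 0 < p) (hpN : 2 * p < N) (hcop : Nat.Coprime N p)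
    {s : Mode N → ℂ}
    (hs : ∀ (n : ℤ) (i : ZMod N), n.natAbs ≤ p → eval s (laxCoord N p n i) = openChain N p n i)
    (c : ℕ × ℤ → ℂ)
    (hc : ∀ (n : ℤ) (i : ZMod N), n.natAbs ≤ p → ∑ a ∈ hamiltonianLabels N p, c a *
      eval s (poissonBracket (limitTensor N p) (laxHamiltonian N p a.1 a.2) (laxCoord N p n i)) = 0) :
    ∀ a ∈ hamiltonianLabels N p, c a = 0 := by
  set e := (evalLaurent N s).mapMatrix (m := ZMod N) with he
  have hcoeff : ∀ (Y : Matrix (ZMod N) (ZMod N) (LaurentPolynomial (MvPolynomial (Mode N) ℂ)))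
      (u v : ZMod N) (n : ℤ), (e Y u v).coeff n = eval s ((Y u v).coeff n) := by
    intro Y u v n
    rw [he, RingHom.mapMatrix_apply, Matrix.map_apply, coeff_evalLaurent]
  have hM : e (laxMatrix N p) = bandMatrix p (openChain N p) := by
    apply matrix_laurent_ext
    intro u v n
    rw [hcoeff, laxMatrix, coeff_bandMatrix, coeff_bandMatrix]
    split_ifs with h1 h2
    · rw [Finset.mem_Icc] at h1
      exact hs n u (by omega)
    · exact map_zero _
    · exact map_zero _
  set M := bandMatrix p (openChain N p) with hMdef
  let S (Y : ℕ → ℤ → Matrix (ZMod N) (ZMod N) (LaurentPolynomial (MvPolynomial (Mode N) ℂ))) :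
      Matrix (ZMod N) (ZMod N) (LaurentPolynomial ℂ) :=
    ∑ a ∈ hamiltonianLabels N p, (single 0 (c a) : LaurentPolynomial ℂ) • e (Y a.1 a.2)
  have hS : ∀ Y u v n, (S Y u v).coeff n =
      ∑ a ∈ hamiltonianLabels N p, c a * eval s ((Y a.1 a.2 u v).coeff n) := by
    intro Y u v n
    simp only [S]
    rw [Matrix.sum_apply, AddMonoidAlgebra.coeff_sum, Finset.sum_apply']
    refine Finset.sum_congr rfl fun a _ => ?_
    rw [coeff_single_smul, sub_zero, hcoeff]
  -- the combination `Z` of the second members of the Lax pairs commutes with `M`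
  set Z := S (laxPartner N p) with hZ
  have hcomm : M * Z = Z * M := by
    rw [← sub_eq_zero]
    obtain ⟨Y, hY⟩ : ∃ Y : ℕ → ℤ → Matrix (ZMod N) (ZMod N)
        (LaurentPolynomial (MvPolynomial (Mode N) ℂ)), ∀ k j, Y k j = (laxMatrix N p).map
        (hamDerivation (limitTensor N p) (laxHamiltonian N p k j)).laurent := ⟨_, fun _ _ => rfl⟩
    have h1 : M * Z - Z * M = S Y := by
      simp only [hZ, S, hY, lax_equation hpN, map_sub, map_mul, hM, Finset.mul_sum, Finset.sum_mul,
        ← Finset.sum_sub_distrib, smul_sub, mul_smul_comm, smul_mul_assoc]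
    rw [h1]
    apply matrix_laurent_ext
    intro u v n
    rw [hS]
    simp only [hY, Matrix.map_apply, Derivation.laurent_coeff, laxMatrix, coeff_bandMatrix]
    by_cases h2 : n ∈ Finset.Icc (-(p : ℤ)) p
    · by_cases h3 : v = u + n
      · simp only [h2, h3, if_true, hamDerivation_apply]
        rw [Finset.mem_Icc] at h2
        exact hc n u (by omega)
      · simp [h3]
    · simp [h2]
  have hgr : IsGraded Z := by
    intro u v n h
    rw [hZ, hS]
    refine Finset.sum_eq_zero fun a _ => ?_
    rw [isGraded_laxPartner _ _ u v n h, map_zero, mul_zero]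
  obtain ⟨F, hF, hZF⟩ := exists_centralizer_expansion hp hcop Z hgr hcomm
  have hZpos : ∀ i l n, 0 < (1 : ℤ) * n → (Z i l).coeff n = 0 := by
    intro i l n hn
    rw [hZ, hS]
    refine Finset.sum_eq_zero fun a _ => ?_
    rw [coeff_laxPartner, if_neg (by omega), if_neg (c := n = 0) (by omega)]
    simp
  -- the combination `X` of the gradients
  set X := S (laxGradient N p) with hX
  let G : ℕ → LaurentPolynomial ℂ := fun k =>
    ∑ a ∈ hamiltonianLabels N p, if a.1 - 1 = k then single (a.2 * N) (c a * a.1) else 0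
  have hXG : X = ∑ k ∈ Finset.range N, G k • M ^ k := by
    simp only [hX, S, G, Finset.sum_smul]
    rw [Finset.sum_comm]
    refine Finset.sum_congr rfl fun a ha => ?_
    have ha' := (mem_hamiltonianLabels_iff hp hcop a).mp ha
    rw [Finset.sum_eq_single (a.1 - 1), if_pos rfl]
    · apply matrix_laurent_ext
      intro u v n
      rw [coeff_single_smul, sub_zero, hcoeff, laxGradient, coeff_single_smul, coeff_single_smul,
        map_mul, ← hcoeff, map_pow, hM, map_natCast, mul_assoc]
    · intro k _ hk
      rw [if_neg (Ne.symm hk), zero_smul]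
    · intro h
      rw [Finset.mem_range] at h
      omega
  have hGdvd : ∀ k n, (G k).coeff n ≠ 0 → (N : ℤ) ∣ n := by
    intro k n h
    by_contra hd
    apply h
    simp only [G]
    rw [AddMonoidAlgebra.coeff_sum, Finset.sum_apply']
    refine Finset.sum_eq_zero fun a _ => ?_
    split_ifs
    · rw [laurent_coeff_single, if_neg]
      rintro rfl
      exact hd ⟨a.2, mul_comm _ _⟩
    · rfl
  set γ : LaurentPolynomial ℂ := single 0 (twoPiI * N) with hγ
  have hdiff : ∑ k ∈ Finset.range N, (F k - γ * G k) • M ^ k = Z - γ • X := by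
    rw [hZF, hXG, Finset.smul_sum, ← Finset.sum_sub_distrib]
    refine Finset.sum_congr rfl fun k _ => ?_
    rw [sub_smul, mul_smul]
  have hγG : ∀ k n, (γ * G k).coeff n = twoPiI * N * (G k).coeff n := by
    intro k n
    rw [hγ, AddMonoidAlgebra.coeff_single_mul_apply, neg_zero, zero_add]
  have hneg : ∀ i l n, 0 < (-1 : ℤ) * n → ((Z - γ • X) i l).coeff n = 0 := by
    intro i l n hn
    rw [Matrix.sub_apply, AddMonoidAlgebra.coeff_sub, Finsupp.sub_apply, hγ, coeff_single_smul,
      sub_zero, hZ, hX, hS, hS, Finset.mul_sum, ← Finset.sum_sub_distrib]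
    refine Finset.sum_eq_zero fun a _ => ?_
    rw [coeff_laxPartner, if_pos (by omega), if_neg (c := n = 0) (by omega)]
    simp only [ite_self, add_zero, map_mul, eval_C]
    ring
  intro a ha
  obtain ⟨h2, hN, hlt⟩ := (mem_hamiltonianLabels_iff hp hcop a).mp ha
  have hlt' : |a.2 * N| < (p : ℤ) * (a.1 - 1 : ℕ) := by
    rw [abs_mul, Int.abs_eq_natAbs, Nat.abs_cast]
    exact_mod_cast hlt
  have hFa : (F (a.1 - 1)).coeff (a.2 * N) = 0 := by
    refine coeff_eq_zero_of_degree hp hcop (Or.inl rfl) F hF ?_ _ (by omega) _ ?_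
    · rw [← hZF]
      exact hZpos
    · have := neg_abs_le (a.2 * (N : ℤ))
      linarith
  have hFGa : (F (a.1 - 1) - γ * G (a.1 - 1)).coeff (a.2 * N) = 0 := by
    refine coeff_eq_zero_of_degree hp hcop (Or.inr rfl) (fun k => F k - γ * G k) ?_ ?_ _
      (by omega) _ ?_
    · intro k n h
      by_contra hd
      apply h
      rw [AddMonoidAlgebra.coeff_sub, Finsupp.sub_apply, hγG,
        not_not.mp (mt (hF k n) hd), not_not.mp (mt (hGdvd k n) hd), mul_zero, sub_zero]
    · rw [hdiff]
      exact hneg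
    · have := le_abs_self (a.2 * (N : ℤ))
      linarith
  rw [AddMonoidAlgebra.coeff_sub, Finsupp.sub_apply, hFa, zero_sub, neg_eq_zero, hγG] at hFGa
  have hGa : (G (a.1 - 1)).coeff (a.2 * N) = c a * a.1 := by
    simp only [G]
    rw [AddMonoidAlgebra.coeff_sum, Finset.sum_apply', Finset.sum_eq_single a]
    · rw [if_pos rfl, laurent_coeff_single, if_pos rfl]
    · intro b hb hba
      have hb' := (mem_hamiltonianLabels_iff hp hcop b).mp hb
      split_ifs with h
      · rw [laurent_coeff_single, if_neg]
        intro h'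
        apply hba
        refine Prod.ext (by omega) ?_
        exact mul_right_cancel₀ (b := (N : ℤ)) (by exact_mod_cast NeZero.ne N) h'
      · rfl
    · intro h
      exact absurd ha h
  rw [hGa] at hFGa
  have h1 : (a.1 : ℂ) ≠ 0 := by
    rw [Nat.cast_ne_zero]
    omega
  have h3 := natCast_ne_zero' N
  have h4 := twoPiI_ne_zero
  simpa [h1, h3, h4] using hFGa

/-- At some point the chosen Hamiltonian vectors are independent, even when tested only on the
generators of `𝒮₂`. -/
lemma linearIndependent_band_at (hp : 0 < p) (hpN : 2 * p < N) (hcop : Nat.Coprime N p) :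
    ∃ s : Mode N → ℂ, LinearIndependent ℂ fun a : hamiltonianLabels N p =>
      hamiltonianVector (limitTensor N p) (bandCoord N p) (laxHamiltonian N p a.1.1 a.1.2) s := by
  classical
  obtain ⟨s, hs⟩ := exists_eval_laxCoord (N := N) hp hpN
  refine ⟨s, ?_⟩
  rw [Fintype.linearIndependent_iff]
  intro c hc
  let c' : ℕ × ℤ → ℂ := fun a => if h : a ∈ hamiltonianLabels N p then c ⟨a, h⟩ else 0
  have hsum : ∀ f : ℕ × ℤ → ℂ, ∑ a ∈ hamiltonianLabels N p, c' a * f a =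
      ∑ a : hamiltonianLabels N p, c a * f a.1 := by
    intro f
    rw [← Finset.sum_coe_sort]
    refine Finset.sum_congr rfl fun a _ => ?_
    simp [c']
  have hstd : ∀ (m : ℤ) (u v : ZMod N), m.natAbs ≤ p → v - u = m →
      ∑ a ∈ hamiltonianLabels N p, c' a * eval s (poissonBracket (limitTensor N p)
        (laxHamiltonian N p a.1 a.2) (stdCoord N u v)) = 0 := by
    intro m u v hm h
    rw [hsum fun a => eval s (poissonBracket (limitTensor N p)
        (laxHamiltonian N p a.1 a.2) (stdCoord N u v))]
    have := congrFun hc ⟨(u, v), (band_iff hpN _).mpr ⟨m, hm, h⟩⟩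
    rw [Finset.sum_apply] at this
    exact this
  have key := eq_zero_of_sum_laxCoord_eq_zero hp hpN hcop hs c' ?_
  · intro a
    have := key a.1 a.2
    simpa [c'] using this
  · intro n i hn
    rcases lt_trichotomy n 0 with h0 | rfl | h0
    · simp only [laxCoord_neg hn h0, ← neg_mul, ← C_neg, poissonBracket_C_mul_right, map_mul,
        eval_C, mul_left_comm (c' _)]
      rw [← Finset.mul_sum, hstd n _ _ hn (by ring), mul_zero]
    · simp only [laxCoord_zero, poissonBracket_sum_right, poissonBracket_C_mul_right, map_mul,
        eval_C, map_sum, Finset.mul_sum]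
      rw [Finset.sum_comm]
      refine Finset.sum_eq_zero fun l _ => ?_
      simp only [mul_left_comm (c' _)]
      rw [← Finset.mul_sum, hstd 0 _ _ hn (by simp), mul_zero]
    · simp only [laxCoord_pos hn h0, poissonBracket_C_mul_right, map_mul,
        eval_C, mul_left_comm (c' _)]
      rw [← Finset.mul_sum, hstd n _ _ hn (by ring), mul_zero]

/-! ### The corank of the limiting Poisson tensor -/

variable (p) in
/-- The bracket `{S_{i, i + n}, S_{k, k + m}}` at a point with matrix `S`, for the labels
`a = (i, n)` and `b = (k, m)`. -/
def chainForm (S : ZMod N → ZMod N → ℂ) (a b : ZMod N × ZMod N) : ℂ :=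
  if shiftLen N p a.2 + shiftLen N p b.2 = shiftLen N p (a.2 + b.2) then
    N * ((if a.1 = b.1 + b.2 then S b.1 (a.1 + a.2) else 0) -
      if b.1 = a.1 + a.2 then S a.1 (b.1 + b.2) else 0) else 0

lemma eval_bracket_stdCoord (hpN : 2 * p < N) (s : Mode N → ℂ) (i j k l : ZMod N) :
    eval s (poissonBracket (limitTensor N p) (stdCoord N i j) (stdCoord N k l)) =
      chainForm p (fun u v => eval s (stdCoord N u v)) (i, j - i) (k, l - k) := by
  rw [poissonBracket_stdCoord, chainForm]
  simp only [scalingExp_add_eq_iff hpN, add_sub_cancel]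
  split_ifs <;> simp

lemma shiftLen_neg (n : ZMod N) : shiftLen N p (-n) = shiftLen N p n := by
  unfold shiftLen
  rw [ZMod.neg_val]
  have := ZMod.val_lt n
  split_ifs with h0
  · simp [h0]
  · omega

lemma shiftLen_zero : shiftLen N p 0 = 0 := by
  simp [shiftLen]

lemma shiftLen_pos (hp : 0 < p) {n : ZMod N} (hn : n ≠ 0) : 0 < shiftLen N p n := by
  have h1 := ZMod.val_lt n
  have h2 : n.val ≠ 0 := by rwa [Ne, ZMod.val_eq_zero]
  unfold shiftLen
  omega

lemma shiftLen_le (n : ZMod N) : shiftLen N p n ≤ p := min_le_right _ _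

lemma exists_intCast_of_shiftLen_lt {n : ZMod N} (hn : shiftLen N p n < p) :
    ∃ m : ℤ, m.natAbs < p ∧ n = m := by
  have h1 := ZMod.val_lt n
  unfold shiftLen at hn
  rcases le_or_gt p n.val with h | h
  · refine ⟨(n.val : ℤ) - N, by omega, ?_⟩
    rw [Int.cast_sub, Int.cast_natCast, ZMod.natCast_zmod_val]
    simp
  · exact ⟨n.val, by omega, by rw [Int.cast_natCast, ZMod.natCast_zmod_val]⟩

lemma chainForm_neg (S : ZMod N → ZMod N → ℂ) (i n k m : ZMod N) :
    chainForm p S (-i, -n) (-k, -m) =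
      chainForm p (fun u v => S (-u) (-v)) (i, n) (k, m) := by
  have h1 : -i = -k + -m ↔ i = k + m := by rw [← neg_add, neg_inj]
  have h2 : -k = -i + -n ↔ k = i + n := by rw [← neg_add, neg_inj]
  simp only [chainForm, ← neg_add, shiftLen_neg, neg_inj]

lemma sum_chainForm_right (S : ZMod N → ZMod N → ℂ) (a : ZMod N × ZMod N) :
    ∑ k, chainForm p S a (k, 0) = 0 := by
  simp [chainForm, shiftLen_zero, ← Finset.mul_sum, Finset.sum_sub_distrib]

lemma sum_chainForm_left (S : ZMod N → ZMod N → ℂ) (b : ZMod N × ZMod N) :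
    ∑ i, chainForm p S (i, 0) b = 0 := by
  simp [chainForm, shiftLen_zero, ← Finset.mul_sum, Finset.sum_sub_distrib]

lemma chainForm_eq_zero_of_shiftLen (hp : 0 < p) (S : ZMod N → ZMod N → ℂ) {i n k m : ZMod N}
    (hn : shiftLen N p n = p) (hm : m ≠ 0) : chainForm p S (i, n) (k, m) = 0 := by
  rw [chainForm, if_neg]
  have := shiftLen_pos hp hm
  have := shiftLen_le (p := p) (n + m)
  simp only
  omega

/-- The differentials of the Casimir functions of the upper half of the band: the matrix
`x = λ^{-a} M_+^t`, where `M_+` is the part of positive shifts, has only negative degrees, the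
highest of them `p t - a N = - r`, and commutes with `M_+`. -/
lemma exists_chainForm_relation (hp : 0 < p) (hpN : 2 * p < N) (hcop : Nat.Coprime N p)
    (S : ZMod N → ZMod N → ℂ) (hS : ∀ i, S i (i + p) ≠ 0) {r : ℕ} (hr : 0 < r) (hrp : r < p) :
    ∃ y : ZMod N → ℤ → ℂ, y 0 r ≠ 0 ∧ ∀ k m : ZMod N, m ≠ 0 →
      ∑ n ∈ Finset.Icc (r : ℤ) p, ∑ i, y i n * chainForm p S (i, (n : ZMod N)) (k, m) = 0 := by
  -- `t p + r = a N`; the relation has the coefficients of `λ ^ (-a) M_+ ^ t`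
  obtain ⟨t, htN, ht⟩ := exists_mul_eq hcop (-(r : ZMod N))
  obtain ⟨a, ha⟩ : ∃ a : ℤ, (t * p : ℤ) + r = a * N := by
    have h1 : (((t * p : ℤ) + r : ℤ) : ZMod N) = 0 := by
      push_cast
      rw [← ht]
      ring
    rw [ZMod.intCast_zmod_eq_zero_iff_dvd] at h1
    obtain ⟨a, ha⟩ := h1
    exact ⟨a, by rw [ha, mul_comm]⟩
  let b : ℤ → ZMod N → ℂ := fun n i => if 0 < n then S i (i + n) else 0
  set M := bandMatrix p b with hM
  let y : ZMod N → ℤ → ℂ := fun i n => ((M ^ t) (i + n) i).coeff (a * N - n)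
  have hcast : ((a * N : ℤ) : ZMod N) = 0 := by simp
  have hy0 : ∀ i n, n < (r : ℤ) → y i n = 0 := by
    intro i n h
    refine coeff_bandMatrix_pow_eq_zero b t _ _ _ ?_
    zify
    rw [← ha]
    exact lt_of_lt_of_le (by linarith) (le_abs_self _)
  refine ⟨y, ?_, ?_⟩
  · have h1 := coeff_bandMatrix_pow_extreme (p := p) b (Or.inl rfl) t (r : ZMod N)
    have h2 : (a * N - (r : ℤ)) = 1 * (t * p) := by linarith
    have h3 : (r : ZMod N) + ((1 * (t * p) : ℤ) : ZMod N) = 0 := by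
      push_cast
      rw [one_mul, ← ht]
      ring
    simp only [y]
    rw [h2, zero_add, Int.cast_natCast]
    rw [h3] at h1
    rw [hM, h1]
    refine Finset.prod_ne_zero_iff.mpr fun t' _ => ?_
    simp only [b]
    rw [if_pos (by omega)]
    simpa using hS _
  · intro k m hm
    by_cases hm' : ∃ m' : ℤ, 0 < m' ∧ m' ≤ p ∧ m = m'
    swap
    · refine Finset.sum_eq_zero fun n hn => Finset.sum_eq_zero fun i _ => ?_
      rw [Finset.mem_Icc] at hn
      rcases lt_or_ge (shiftLen N p m) p with h | h
      · obtain ⟨m', h1, rfl⟩ := exists_intCast_of_shiftLen_lt h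
        have hne : m' ≠ 0 := by rintro rfl; simp at hm
        have hneg : m' < 0 := by
          by_contra h2
          exact hm' ⟨m', by omega, by omega, rfl⟩
        rw [chainForm, if_neg, mul_zero]
        rw [← Int.cast_add, shiftLen_intCast (by omega), shiftLen_intCast (by omega),
          shiftLen_intCast (by omega)]
        omega
      · rw [chainForm, if_neg, mul_zero]
        have h2 := shiftLen_le (p := p) ((n : ZMod N) + m)
        have h3 : shiftLen N p (n : ZMod N) = min (min n.natAbs (N - n.natAbs)) p :=
          shiftLen_intCast (by omega)
        simp only
        omega
    · obtain ⟨m', hm0, hmp, rfl⟩ := hm'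
      -- the relation at `(k, m')` is an entry of the identity `M_+ M_+ ^ t = M_+ ^ t M_+`
      have hcomm : (((M * M ^ t) k (k + m')).coeff (a * N + m')) -
          (((M ^ t * M) k (k + m')).coeff (a * N + m')) = 0 := by
        rw [← pow_succ', ← pow_succ, sub_self]
      rw [hM, coeff_bandMatrix_mul, coeff_mul_bandMatrix, ← Finset.sum_sub_distrib] at hcomm
      rw [← mul_zero (N : ℂ), ← hcomm, Finset.mul_sum]
      set G : ℤ → ℂ := fun d => N * (b d k * ((M ^ t) (k + d) (k + m')).coeff (a * N + m' - d) -
        ((M ^ t) k (k + m' - d)).coeff (a * N + m' - d) * b d (k + m' - d)) with hG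
      have hGy : ∀ n : ℤ, G (n + m') = N * (b (n + m') k * y (k + m') n -
          y (k - n) n * b (n + m') (k - n)) := by
        intro n
        have e1 : a * N + m' - (n + m') = a * N - n := by ring
        have e2 : k + ((n + m' : ℤ) : ZMod N) = k + m' + n := by push_cast; ring
        have e3 : k + (m' : ZMod N) - ((n + m' : ℤ) : ZMod N) = k - n := by push_cast; ring
        simp only [hG, y, e1, e2, e3, sub_add_cancel]
      have hinner : ∀ n ∈ Finset.Icc (r : ℤ) (p - m'),
          ∑ i, y i n * chainForm p S (i, (n : ZMod N)) (k, (m' : ZMod N)) = G (n + m') := by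
        intro n hn
        rw [Finset.mem_Icc] at hn
        have h1 : shiftLen N p (n : ZMod N) + shiftLen N p (m' : ZMod N) =
            shiftLen N p ((n : ZMod N) + m') := by
          rw [← Int.cast_add, shiftLen_intCast (by omega), shiftLen_intCast (by omega),
            shiftLen_intCast (by omega)]
          omega
        have h2 : ∀ i : ZMod N, k = i + n ↔ i = k - n := fun i =>
          ⟨fun h => by rw [h]; ring, fun h => by rw [h]; ring⟩
        have e1 : k + ((n + m' : ℤ) : ZMod N) = k + m' + n := by push_cast; ring
        have e2 : k - (n : ZMod N) + ((n + m' : ℤ) : ZMod N) = k + m' := by push_cast; ring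
        simp only [chainForm, h1, if_true, h2, hGy, b, if_pos (show 0 < n + m' by omega), mul_sub,
          Finset.sum_sub_distrib, mul_ite, mul_zero, Finset.sum_ite_eq', Finset.mem_univ, e1, e2]
        ring
      -- both sums run over the shifts `n` with `r ≤ n ≤ p - m'`
      rw [← Finset.sum_subset (s₁ := Finset.Icc (r : ℤ) (p - m'))
        (Finset.Icc_subset_Icc_right (by omega)), Finset.sum_congr rfl hinner,
        ← Finset.sum_subset (s₁ := Finset.Icc (r + m' : ℤ) p) (s₂ := Finset.Icc (-(p : ℤ)) p)
        (f := G) (Finset.Icc_subset_Icc_left (by omega))]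
      · refine Finset.sum_bij (fun n _ => n + m') ?_ ?_ ?_ fun _ _ => rfl
        · intro n hn
          rw [Finset.mem_Icc] at *
          omega
        · intro _ _ _ _ h
          exact add_right_cancel h
        · intro d hd
          rw [Finset.mem_Icc] at hd
          exact ⟨d - m', Finset.mem_Icc.mpr (by omega), by ring⟩
      · intro d hd hd'
        rw [Finset.mem_Icc] at hd hd'
        obtain ⟨n, rfl⟩ : ∃ n, d = n + m' := ⟨d - m', by ring⟩
        rw [hGy, hy0 _ _ (by omega), hy0 _ _ (by omega)]
        ring
      · intro n hn hn'
        rw [Finset.mem_Icc] at hn hn'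
        refine Finset.sum_eq_zero fun i _ => ?_
        rw [chainForm, if_neg, mul_zero]
        rw [← Int.cast_add, shiftLen_intCast (by omega), shiftLen_intCast (by omega),
          shiftLen_intCast (by omega)]
        omega

/-- The rank of the limiting Poisson tensor is at most `2 p (N - 1)`: the rows with label
`(i, n)`, `i ≠ 0`, `|n| < p`, together with the vectors supported on the labels `(k, 0)` with
vanishing sum, span all rows. -/
lemma rank_chainForm_le (hp : 0 < p) (hpN : 2 * p < N) (hcop : Nat.Coprime N p)
    (S : ZMod N → ZMod N → ℂ) (hS : ∀ i, S i (i + p) ≠ 0) (hS' : ∀ i, S i (i - p) ≠ 0) :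
    (Matrix.of (chainForm p S)).rank ≤ 2 * p * (N - 1) := by
  classical
  let row (i n : ZMod N) : ZMod N × ZMod N → ℂ := chainForm p S (i, n)
  let δ (k : ZMod N) : ZMod N × ZMod N → ℂ := Pi.single (k, 0) 1 - Pi.single (0, 0) 1
  let G : Finset (ZMod N × ZMod N → ℂ) :=
    ((Finset.univ.erase (0 : ZMod N)) ×ˢ Finset.Ioo (-(p : ℤ)) p).image (fun a => row a.1 a.2) ∪
    (Finset.univ.erase (0 : ZMod N)).image δ
  set U := Submodule.span ℂ (G : Set (ZMod N × ZMod N → ℂ)) with hU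
  have hcard : G.card ≤ 2 * p * (N - 1) := by
    refine (Finset.card_union_le _ _).trans ?_
    refine (add_le_add Finset.card_image_le Finset.card_image_le).trans ?_
    rw [Finset.card_product, Int.card_Ioo, Finset.card_erase_of_mem (Finset.mem_univ _),
      Finset.card_univ, ZMod.card, show ((p : ℤ) - -p - 1).toNat = 2 * p - 1 by omega]
    obtain ⟨q, hq⟩ : ∃ q, 2 * p = q + 1 := ⟨2 * p - 1, by omega⟩
    rw [hq, Nat.add_sub_cancel, add_mul, one_mul, mul_comm]
  have hrow : ∀ i : ZMod N, i ≠ 0 → ∀ n : ℤ, n.natAbs < p → row i n ∈ U := by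
    intro i hi n hn
    refine Submodule.subset_span (Finset.mem_coe.mpr (Finset.mem_union_left _
      (Finset.mem_image.mpr ⟨(i, n), ?_, rfl⟩)))
    simp only [Finset.mem_product, Finset.mem_erase, Finset.mem_univ, and_true, Finset.mem_Ioo]
    exact ⟨hi, by omega⟩
  have hδ : ∀ k, δ k ∈ U := by
    intro k
    by_cases hk : k = 0
    · rw [hk]
      simp [δ]
    · exact Submodule.subset_span (Finset.mem_coe.mpr (Finset.mem_union_right _
        (Finset.mem_image.mpr ⟨k, by simp [hk], rfl⟩)))
  have hcol : ∀ f : ZMod N × ZMod N → ℂ, (∀ k m, m ≠ 0 → f (k, m) = 0) → ∑ k, f (k, 0) = 0 →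
      f ∈ U := by
    intro f h1 h2
    have : f = ∑ k, f (k, 0) • δ k := by
      have h3 : ∑ k, f (k, 0) • δ k =
          ∑ k, f (k, 0) • (Pi.single (k, 0) 1 : ZMod N × ZMod N → ℂ) := by
        simp only [δ, smul_sub, Finset.sum_sub_distrib]
        rw [← Finset.sum_smul, h2, zero_smul, sub_zero]
      rw [h3]
      ext ⟨k, m⟩
      rw [Finset.sum_apply]
      by_cases hm : m = 0
      · subst hm
        rw [Finset.sum_eq_single k] <;> simp +contextual [eq_comm]
      · simp [hm, h1]
    rw [this]
    exact Submodule.sum_mem _ fun k _ => Submodule.smul_mem _ _ (hδ k)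
  have hzero : ∀ i, row i 0 ∈ U := by
    intro i
    by_cases hi : i = 0
    · have h1 : row 0 0 = -∑ j ∈ Finset.univ.erase 0, row j 0 := by
        rw [eq_neg_iff_add_eq_zero, Finset.add_sum_erase _ (fun j => row j 0) (Finset.mem_univ _)]
        ext b
        rw [Finset.sum_apply]
        exact sum_chainForm_left S b
      rw [hi, h1]
      refine Submodule.neg_mem _ (Submodule.sum_mem _ fun j hj => ?_)
      simpa using hrow j (Finset.ne_of_mem_erase hj) 0 (by simpa using hp)
    · simpa using hrow i hi 0 (by simpa using hp)
  have hbig : ∀ i n, shiftLen N p n = p → row i n ∈ U := fun i n hn =>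
    hcol _ (fun k m hm => chainForm_eq_zero_of_shiftLen hp S hn hm) (sum_chainForm_right S _)
  -- the rows of positive (`ε = 1`) and negative shifts, by downward induction on the shift
  have hband : ∀ ε : ℤ, ε = 1 ∨ ε = -1 → ∀ d r : ℕ, r + d = p → 0 < r →
      ∀ i, row i ((ε * r : ℤ) : ZMod N) ∈ U := by
    intro ε hε d
    induction d using Nat.strong_induction_on with
    | _ d ih =>
      intro r hrd hr i
      by_cases hd : d = 0
      · refine hbig _ _ ?_
        rw [shiftLen_intCast] <;> rcases hε with rfl | rfl <;> omega
      by_cases hi : i = 0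
      swap
      · exact hrow i hi _ (by rcases hε with rfl | rfl <;> omega)
      obtain ⟨y, hy0, hy⟩ : ∃ y : ZMod N → ℤ → ℂ, y 0 r ≠ 0 ∧ ∀ k m : ZMod N, m ≠ 0 →
          ∑ n ∈ Finset.Icc (r : ℤ) p, ∑ i, y i n * row i ((ε * n : ℤ) : ZMod N) (k, m) = 0 := by
        rcases hε with rfl | rfl
        · simpa using exists_chainForm_relation hp hpN hcop S hS hr (by omega)
        · obtain ⟨y, hy0, hy⟩ := exists_chainForm_relation hp hpN hcop
            (fun u v => S (-u) (-v)) (fun i => by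
              have := hS' (-i)
              rwa [← neg_add'] at this) hr (by omega)
          refine ⟨fun i n => y (-i) n, by simpa using hy0, fun k m hm => ?_⟩
          rw [← hy (-k) (-m) (neg_ne_zero.mpr hm)]
          refine Finset.sum_congr rfl fun n _ => ?_
          rw [← Equiv.sum_comp (Equiv.neg (ZMod N))]
          refine Finset.sum_congr rfl fun i _ => ?_
          have := chainForm_neg (p := p) S i n (-k) (-m)
          rw [neg_neg, neg_neg] at this
          simp only [Equiv.neg_apply, neg_neg, row, ← this]
          simp
      have hmem : ∑ n ∈ Finset.Icc (r : ℤ) p, ∑ i, y i n • row i ((ε * n : ℤ) : ZMod N) ∈ U := by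
        refine hcol _ (fun k m hm => ?_) ?_
        · simpa [Finset.sum_apply] using hy k m hm
        · simp only [Finset.sum_apply, Pi.smul_apply, smul_eq_mul]
          rw [Finset.sum_comm]
          refine Finset.sum_eq_zero fun n _ => ?_
          rw [Finset.sum_comm]
          refine Finset.sum_eq_zero fun i _ => ?_
          rw [← Finset.mul_sum, sum_chainForm_right, mul_zero]
      rw [← Finset.add_sum_erase _ _ (Finset.mem_Icc.mpr ⟨le_refl (r : ℤ), by omega⟩),
        ← Finset.add_sum_erase _ _ (Finset.mem_univ (0 : ZMod N)), add_assoc] at hmem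
      have hrest := (Submodule.add_mem_iff_left U ?_).mp hmem
      · rw [hi]
        exact (Submodule.smul_mem_iff _ hy0).mp hrest
      · refine Submodule.add_mem _ (Submodule.sum_mem _ fun j hj => Submodule.smul_mem _ _ ?_)
          (Submodule.sum_mem _ fun n hn => Submodule.sum_mem _ fun j _ => Submodule.smul_mem _ _ ?_)
        · exact hrow j (Finset.ne_of_mem_erase hj) _ (by rcases hε with rfl | rfl <;> omega)
        · rw [Finset.mem_erase, Finset.mem_Icc] at hn
          obtain ⟨n', rfl⟩ : ∃ n' : ℕ, n = n' := ⟨n.toNat, by omega⟩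
          exact ih (p - n') (by omega) n' (by omega) (by omega) j
  have hall : ∀ i n, row i n ∈ U := by
    intro i n
    rcases (shiftLen_le (p := p) n).lt_or_eq with h | h
    · obtain ⟨m, h1, rfl⟩ := exists_intCast_of_shiftLen_lt h
      rcases lt_trichotomy m 0 with h0 | rfl | h0
      · have := hband (-1) (Or.inr rfl) (p - m.natAbs) m.natAbs (by omega) (by omega) i
        rwa [show (-1 * (m.natAbs : ℤ)) = m by omega] at this
      · simpa using hzero i
      · have := hband 1 (Or.inl rfl) (p - m.natAbs) m.natAbs (by omega) (by omega) i
        rwa [show (1 * (m.natAbs : ℤ)) = m by omega] at this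
    · exact hbig i n h
  rw [Matrix.rank_eq_finrank_span_row]
  refine (Submodule.finrank_mono (t := U) (Submodule.span_le.mpr ?_)).trans
    ((finrank_span_finset_le_card G).trans hcard)
  rintro _ ⟨⟨i, n⟩, rfl⟩
  exact hall i n

/-! ### Jacobian matrices, ranks of bracket matrices and genericity -/

section Rank

variable {σ ι ι' κ : Type*} [Fintype σ]

/-- The Jacobian matrix of a family of polynomials at a point. -/
def jacobian (g : ι → MvPolynomial σ ℂ) (s : σ → ℂ) : Matrix ι σ ℂ :=
  Matrix.of fun b x => eval s (pderiv x (g b))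

/-- The Poisson tensor at a point. -/
def tensorAt (P : σ → σ → MvPolynomial σ ℂ) (s : σ → ℂ) : Matrix σ σ ℂ :=
  Matrix.of fun x y => eval s (P x y)

lemma eval_poissonBracket_eq_jacobian (P : σ → σ → MvPolynomial σ ℂ) (f : ι → MvPolynomial σ ℂ)
    (g : ι' → MvPolynomial σ ℂ) (s : σ → ℂ) (a : ι) (b : ι') :
    eval s (poissonBracket P (f a) (g b)) =
      (jacobian f s * tensorAt P s * (jacobian g s).transpose) a b := by
  simp only [poissonBracket, map_sum, map_mul, jacobian, tensorAt, Matrix.mul_apply,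
    Matrix.transpose_apply, Matrix.of_apply, Finset.sum_mul]
  rw [Finset.sum_comm]
  exact Finset.sum_congr rfl fun y _ => Finset.sum_congr rfl fun x _ => by ring

lemma bracketMatrix_eq_jacobian (P : σ → σ → MvPolynomial σ ℂ) (g : ι → MvPolynomial σ ℂ)
    (s : σ → ℂ) :
    bracketMatrix P g s = jacobian g s * tensorAt P s * (jacobian g s).transpose := by
  ext a b
  exact eval_poissonBracket_eq_jacobian P g g s a b

/-- The gradient of a polynomial in the `g b` is a combination of the gradients of the `g b`. -/
lemma exists_gradient_combination [Fintype ι] (g : ι → MvPolynomial σ ℂ) (s : σ → ℂ)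
    {f : MvPolynomial σ ℂ} (hf : f ∈ Algebra.adjoin ℂ (Set.range g)) :
    ∃ e : ι → ℂ, ∀ x, eval s (pderiv x f) = ∑ b, e b * jacobian g s b x := by
  classical
  induction hf using Algebra.adjoin_induction with
  | mem f hf =>
    obtain ⟨b, rfl⟩ := hf
    exact ⟨Pi.single b 1, fun x => by simp [jacobian, Pi.single_apply]⟩
  | algebraMap r => exact ⟨0, fun x => by simp [MvPolynomial.algebraMap_eq]⟩
  | add f f' _ _ h h' =>
    obtain ⟨e, he⟩ := h
    obtain ⟨e', he'⟩ := h'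
    exact ⟨e + e', fun x => by simp [he, he', add_mul, Finset.sum_add_distrib]⟩
  | mul f f' _ _ h h' =>
    obtain ⟨e, he⟩ := h
    obtain ⟨e', he'⟩ := h'
    refine ⟨fun b => eval s f * e' b + eval s f' * e b, fun x => ?_⟩
    simp [Derivation.leibniz, he, he', add_mul, Finset.sum_add_distrib, Finset.mul_sum, mul_assoc]

/-- The chain rule for a family of polynomials in the `g b`. -/
lemma exists_jacobian_eq_mul [Fintype ι] (g : ι → MvPolynomial σ ℂ) (s : σ → ℂ)
    {f : κ → MvPolynomial σ ℂ} (hf : ∀ a, f a ∈ Algebra.adjoin ℂ (Set.range g)) :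
    ∃ E : Matrix κ ι ℂ, jacobian f s = E * jacobian g s := by
  choose E hE using fun a => exists_gradient_combination g s (hf a)
  refine ⟨Matrix.of E, ?_⟩
  ext a x
  rw [Matrix.mul_apply]
  exact hE a x

lemma rank_bracketMatrix_le [Fintype ι] [Fintype κ] (P : σ → σ → MvPolynomial σ ℂ)
    (g : ι → MvPolynomial σ ℂ) (s : σ → ℂ)
    {f : κ → MvPolynomial σ ℂ} (hf : ∀ a, f a ∈ Algebra.adjoin ℂ (Set.range g)) :
    (bracketMatrix P f s).rank ≤ (bracketMatrix P g s).rank := by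
  obtain ⟨E, hE⟩ := exists_jacobian_eq_mul g s hf
  have : bracketMatrix P f s = E * bracketMatrix P g s * E.transpose := by
    rw [bracketMatrix_eq_jacobian, bracketMatrix_eq_jacobian, hE, Matrix.transpose_mul]
    simp only [Matrix.mul_assoc]
  rw [this]
  exact (Matrix.rank_mul_le_left _ _).trans (Matrix.rank_mul_le_right _ _)

/-- An isotropic family of vectors with independent images under an antisymmetric form has at
most half as many members as the rank of the form. -/
lemma two_mul_card_le_rank [Fintype ι] [Fintype κ] (B : Matrix ι ι ℂ) (hB : B.transpose = -B)
    (E : Matrix κ ι ℂ) (h0 : E * B * E.transpose = 0)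
    (hli : LinearIndependent ℂ (E * B).row) : 2 * Fintype.card κ ≤ B.rank := by
  classical
  have h1 : (E * B).rank = Fintype.card κ := hli.rank_matrix
  have h2 : (B * E.transpose).rank = Fintype.card κ := by
    have : B * E.transpose = -(E * B).transpose := by
      rw [Matrix.transpose_mul, hB, Matrix.neg_mul, neg_neg]
    have hneg : ∀ A : Matrix ι κ ℂ, (-A).rank ≤ A.rank := fun A => by
      have := Matrix.rank_mul_le_right (-1 : Matrix ι ι ℂ) A
      rwa [Matrix.neg_mul, Matrix.one_mul] at this
    rw [this, ← h1, ← Matrix.rank_transpose (E * B)]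
    refine le_antisymm (hneg _) ?_
    have := hneg (-(E * B).transpose)
    rwa [neg_neg] at this
  -- the restriction of `E` to the range of `B` has the range of `E B`, and its kernel contains the
  -- range of `B Eᵀ`; both have dimension `card κ`
  let φ := E.mulVecLin.domRestrict (LinearMap.range B.mulVecLin)
  have h3 := φ.finrank_range_add_finrank_ker
  have h4 : LinearMap.range φ = LinearMap.range (E * B).mulVecLin := by
    rw [LinearMap.range_domRestrict, Matrix.mulVecLin_mul, LinearMap.range_comp]
  have h5 : (LinearMap.range (B * E.transpose).mulVecLin) ≤
      (LinearMap.ker φ).map (Submodule.subtype _) := by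
    rintro _ ⟨v, rfl⟩
    refine ⟨⟨(B * E.transpose).mulVecLin v, ?_⟩, ?_, rfl⟩
    · rw [Matrix.mulVecLin_mul]
      exact LinearMap.mem_range_self _ _
    · change E.mulVec ((B * E.transpose).mulVec v) = 0
      rw [Matrix.mulVec_mulVec, ← Matrix.mul_assoc, h0, Matrix.zero_mulVec]
  have h6 := (Submodule.finrank_mono h5).trans (Submodule.finrank_map_le _ _)
  rw [h4] at h3
  change (E * B).rank + _ = B.rank at h3
  change (B * E.transpose).rank ≤ _ at h6
  omega

/-- An involutive family in the algebra generated by the `g b`, with independent Hamiltonian vectors,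
bounds the rank of the brackets of the generators from below. -/
lemma two_mul_card_le_rank_bracketMatrix [Fintype ι] [Fintype κ] {P : σ → σ → MvPolynomial σ ℂ}
    (hP : ∀ x y, P x y = -P y x) (g : ι → MvPolynomial σ ℂ) (s : σ → ℂ)
    {F : κ → MvPolynomial σ ℂ} (hF : ∀ a, F a ∈ Algebra.adjoin ℂ (Set.range g))
    (hinv : ∀ a b, poissonBracket P (F a) (F b) = 0)
    (hli : LinearIndependent ℂ fun a => hamiltonianVector P g (F a) s) :
    2 * Fintype.card κ ≤ (bracketMatrix P g s).rank := by
  obtain ⟨E, hE⟩ := exists_jacobian_eq_mul g s hF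
  refine two_mul_card_le_rank _ ?_ E ?_ ?_
  · ext a b
    simp only [bracketMatrix, Matrix.transpose_apply, Matrix.of_apply, Matrix.neg_apply]
    rw [poissonBracket_antisymm hP, map_neg]
  · have : E * bracketMatrix P g s * E.transpose = bracketMatrix P F s := by
      rw [bracketMatrix_eq_jacobian, bracketMatrix_eq_jacobian, hE, Matrix.transpose_mul]
      simp only [Matrix.mul_assoc]
    rw [this]
    ext a b
    simp [bracketMatrix, hinv]
  · convert hli using 1
    ext a b
    rw [Matrix.row, bracketMatrix_eq_jacobian, ← Matrix.mul_assoc, ← Matrix.mul_assoc, ← hE]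
    exact (eval_poissonBracket_eq_jacobian P F g s a b).symm

/-- The vectors of brackets with the `g b` are images of the Hamiltonian vectors under the
Jacobian matrix. -/
lemma linearIndependent_hamiltonianVector_X [DecidableEq σ] (P : σ → σ → MvPolynomial σ ℂ)
    (g : ι → MvPolynomial σ ℂ) (s : σ → ℂ) (F : κ → MvPolynomial σ ℂ)
    (hli : LinearIndependent ℂ fun a => hamiltonianVector P g (F a) s) :
    LinearIndependent ℂ fun a => hamiltonianVector P (X : σ → MvPolynomial σ ℂ) (F a) s := by
  refine LinearIndependent.of_comp (jacobian g s).mulVecLin ?_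
  convert hli using 1
  ext a b
  have hX : jacobian (X : σ → MvPolynomial σ ℂ) s = 1 := by
    ext x y
    simp [jacobian, pderiv_X, Matrix.one_apply, Pi.single_apply, eq_comm, apply_ite]
  have h1 := eval_poissonBracket_eq_jacobian P F g s a b
  have h2 : ∀ y, hamiltonianVector P X (F a) s y = (jacobian F s * tensorAt P s) a y := by
    intro y
    rw [hamiltonianVector, eval_poissonBracket_eq_jacobian P F X s a y, hX, Matrix.transpose_one,
      Matrix.mul_one]
  rw [hamiltonianVector, h1, Matrix.mul_apply]
  simp only [Function.comp, Matrix.mulVecLin_apply, Matrix.mulVec, dotProduct, h2,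
    Matrix.transpose_apply]
  exact Finset.sum_congr rfl fun y _ => mul_comm _ _

/-- Linear independence of the Hamiltonian vectors at one point implies it at all points outside
the zero set of a minor. -/
lemma exists_polynomial_linearIndependent [Fintype ι] [Fintype κ] (P : σ → σ → MvPolynomial σ ℂ)
    (g : ι → MvPolynomial σ ℂ) (F : κ → MvPolynomial σ ℂ) {s₀ : σ → ℂ}
    (hli : LinearIndependent ℂ fun a => hamiltonianVector P g (F a) s₀) :
    ∃ D : MvPolynomial σ ℂ, D ≠ 0 ∧ ∀ s, eval s D ≠ 0 →
      LinearIndependent ℂ fun a => hamiltonianVector P g (F a) s := by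
  classical
  let V (s : σ → ℂ) : Matrix κ ι ℂ := Matrix.of fun a b => hamiltonianVector P g (F a) s b
  -- `D = det (V W)` for a right inverse `W` of `V` at the given point
  obtain ⟨W, hW⟩ : ∃ W : Matrix ι κ ℂ, V s₀ * W = 1 := by
    rw [← Matrix.mulVec_surjective_iff_exists_right_inverse]
    have h1 : (V s₀).rank = Fintype.card κ := LinearIndependent.rank_matrix hli
    have h2 : LinearMap.range (V s₀).mulVecLin = ⊤ := by
      apply Submodule.eq_top_of_finrank_eq
      rw [Module.finrank_fintype_fun_eq_card]
      exact h1
    exact LinearMap.range_eq_top.mp h2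
  let D : MvPolynomial σ ℂ :=
    (Matrix.of (fun a b => poissonBracket P (F a) (g b)) * W.map (C (σ := σ))).det
  have hD : ∀ s, eval s D = (V s * W).det := by
    intro s
    simp only [D]
    rw [RingHom.map_det, RingHom.mapMatrix_apply, Matrix.map_mul]
    congr 2
    ext i j
    simp
  refine ⟨D, ?_, fun s hs => ?_⟩
  · intro h
    have := hD s₀
    rw [h, hW] at this
    simp at this
  · rw [hD] at hs
    have := Matrix.linearIndependent_rows_of_det_ne_zero hs
    refine LinearIndependent.of_comp (W.transpose.mulVecLin) ?_
    have h1 : (W.transpose.mulVecLin ∘ fun a => hamiltonianVector P g (F a) s) =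
        fun a => (V s * W) a := by
      ext a b
      simp only [Function.comp, Matrix.mulVecLin_apply, Matrix.mulVec, dotProduct,
        Matrix.transpose_apply, Matrix.mul_apply]
      exact Finset.sum_congr rfl fun y _ => mul_comm _ _
    rw [h1]
    exact this

end Rank

lemma X_mem_adjoin_stdCoord (x : Mode N) : (X x : MvPolynomial (Mode N) ℂ) ∈
    Algebra.adjoin ℂ (Set.range fun a : ZMod N × ZMod N => stdCoord N a.1 (a.1 + a.2)) := by
  rw [← linForm_dualBasis, linForm_eq_sum]
  refine Subalgebra.sum_mem _ fun i _ => Subalgebra.sum_mem _ fun j _ => ?_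
  rw [← smul_eq_C_mul]
  exact Subalgebra.smul_mem _ (Algebra.subset_adjoin (Set.mem_range.mpr ⟨(j, i - j), by simp⟩)) _

/-- The coordinates are combinations of the matrix entries `S̃_{ij}`, so the brackets of the latter
bound the rank. -/
lemma rank_bracketMatrix_X_le (hp : 0 < p) (hpN : 2 * p < N) (hcop : Nat.Coprime N p)
    (s : Mode N → ℂ) (h1 : ∀ i : ZMod N, eval s (stdCoord N i (i + p)) ≠ 0)
    (h2 : ∀ i : ZMod N, eval s (stdCoord N i (i - p)) ≠ 0) :
    (bracketMatrix (limitTensor N p) (X : Mode N → MvPolynomial (Mode N) ℂ) s).rank ≤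
      2 * p * (N - 1) := by
  refine (rank_bracketMatrix_le (limitTensor N p) _ s X_mem_adjoin_stdCoord).trans ?_
  have : bracketMatrix (limitTensor N p)
      (fun a : ZMod N × ZMod N => stdCoord N a.1 (a.1 + a.2)) s =
      Matrix.of (chainForm p fun u v => eval s (stdCoord N u v)) := by
    ext ⟨i, n⟩ ⟨k, m⟩
    simp only [bracketMatrix, Matrix.of_apply]
    rw [eval_bracket_stdCoord hpN]
    simp
  rw [this]
  exact rank_chainForm_le hp hpN hcop _ h1 h2

lemma stdCoord_ne_zero {i j : ZMod N} (h : i ≠ j) : stdCoord N i j ≠ 0 := by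
  classical
  obtain ⟨s, hs⟩ := exists_eval_stdCoord (Matrix.single i j (1 : ℂ))
    (Matrix.trace_single_eq_of_ne i j 1 h)
  intro h0
  have := hs i j
  rw [h0] at this
  simp at this

/-- The lower bound of the rank on `𝒮₂` and the upper bound on the whole phase space agree, which
determines both ranks. -/
lemma generic_rank_and_independence (hp : 0 < p) (hpN : 2 * p < N) (hcop : Nat.Coprime N p) :
    ∃ D : MvPolynomial (Mode N) ℂ, D ≠ 0 ∧ ∀ s, eval s D ≠ 0 →
      (bracketMatrix (limitTensor N p) (X : Mode N → MvPolynomial (Mode N) ℂ) s).rank =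
        2 * (p * (N - 1)) ∧
      (LinearIndependent ℂ fun a : hamiltonianLabels N p =>
        hamiltonianVector (limitTensor N p) (X : Mode N → MvPolynomial (Mode N) ℂ)
          (laxHamiltonian N p a.1.1 a.1.2) s) ∧
      (bracketMatrix (limitTensor N p) (bandCoord N p) s).rank = 2 * (p * (N - 1)) ∧
      LinearIndependent ℂ fun a : hamiltonianLabels N p =>
        hamiltonianVector (limitTensor N p) (bandCoord N p) (laxHamiltonian N p a.1.1 a.1.2) s := by
  classical
  obtain ⟨s₀, hs₀⟩ := linearIndependent_band_at (N := N) hp hpN hcop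
  obtain ⟨D, hD, hDs⟩ := exists_polynomial_linearIndependent (limitTensor N p) (bandCoord N p)
    (fun a : hamiltonianLabels N p => laxHamiltonian N p a.1.1 a.1.2) hs₀
  have hpz : (p : ZMod N) ≠ 0 := by
    have := int_eq_of_cast_eq (N := N) (p := p) hpN (m := p) (n := 0)
    intro h
    simp [h] at this
    omega
  refine ⟨D * ((∏ i : ZMod N, stdCoord N i (i + p)) * ∏ i : ZMod N, stdCoord N i (i - p)),
    mul_ne_zero hD (mul_ne_zero (Finset.prod_ne_zero_iff.mpr fun i _ => stdCoord_ne_zero ?_)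
      (Finset.prod_ne_zero_iff.mpr fun i _ => stdCoord_ne_zero ?_)), fun s hs => ?_⟩
  · simpa using hpz
  · intro h
    exact hpz (by simpa using sub_eq_self.mp h.symm)
  rw [map_mul, map_mul, map_prod, map_prod, mul_ne_zero_iff, mul_ne_zero_iff,
    Finset.prod_ne_zero_iff, Finset.prod_ne_zero_iff] at hs
  obtain ⟨h0, h1, h2⟩ := hs
  have hup := rank_bracketMatrix_X_le hp hpN hcop s (fun i => h1 i (Finset.mem_univ _))
    fun i => h2 i (Finset.mem_univ _)
  have hband := hDs s h0
  have hX := linearIndependent_hamiltonianVector_X _ _ _ _ hband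
  have hcard : Fintype.card (hamiltonianLabels N p) = p * (N - 1) := by
    rw [Fintype.card_coe, card_hamiltonianLabels hp hcop]
  have hlow := two_mul_card_le_rank_bracketMatrix (limitTensor_antisymm N p) (bandCoord N p) s
    (fun a : hamiltonianLabels N p => laxHamiltonian_mem_bandAlgebra hpN a.1.1 a.1.2)
    (fun a b => involution hpN _ _ _ _) hband
  have hmid : (bracketMatrix (limitTensor N p) (bandCoord N p) s).rank ≤
      (bracketMatrix (limitTensor N p) (X : Mode N → MvPolynomial (Mode N) ℂ) s).rank := by
    refine rank_bracketMatrix_le _ _ _ fun a => ?_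
    rw [MvPolynomial.adjoin_range_X]
    trivial
  rw [mul_assoc] at hup
  rw [hcard] at hlow
  exact ⟨by omega, hX, by omega, hband⟩

/-! ### The limit of the Poisson tensor -/

lemma norm_ex (z : ℂ) : ‖ex z‖ = Real.exp (-(2 * Real.pi * z.im)) := by
  rw [ex, Complex.norm_exp]
  congr 1
  simp

lemma tendsto_ex_ofReal_mul {e : ℝ} (he : 0 ≤ e) :
    Tendsto (fun τ : ℂ => ex (e * τ)) (comap Complex.im atTop) (𝓝 (if e = 0 then 1 else 0)) := by
  split_ifs with h
  · simp only [h, Complex.ofReal_zero, zero_mul, ex_zero]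
    exact tendsto_const_nhds
  · rw [tendsto_zero_iff_norm_tendsto_zero]
    have he' : 0 < e := lt_of_le_of_ne he (Ne.symm h)
    have h1 : ∀ τ : ℂ, ‖ex (e * τ)‖ = Real.exp (-(2 * Real.pi * e * τ.im)) := by
      intro τ
      rw [norm_ex, Complex.im_ofReal_mul]
      ring_nf
    simp_rw [h1]
    refine Real.tendsto_exp_neg_atTop_nhds_zero.comp ?_
    exact (tendsto_comap (f := Complex.im)).const_mul_atTop (by positivity)

lemma eval_unscale_coord (τ : ℂ) (s : Mode N → ℂ) (a b : ℤ) :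
    eval (unscale N p τ s) (coord N a b) =
      ex (-(scalingExp N p b : ℂ) * τ) * eval s (coord N a b) := by
  unfold coord
  split_ifs with h
  · simp only [map_mul, eval_C, eval_X, unscale]
    ring
  · simp

/-- The scaled tensor differs from the limiting one by the factor `q^(g(b) + g(d) - g(b + d))`. -/
lemma scaledTensor_eq (τ : ℂ) (s : Mode N → ℂ) (x y : Mode N) :
    scaledTensor N p τ s x y = ex ((scalingExp N p x.1.2 + scalingExp N p y.1.2 -
      scalingExp N p (x.1.2 + y.1.2) : ℝ) * τ) * eval s (topTensor N x y) := by
  rw [scaledTensor, topTensor, map_mul, map_mul, eval_unscale_coord, eval_C, eval_C]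
  have h : (((x.n : ℤ) + y.n : ℤ) : ZMod N) = x.1.2 + y.1.2 := by
    push_cast
    rw [mode_natCast_n, mode_natCast_n]
  rw [h]
  have e : (((scalingExp N p x.1.2 + scalingExp N p y.1.2 -
      scalingExp N p (x.1.2 + y.1.2) : ℝ)) : ℂ) * τ = (scalingExp N p x.1.2 : ℂ) * τ +
      (scalingExp N p y.1.2 : ℂ) * τ + -(scalingExp N p (x.1.2 + y.1.2) : ℂ) * τ := by
    push_cast
    ring
  rw [e, ex_add, ex_add]
  ring

lemma tendsto_scaledTensor (hpN : 2 * p < N) (s : Mode N → ℂ) (x y : Mode N) :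
    Tendsto (fun τ : ℂ => scaledTensor N p τ s x y) (comap Complex.im atTop)
      (𝓝 (eval s (limitTensor N p x y))) := by
  simp_rw [scaledTensor_eq]
  have h0 : 0 ≤ scalingExp N p x.1.2 + scalingExp N p y.1.2 - scalingExp N p (x.1.2 + y.1.2) := by
    have h1 : (shiftLen N p (x.1.2 + y.1.2) : ℝ) ≤ shiftLen N p x.1.2 + shiftLen N p y.1.2 := by
      exact_mod_cast shiftLen_add_le _ _
    rw [scalingExp_eq hpN, scalingExp_eq hpN, scalingExp_eq hpN, ← add_div, ← sub_div]
    exact div_nonneg (by linarith) (by positivity)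
  have h1 := (tendsto_ex_ofReal_mul h0).mul_const (eval s (topTensor N x y))
  convert h1 using 2
  rw [limitTensor]
  simp only [sub_eq_zero]
  split_ifs <;> simp

/-! ### Asymptotics of the theta function -/

lemma ex_one_div_four : ex (1 / 4) = Complex.I := by
  rw [ex, show 2 * (Real.pi : ℂ) * Complex.I * (1 / 4) = Real.pi / 2 * Complex.I by ring]
  exact Complex.exp_pi_div_two_mul_I

lemma ex_eq_of_eq {z w : ℂ} (h : z = w) : ex z = ex w := by rw [h]

/-- The theta terms are those of Mathlib's two-variable theta function. -/
lemma theta_term_eq (z τ : ℂ) (j : ℤ) :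
    ex (((j : ℂ) + 1 / 2) ^ 2 * τ / 2) * ex (((j : ℂ) + 1 / 2) * (z + 1 / 2)) =
      ex (τ / 8 + (z + 1 / 2) / 2) * jacobiTheta₂_term j (z + 1 / 2 + τ / 2) τ := by
  rw [jacobiTheta₂_term, ex, ex, ex, ← Complex.exp_add, ← Complex.exp_add]
  congr 1
  ring

lemma theta_eq (z τ : ℂ) :
    theta z τ = ex (τ / 8 + (z + 1 / 2) / 2) * jacobiTheta₂ (z + 1 / 2 + τ / 2) τ := by
  simp_rw [theta, theta_term_eq, tsum_mul_left, jacobiTheta₂]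

lemma summable_theta_term (z : ℂ) {τ : ℂ} (hτ : 0 < τ.im) : Summable fun j : ℤ =>
    ‖ex (((j : ℂ) + 1 / 2) ^ 2 * τ / 2) * ex (((j : ℂ) + 1 / 2) * (z + 1 / 2))‖ := by
  simp_rw [theta_term_eq]
  exact (((summable_jacobiTheta₂_term_iff _ _).mpr hτ).mul_left _).norm

lemma summable_deriv_theta_term (z : ℂ) {τ : ℂ} (hτ : 0 < τ.im) : Summable fun j : ℤ =>
    ‖2 * Real.pi * Complex.I * ((j : ℂ) + 1 / 2) *
      (ex (((j : ℂ) + 1 / 2) ^ 2 * τ / 2) * ex (((j : ℂ) + 1 / 2) * (z + 1 / 2)))‖ := by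
  simp_rw [theta_term_eq]
  have h1 := ((summable_jacobiTheta₂_term_iff (z + 1 / 2 + τ / 2) τ).mpr hτ).mul_left
    (Real.pi * Complex.I * ex (τ / 8 + (z + 1 / 2) / 2))
  have h2 := ((summable_jacobiTheta₂'_term_iff (z + 1 / 2 + τ / 2) τ).mpr hτ).mul_left
    (ex (τ / 8 + (z + 1 / 2) / 2))
  refine ((h1.add h2).congr fun j => ?_).norm
  rw [jacobiTheta₂'_term]
  ring

/-- Termwise differentiation of the theta series. -/
lemma deriv_theta (z : ℂ) {τ : ℂ} (hτ : 0 < τ.im) :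
    deriv (fun v => theta v τ) z = ∑' j : ℤ, 2 * Real.pi * Complex.I * ((j : ℂ) + 1 / 2) *
      (ex (((j : ℂ) + 1 / 2) ^ 2 * τ / 2) * ex (((j : ℂ) + 1 / 2) * (z + 1 / 2))) := by
  have h1 := (hasSum_jacobiTheta₂_term (z + 1 / 2 + τ / 2) hτ).mul_left
    (Real.pi * Complex.I * ex (τ / 8 + (z + 1 / 2) / 2))
  have h2 := (hasSum_jacobiTheta₂'_term (z + 1 / 2 + τ / 2) hτ).mul_left
    (ex (τ / 8 + (z + 1 / 2) / 2))
  have h3 : HasDerivAt (fun v => ex (τ / 8 + (v + 1 / 2) / 2))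
      (Real.pi * Complex.I * ex (τ / 8 + (z + 1 / 2) / 2)) z := by
    unfold ex
    have : HasDerivAt (fun v : ℂ => 2 * Real.pi * Complex.I * (τ / 8 + (v + 1 / 2) / 2))
        (2 * Real.pi * Complex.I * (1 / 2)) z :=
      ((((hasDerivAt_id z).add_const _).div_const 2).const_add _).const_mul _
    exact this.cexp.congr_deriv (by ring)
  have h4 : HasDerivAt (fun v => jacobiTheta₂ (v + 1 / 2 + τ / 2) τ)
      (jacobiTheta₂' (z + 1 / 2 + τ / 2) τ) z := by
    have := hasDerivAt_jacobiTheta₂_fst (z + 1 / 2 + τ / 2) hτ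
    rw [add_assoc] at this
    simpa only [add_assoc] using this.comp_add_const z (1 / 2 + τ / 2)
  have h5 := (h3.mul h4).deriv
  simp_rw [theta_eq]
  refine h5.trans ?_
  rw [← (h1.add h2).tsum_eq]
  refine tsum_congr fun j => ?_
  rw [theta_term_eq, jacobiTheta₂'_term]
  ring

/-- The Fourier exponents `(j + ½ + a)² / 2 - (½ - |a|)² / 2` are non-negative; the minimum is
attained at `j = 0` if `a ≤ 0` and at `j = -1` if `a ≥ 0`. -/
lemma theta_exponent {a : ℝ} (ha : |a| < 1) (j : ℤ) :
    0 ≤ ((j : ℝ) + 1 / 2) ^ 2 / 2 + a * ((j : ℝ) + 1 / 2) - (1 / 8 - |a| / 2) ∧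
    (((j : ℝ) + 1 / 2) ^ 2 / 2 + a * ((j : ℝ) + 1 / 2) - (1 / 8 - |a| / 2) = 0 ↔
      (j = 0 ∧ a ≤ 0) ∨ (j = -1 ∧ 0 ≤ a)) := by
  have key : ((j : ℝ) + 1 / 2) ^ 2 / 2 + a * ((j : ℝ) + 1 / 2) - (1 / 8 - |a| / 2) =
      j * (j + 1) / 2 + a * (j + 1 / 2) + |a| / 2 := by ring
  rw [key]
  rw [abs_lt] at ha
  rcases lt_trichotomy j 0 with h | rfl | h
  · rcases eq_or_ne j (-1) with rfl | h'
    · push_cast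
      rcases le_total 0 a with h0 | h0
      · rw [abs_of_nonneg h0]
        refine ⟨by linarith, ?_⟩
        simp [h0]
        ring
      · rw [abs_of_nonpos h0]
        refine ⟨by linarith, ?_⟩
        constructor
        · intro h1
          exact Or.inr ⟨trivial, by linarith⟩
        · rintro (⟨h1, -⟩ | ⟨-, h1⟩)
          · simp at h1
          · linarith
    · have h1 : (j : ℝ) ≤ -2 := by exact_mod_cast (by omega : j ≤ -2)
      have hpos : 0 < (j : ℝ) * (j + 1) / 2 + a * (j + 1 / 2) + |a| / 2 := by
        rcases le_total 0 a with h0 | h0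
        · rw [abs_of_nonneg h0]
          nlinarith
        · rw [abs_of_nonpos h0]
          nlinarith
      refine ⟨hpos.le, ?_⟩
      constructor
      · intro h2
        linarith
      · rintro (⟨h2, -⟩ | ⟨h2, -⟩) <;> omega
  · push_cast
    rcases le_total 0 a with h0 | h0
    · rw [abs_of_nonneg h0]
      refine ⟨by linarith, ?_⟩
      constructor
      · intro h1
        exact Or.inl ⟨trivial, by linarith⟩
      · rintro (⟨-, h1⟩ | ⟨h1, -⟩)
        · linarith
        · simp at h1
    · rw [abs_of_nonpos h0]
      refine ⟨by linarith, ?_⟩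
      simp [h0]
      ring
  · have h1 : (1 : ℝ) ≤ j := by exact_mod_cast h
    have hpos : 0 < (j : ℝ) * (j + 1) / 2 + a * (j + 1 / 2) + |a| / 2 := by
      rcases le_total 0 a with h0 | h0
      · rw [abs_of_nonneg h0]
        nlinarith
      · rw [abs_of_nonpos h0]
        nlinarith
    refine ⟨hpos.le, ?_⟩
    constructor
    · intro h2
      linarith
    · rintro (⟨h2, -⟩ | ⟨h2, -⟩) <;> omega

/-- Asymptotics of a theta series with weights at `z + a τ`, `|a| < 1`. -/
lemma tendsto_weighted_theta (w : ℤ → ℂ) (z : ℂ) {a : ℝ} (ha : |a| < 1)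
    (hw : Summable fun j : ℤ => ‖w j * (ex (((j : ℂ) + 1 / 2) ^ 2 * Complex.I / 2) *
      ex (((j : ℂ) + 1 / 2) * (z + a * Complex.I + 1 / 2)))‖) :
    Tendsto (fun τ : ℂ => ex (-(1 / 8 - |a| / 2 : ℝ) * τ) *
        ∑' j : ℤ, w j * (ex (((j : ℂ) + 1 / 2) ^ 2 * τ / 2) *
          ex (((j : ℂ) + 1 / 2) * (z + a * τ + 1 / 2)))) (comap Complex.im atTop)
      (𝓝 ((if a ≤ 0 then w 0 * ex ((z + 1 / 2) / 2) else 0) +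
        if 0 ≤ a then w (-1) * ex (-((z + 1 / 2) / 2)) else 0)) := by
  set e : ℤ → ℝ := fun j =>
    ((j : ℝ) + 1 / 2) ^ 2 / 2 + a * ((j : ℝ) + 1 / 2) - (1 / 8 - |a| / 2) with he
  have hterm : ∀ (τ : ℂ) (j : ℤ), ex (-(1 / 8 - |a| / 2 : ℝ) * τ) *
      (w j * (ex (((j : ℂ) + 1 / 2) ^ 2 * τ / 2) *
          ex (((j : ℂ) + 1 / 2) * (z + a * τ + 1 / 2)))) =
      ex (e j * τ) * (w j * ex (((j : ℂ) + 1 / 2) * (z + 1 / 2))) := by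
    intro τ j
    have h1 : ex (-(1 / 8 - |a| / 2 : ℝ) * τ) * (ex (((j : ℂ) + 1 / 2) ^ 2 * τ / 2) *
        ex (((j : ℂ) + 1 / 2) * (z + a * τ + 1 / 2))) =
        ex (e j * τ) * ex (((j : ℂ) + 1 / 2) * (z + 1 / 2)) := by
      rw [← ex_add, ← ex_add, ← ex_add]
      apply ex_eq_of_eq
      simp only [he]
      push_cast
      ring
    linear_combination w j * h1
  simp_rw [← tsum_mul_left, hterm]
  have hlim : (if a ≤ 0 then w 0 * ex ((z + 1 / 2) / 2) else 0) +
      (if 0 ≤ a then w (-1) * ex (-((z + 1 / 2) / 2)) else 0) =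
      ∑' j : ℤ, (if e j = 0 then 1 else 0) * (w j * ex (((j : ℂ) + 1 / 2) * (z + 1 / 2))) := by
    rw [tsum_eq_sum (s := {0, -1})]
    · rw [Finset.sum_pair (by norm_num)]
      have h1 : e 0 = 0 ↔ a ≤ 0 := by
        rw [(theta_exponent ha 0).2]
        simp
      have h2 : e (-1) = 0 ↔ 0 ≤ a := by
        rw [(theta_exponent ha (-1)).2]
        simp
      have e1 : (((0 : ℤ) : ℂ) + 1 / 2) * (z + 1 / 2) = (z + 1 / 2) / 2 := by push_cast; ring
      have e2 : (((-1 : ℤ) : ℂ) + 1 / 2) * (z + 1 / 2) = -((z + 1 / 2) / 2) := by push_cast; ring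
      rw [e1, e2]
      simp only [h1, h2, ite_mul, one_mul, zero_mul]
    · intro j hj
      rw [if_neg, zero_mul]
      rw [(theta_exponent ha j).2]
      simp only [Finset.mem_insert, Finset.mem_singleton, not_or] at hj
      tauto
  rw [hlim]
  refine tendsto_tsum_of_dominated_convergence
    (bound := fun j => ‖ex (-(1 / 8 - |a| / 2 : ℝ) * Complex.I)‖ *
      ‖w j * (ex (((j : ℂ) + 1 / 2) ^ 2 * Complex.I / 2) *
      ex (((j : ℂ) + 1 / 2) * (z + a * Complex.I + 1 / 2)))‖) (hw.mul_left _) ?_ ?_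
  · intro j
    exact (tendsto_ex_ofReal_mul (theta_exponent ha j).1).mul_const _
  · have hev : ∀ᶠ τ : ℂ in comap Complex.im atTop, 1 ≤ τ.im :=
      tendsto_comap.eventually (eventually_ge_atTop 1)
    filter_upwards [hev] with τ hτ j
    rw [← norm_mul, hterm, norm_mul, norm_mul (ex _)]
    refine mul_le_mul_of_nonneg_right ?_ (norm_nonneg _)
    rw [norm_ex, norm_ex, Complex.im_ofReal_mul, Complex.im_ofReal_mul, Complex.I_im]
    have := (theta_exponent ha j).1
    refine Real.exp_le_exp.mpr (neg_le_neg ?_)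
    have : e j * 1 ≤ e j * τ.im := mul_le_mul_of_nonneg_left hτ this
    exact mul_le_mul_of_nonneg_left this (by positivity)

/-- The leading coefficient of `ϑ(z + a τ)`. -/
def thetaLead (z : ℂ) (a : ℝ) : ℂ :=
  (if a ≤ 0 then ex ((z + 1 / 2) / 2) else 0) + if 0 ≤ a then ex (-((z + 1 / 2) / 2)) else 0

lemma tendsto_theta (z : ℂ) {a : ℝ} (ha : |a| < 1) :
    Tendsto (fun τ : ℂ => ex (-(1 / 8 - |a| / 2 : ℝ) * τ) * theta (z + a * τ) τ)
      (comap Complex.im atTop) (𝓝 (thetaLead z a)) := by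
  have := tendsto_weighted_theta (fun _ => 1) z ha (by
    simpa using summable_theta_term (z + a * Complex.I) (τ := Complex.I) (by simp))
  simpa [theta, thetaLead] using this

lemma tendsto_deriv_theta :
    Tendsto (fun τ : ℂ => ex (-(1 / 8 : ℝ) * τ) * deriv (fun v => theta v τ) 0)
      (comap Complex.im atTop) (𝓝 (-(2 * Real.pi))) := by
  have := tendsto_weighted_theta (fun j => 2 * Real.pi * Complex.I * ((j : ℂ) + 1 / 2)) 0
    (a := 0) (by simp) (by
    simpa using summable_deriv_theta_term 0 (τ := Complex.I) (by simp))
  have hev : ∀ᶠ τ : ℂ in comap Complex.im atTop, 0 < τ.im :=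
    tendsto_comap.eventually (eventually_gt_atTop 0)
  have h3 : ex (-(1 / 4)) = -Complex.I := by rw [ex_neg, ex_one_div_four, Complex.inv_I]
  refine (this.congr' ?_).trans_eq ?_
  · filter_upwards [hev] with τ hτ
    rw [deriv_theta 0 hτ]
    simp
  · have e1 : ((0 : ℂ) + 1 / 2) / 2 = 1 / 4 := by norm_num
    rw [e1, ex_one_div_four, h3, if_pos le_rfl, if_pos le_rfl]
    push_cast
    congr 1
    linear_combination (2 * Real.pi : ℂ) * Complex.I_sq

/-! ### The limit of the Lax matrix -/

lemma sin_mode_ne_zero (x : Mode N) (h : x.n = 0) : Complex.sin (Real.pi * x.m / N) ≠ 0 := by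
  have hm : x.1.1 ≠ 0 := by
    intro h1
    apply x.2
    refine Prod.ext h1 ?_
    rw [← mode_natCast_n, h]
    simp
  exact sin_ne_zero_of_zmod N hm

lemma thetaLead_of_neg (z : ℂ) {a : ℝ} (ha : a < 0) : thetaLead z a = ex ((z + 1 / 2) / 2) := by
  rw [thetaLead, if_pos ha.le, if_neg (not_le.mpr ha), add_zero]

lemma thetaLead_of_pos (z : ℂ) {a : ℝ} (ha : 0 < a) : thetaLead z a = ex (-((z + 1 / 2) / 2)) := by
  rw [thetaLead, if_neg (not_le.mpr ha), if_pos ha.le, zero_add]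

lemma thetaLead_zero (z : ℂ) : thetaLead z 0 = -(2 * Complex.sin (Real.pi * z)) := by
  rw [thetaLead, if_pos le_rfl, if_pos le_rfl, add_div, neg_add, ex_add, ex_add]
  have h1 : (1 : ℂ) / 2 / 2 = 1 / 4 := by norm_num
  have h2 := two_I_sin z
  rw [h1, ex_neg (1 / 4), ex_one_div_four, Complex.inv_I]
  linear_combination -Complex.I * h2 + 2 * Complex.sin (Real.pi * z) * Complex.I_sq

lemma thetaLead_ne_zero (x : Mode N) : thetaLead (-((x.m : ℂ) / N)) (-(x.n / N : ℝ)) ≠ 0 := by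
  have hN : (0 : ℝ) < N := by exact_mod_cast Nat.pos_of_ne_zero (NeZero.ne N)
  by_cases h : x.n = 0
  · rw [h, Nat.cast_zero, zero_div, neg_zero, thetaLead_zero, mul_neg, Complex.sin_neg]
    have := sin_mode_ne_zero x h
    rw [mul_div_assoc] at this
    simpa using this
  · rw [thetaLead_of_neg]
    · exact ex_ne_zero _
    · have : (0 : ℝ) < x.n := by exact_mod_cast Nat.pos_of_ne_zero h
      rw [neg_lt_zero]
      positivity

/-- The exponent of `q` that remains in the `x`-th coefficient of the Lax matrix after the
substitution: `¼ - ½ |½ - n/N| - g(n)`, which is half the distance of `n/N` from `ℤ`, minus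
`g(n)`. -/
lemma lax_exponent (hpN : 2 * p < N) (x : Mode N) :
    0 ≤ 1 / 4 - |1 / 2 - (x.n / N : ℝ)| / 2 - scalingExp N p x.1.2 ∧
    (1 / 4 - |1 / 2 - (x.n / N : ℝ)| / 2 - scalingExp N p x.1.2 = 0 ↔ x.n ≤ p ∨ N - p ≤ x.n) := by
  have hN : (0 : ℝ) < N := by exact_mod_cast Nat.pos_of_ne_zero (NeZero.ne N)
  have hx : x.n < N := ZMod.val_lt _
  have hx' : (x.n : ℝ) < N := by exact_mod_cast hx
  have hp' : 2 * (p : ℝ) < N := by exact_mod_cast hpN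
  have key : ∃ t : ℕ, (t : ℝ) / (2 * N) =
      1 / 4 - |1 / 2 - (x.n / N : ℝ)| / 2 - scalingExp N p x.1.2 ∧
      (t = 0 ↔ x.n ≤ p ∨ N - p ≤ x.n) := by
    rw [scalingExp_eq hpN]
    have hs : shiftLen N p x.1.2 = min (min x.n (N - x.n)) p := rfl
    rcases le_total (2 * x.n) N with h | h
    · refine ⟨x.n - min x.n p, ?_, by omega⟩
      have h1 : shiftLen N p x.1.2 = min x.n p := by omega
      have h2 : 2 * (x.n : ℝ) ≤ N := by exact_mod_cast h
      have h3 : (0 : ℝ) ≤ 1 / 2 - x.n / N := by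
        rw [sub_nonneg, div_le_div_iff₀ hN two_pos]
        linarith
      rw [abs_of_nonneg h3, h1, Nat.cast_sub (min_le_left _ _)]
      field_simp
      ring
    · refine ⟨N - x.n - min (N - x.n) p, ?_, by omega⟩
      have h1 : shiftLen N p x.1.2 = min (N - x.n) p := by omega
      have h2 : (N : ℝ) ≤ 2 * x.n := by exact_mod_cast h
      have h3 : 1 / 2 - (x.n / N : ℝ) ≤ 0 := by
        rw [sub_nonpos, div_le_div_iff₀ two_pos hN]
        linarith
      rw [abs_of_nonpos h3, h1, Nat.cast_sub (min_le_left _ _), Nat.cast_sub hx.le]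
      field_simp
      ring
  obtain ⟨t, ht, ht0⟩ := key
  rw [← ht, ← ht0]
  refine ⟨by positivity, ?_⟩
  rw [div_eq_zero_iff]
  constructor
  · rintro (h | h)
    · exact_mod_cast h
    · linarith
  · intro h
    left
    exact_mod_cast h

/-- The coefficient of `s̃_x T_x` in the scaled Lax matrix. -/
lemma tendsto_lax_coefficient (hpN : 2 * p < N) (z : ℂ) (x : Mode N) :
    Tendsto (fun τ : ℂ => ex (-(scalingExp N p x.1.2 : ℂ) * τ) *
      (ex (-((x.n : ℂ) * (z + τ / 2) / N)) *
        phi (-(((x.m : ℂ) + x.n * τ) / N)) (z + τ / 2) τ)) (comap Complex.im atTop)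
      (𝓝 (ex (-((x.n : ℂ) * z / N)) * (if x.n ≤ p ∨ N - p ≤ x.n then 1 else 0) *
        (thetaLead (z - (x.m : ℂ) / N) (1 / 2 - x.n / N) * -(2 * Real.pi) /
          (thetaLead (-((x.m : ℂ) / N)) (-(x.n / N : ℝ)) * thetaLead z (1 / 2))))) := by
  have hN := natCast_ne_zero' N
  have hNr : (0 : ℝ) < N := by exact_mod_cast Nat.pos_of_ne_zero (NeZero.ne N)
  have hx : x.n < N := ZMod.val_lt _
  have hx' : (x.n / N : ℝ) < 1 := by
    rw [div_lt_one hNr]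
    exact_mod_cast hx
  have hx0 : 0 ≤ (x.n / N : ℝ) := by positivity
  have hA := tendsto_theta (z - (x.m : ℂ) / N) (a := 1 / 2 - x.n / N)
    (by rw [abs_lt]; constructor <;> linarith)
  have hB := tendsto_theta (-((x.m : ℂ) / N)) (a := -(x.n / N : ℝ))
    (by rw [abs_lt]; constructor <;> linarith)
  have hC := tendsto_theta z (a := 1 / 2) (by rw [abs_lt]; constructor <;> linarith)
  have hE := tendsto_ex_ofReal_mul (lax_exponent hpN x).1
  have hne : thetaLead (-((x.m : ℂ) / N)) (-(x.n / N : ℝ)) * thetaLead z (1 / 2) ≠ 0 :=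
    mul_ne_zero (thetaLead_ne_zero x) (by
      rw [thetaLead_of_pos _ (by norm_num)]
      exact ex_ne_zero _)
  have := (hE.const_mul (ex (-((x.n : ℂ) * z / N)))).mul
    ((hA.mul tendsto_deriv_theta).div (hB.mul hC) hne)
  simp only [(lax_exponent hpN x).2] at this
  refine this.congr fun τ => ?_
  have e1 : z - (x.m : ℂ) / N + ((1 / 2 - x.n / N : ℝ) : ℂ) * τ =
      -(((x.m : ℂ) + x.n * τ) / N) + (z + τ / 2) := by
    push_cast
    ring
  have e2 : -((x.m : ℂ) / N) + ((-(x.n / N : ℝ) : ℝ) : ℂ) * τ = -(((x.m : ℂ) + x.n * τ) / N) := by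
    push_cast
    ring
  have e3 : z + ((1 / 2 : ℝ) : ℂ) * τ = z + τ / 2 := by
    push_cast
    ring
  rw [Pi.div_apply, e1, e2, e3, phi]
  rw [abs_neg, abs_of_nonneg hx0, abs_of_nonneg (by norm_num : (0 : ℝ) ≤ 1 / 2)]
  have e4 : ex (-((x.n : ℂ) * z / N)) *
      ex ((1 / 4 - |1 / 2 - (x.n / N : ℝ)| / 2 - scalingExp N p x.1.2 : ℝ) * τ) *
      (ex (-(1 / 8 - |1 / 2 - (x.n / N : ℝ)| / 2 : ℝ) * τ) * ex (-(1 / 8 : ℝ) * τ)) =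
      ex (-(scalingExp N p x.1.2 : ℂ) * τ) * ex (-((x.n : ℂ) * (z + τ / 2) / N)) *
      (ex (-(1 / 8 - x.n / N / 2 : ℝ) * τ) * ex (-(1 / 8 - 1 / 2 / 2 : ℝ) * τ)) := by
    simp only [← ex_add]
    apply ex_eq_of_eq
    push_cast
    ring
  have e5 : ∀ a b c d t u : ℂ, d ≠ 0 → a * b = c * d → a * (b * t / (d * u)) = c * (t / u) := by
    intro a b c d t u hd h
    rw [mul_div_mul_comm, ← mul_assoc, ← mul_div_assoc a b d, h, mul_div_assoc c, div_self hd, mul_one]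
  rw [mul_mul_mul_comm, mul_mul_mul_comm (ex (-(1 / 8 - x.n / N / 2 : ℝ) * τ)),
    e5 _ _ _ _ _ _ (mul_ne_zero (ex_ne_zero _) (ex_ne_zero _)) e4, mul_assoc]

/-- The ratio of the leading coefficients of the theta functions is `c_{mn}(z)`. -/
lemma lax_limit_eq (hpN : 2 * p < N) (z : ℂ) (x : Mode N) :
    ex (-((x.n : ℂ) * z / N)) * (if x.n ≤ p ∨ N - p ≤ x.n then 1 else 0) *
        (thetaLead (z - (x.m : ℂ) / N) (1 / 2 - x.n / N) * -(2 * Real.pi) /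
          (thetaLead (-((x.m : ℂ) / N)) (-(x.n / N : ℝ)) * thetaLead z (1 / 2))) =
      limitLaxCoeff N p z x := by
  have hN := natCast_ne_zero' N
  have hNr : (0 : ℝ) < N := by exact_mod_cast Nat.pos_of_ne_zero (NeZero.ne N)
  have hx : x.n < N := ZMod.val_lt _
  have hI := Complex.I_ne_zero
  rw [thetaLead_of_pos z (by norm_num), limitLaxCoeff]
  by_cases h0 : x.n = 0
  · rw [if_pos h0, if_pos (Or.inl (by omega)), h0, Nat.cast_zero, Nat.cast_zero, zero_div, neg_zero,
      sub_zero, thetaLead_zero, thetaLead_of_pos _ (by norm_num), zero_mul, zero_div, neg_zero,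
      ex_zero, mul_neg (Real.pi : ℂ), Complex.sin_neg]
    have h1 := sin_mode_ne_zero x h0
    have h2 : ex (-((z - (x.m : ℂ) / N + 1 / 2) / 2)) =
        ex ((x.m : ℂ) / (2 * N)) * ex (-((z + 1 / 2) / 2)) := by
      rw [← ex_add]
      apply ex_eq_of_eq
      field_simp
      ring
    have h3 := ex_ne_zero (-((z + 1 / 2) / 2))
    rw [h2]
    rw [mul_div_assoc (Real.pi : ℂ) (x.m : ℂ)] at h1 ⊢
    generalize ex (-((z + 1 / 2) / 2)) = E at *
    generalize ex ((x.m : ℂ) / (2 * N)) = F at *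
    generalize Complex.sin (Real.pi * ((x.m : ℂ) / N)) = σ at *
    field_simp
  rw [if_neg h0]
  have hpos : (0 : ℝ) < x.n := by exact_mod_cast Nat.pos_of_ne_zero h0
  rw [thetaLead_of_neg (a := -(x.n / N : ℝ)) _ (by rw [neg_lt_zero]; positivity)]
  have hquarter : ∀ w : ℂ, ex (w - 1 / 4) = -Complex.I * ex w := by
    intro w
    rw [ex_sub, ex_one_div_four, div_eq_mul_inv, Complex.inv_I, mul_comm]
  by_cases h1 : x.n ≤ p
  · have h2 : (0 : ℝ) < 1 / 2 - x.n / N := by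
      rw [sub_pos, div_lt_div_iff₀ hNr two_pos]
      have : x.n * 2 < 1 * N := by omega
      exact_mod_cast this
    rw [if_pos h1, if_pos (Or.inl h1), thetaLead_of_pos _ h2, mul_one, ← ex_add]
    have h3 : ex (-((z - (x.m : ℂ) / N + 1 / 2) / 2)) =
        ex ((x.m : ℂ) / N - 1 / 4) * ex ((-((x.m : ℂ) / N) + 1 / 2) / 2 + -((z + 1 / 2) / 2)) := by
      rw [← ex_add]
      apply ex_eq_of_eq
      ring
    rw [h3, hquarter, ex_add (-((x.n : ℂ) * z / N))]
    have := ex_ne_zero ((-((x.m : ℂ) / N) + 1 / 2) / 2 + -((z + 1 / 2) / 2))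
    generalize ex ((-((x.m : ℂ) / N) + 1 / 2) / 2 + -((z + 1 / 2) / 2)) = E at *
    field_simp
  · rw [if_neg h1]
    by_cases h2 : N - p ≤ x.n
    · have h3 : 1 / 2 - (x.n / N : ℝ) < 0 := by
        rw [sub_neg, div_lt_div_iff₀ two_pos hNr]
        have : 1 * N < x.n * 2 := by omega
        exact_mod_cast this
      rw [if_pos h2, if_pos (Or.inr h2), thetaLead_of_neg _ h3, mul_one, ← ex_add]
      have h4 : ex ((z - (x.m : ℂ) / N + 1 / 2) / 2) =
          ex (z + 1 / 2 - 1 / 4) *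
            ex ((-((x.m : ℂ) / N) + 1 / 2) / 2 + -((z + 1 / 2) / 2)) := by
        rw [← ex_add]
        apply ex_eq_of_eq
        ring
      have h5 : ex (((N : ℂ) - x.n) * z / N) = ex (-((x.n : ℂ) * z / N)) * ex z := by
        rw [← ex_add]
        apply ex_eq_of_eq
        field_simp
        ring
      have h6 : ex (1 / 2 - 1 / 4) = Complex.I := by
        rw [← ex_one_div_four]
        apply ex_eq_of_eq
        norm_num
      rw [h4, h5, add_sub_assoc, ex_add z, h6]
      have := ex_ne_zero ((-((x.m : ℂ) / N) + 1 / 2) / 2 + -((z + 1 / 2) / 2))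
      generalize ex ((-((x.m : ℂ) / N) + 1 / 2) / 2 + -((z + 1 / 2) / 2)) = E at *
      field_simp
    · rw [if_neg h2, if_neg (by tauto)]
      ring

lemma tendsto_topLax (hpN : 2 * p < N) (s : Mode N → ℂ) (z : ℂ) (i j : ZMod N) :
    Tendsto (fun τ : ℂ => topLax N τ (z + τ / 2) (unscale N p τ s) i j)
      (comap Complex.im atTop) (𝓝 (eval s (limitLax N p z i j))) := by
  have h1 : eval s (limitLax N p z i j) =
      ∑ x : Mode N, s x * sinBasis N x i j * limitLaxCoeff N p z x := by
    rw [limitLax, Matrix.of_apply, map_sum]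
    refine Finset.sum_congr rfl fun x _ => ?_
    rw [map_mul, eval_C, eval_X]
    ring
  rw [h1]
  have h2 : Tendsto (fun τ : ℂ => ∑ x : Mode N, s x * sinBasis N x i j *
      (ex (-(scalingExp N p x.1.2 : ℂ) * τ) * (ex (-((x.n : ℂ) * (z + τ / 2) / N)) *
        phi (-(((x.m : ℂ) + x.n * τ) / N)) (z + τ / 2) τ))) (comap Complex.im atTop)
      (𝓝 (∑ x : Mode N, s x * sinBasis N x i j * limitLaxCoeff N p z x)) := by
    refine tendsto_finsetSum _ fun x _ => ?_
    rw [← lax_limit_eq hpN]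
    exact (tendsto_lax_coefficient hpN z x).const_mul _
  refine h2.congr fun τ => ?_
  rw [topLax, Matrix.sum_apply]
  refine Finset.sum_congr rfl fun x _ => ?_
  rw [Matrix.smul_apply, smul_eq_mul, unscale]
  ring

/-! ### The limit of the Hamiltonian -/

/-- The inner sum of the second Eisenstein function. -/
def inverseSquareSum (u : ℂ) : ℂ := ∑' k : ℤ, 1 / (u + k) ^ 2

lemma inverseSquareSum_neg (u : ℂ) : inverseSquareSum (-u) = inverseSquareSum u := by
  rw [inverseSquareSum, inverseSquareSum, ← (Equiv.neg ℤ).tsum_eq]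
  refine tsum_congr fun k => ?_
  rw [Equiv.neg_apply, Int.cast_neg, ← neg_add, neg_sq]

/-- Lipschitz's formula, with the geometric series summed. -/
lemma inverseSquareSum_of_im_pos {u : ℂ} (hu : 0 < u.im) :
    inverseSquareSum u = -(4 * Real.pi ^ 2) * (ex u / (1 - ex u) ^ 2) := by
  have h1 := EisensteinSeries.qExpansion_identity (k := 1) le_rfl ⟨u, hu⟩
  have h2 : ‖ex u‖ < 1 := by
    rw [norm_ex, Real.exp_lt_one_iff]
    have := Real.pi_pos
    have : 0 < 2 * Real.pi * u.im := by positivity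
    linarith
  have h3 := tsum_coe_mul_geometric_of_norm_lt_one h2
  rw [← h3, inverseSquareSum]
  refine h1.trans ?_
  simp only [pow_one, Nat.factorial_one, Nat.cast_one, div_one, ex]
  congr 1
  linear_combination (4 * Real.pi ^ 2 : ℂ) * Complex.I_sq

/-- On the real line the sum is obtained as a limit from the upper half-plane. -/
lemma inverseSquareSum_ofReal {x : ℝ} (hx : Complex.sin (Real.pi * x) ≠ 0) :
    inverseSquareSum x = Real.pi ^ 2 / Complex.sin (Real.pi * x) ^ 2 := by
  have hsin : ∀ u : ℂ, Complex.sin (Real.pi * u) ≠ 0 →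
      -(4 * Real.pi ^ 2) * (ex u / (1 - ex u) ^ 2) = Real.pi ^ 2 / Complex.sin (Real.pi * u) ^ 2 := by
    intro u hu
    have h1 := two_I_sin u
    have h2 : ex u = ex (u / 2) * ex (u / 2) := by
      rw [← ex_add]
      apply ex_eq_of_eq
      ring
    have h3 := ex_ne_zero (u / 2)
    have h4 : 1 - ex u = -(2 * Complex.I * Complex.sin (Real.pi * u)) * ex (u / 2) := by
      rw [h1, h2, ex_neg]
      field_simp
      ring
    rw [h4, h2]
    have hI := Complex.I_ne_zero
    generalize Complex.sin (Real.pi * u) = σ at *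
    generalize ex (u / 2) = E at *
    field_simp
    linear_combination -4 * Complex.I_sq
  -- the series converges uniformly near the real point
  have hlim : Tendsto (fun ε : ℝ => inverseSquareSum (x + ε * Complex.I)) (𝓝[>] 0)
      (𝓝 (inverseSquareSum x)) := by
    refine tendsto_tsum_of_dominated_convergence (bound := fun k : ℤ => 1 / |(k : ℝ) + x| ^ (2 : ℝ))
      ((Real.summable_one_div_int_add_rpow x 2).mpr one_lt_two) ?_ ?_
    · intro k
      have hk : (x : ℂ) + k ≠ 0 := by
        intro h
        apply hx
        have h1 : (x : ℂ) = ((-k : ℤ) : ℂ) := by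
          push_cast
          linear_combination h
        rw [h1, mul_comm, Complex.sin_int_mul_pi]
      have hc : ContinuousAt (fun ε : ℝ => 1 / ((x : ℂ) + ε * Complex.I + k) ^ 2) 0 := by
        refine ContinuousAt.div continuousAt_const ?_ ?_
        · exact Continuous.continuousAt (by fun_prop)
        · simpa using hk
      have := hc.tendsto.mono_left (nhdsWithin_le_nhds (s := Set.Ioi 0))
      simpa using this
    · refine Eventually.of_forall fun ε k => ?_
      rw [norm_div, norm_one, norm_pow, Real.rpow_two]
      have h1 : |(k : ℝ) + x| ≤ ‖(x : ℂ) + ε * Complex.I + k‖ := by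
        have := Complex.abs_re_le_norm ((x : ℂ) + ε * Complex.I + k)
        simpa [add_comm] using this
      by_cases h0 : (k : ℝ) + x = 0
      · exfalso
        apply hx
        have h1 : (x : ℂ) = ((-k : ℤ) : ℂ) := by
          have : x = -k := by linarith
          rw [this]
          push_cast
          ring
        rw [h1, mul_comm, Complex.sin_int_mul_pi]
      · have := abs_pos.mpr h0
        gcongr
  have hlim' : Tendsto (fun ε : ℝ => inverseSquareSum (x + ε * Complex.I)) (𝓝[>] 0)
      (𝓝 (Real.pi ^ 2 / Complex.sin (Real.pi * x) ^ 2)) := by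
    have hc : ContinuousAt (fun ε : ℝ => Complex.sin (Real.pi * (x + ε * Complex.I))) 0 :=
      Continuous.continuousAt (by fun_prop)
    have hne : ∀ᶠ ε : ℝ in 𝓝[>] 0, Complex.sin (Real.pi * (x + ε * Complex.I)) ≠ 0 :=
      nhdsWithin_le_nhds (hc.eventually_ne (by simpa using hx))
    have h1 : Tendsto (fun ε : ℝ => Real.pi ^ 2 /
        Complex.sin (Real.pi * (x + ε * Complex.I)) ^ 2) (𝓝[>] 0)
        (𝓝 (Real.pi ^ 2 / Complex.sin (Real.pi * x) ^ 2)) := by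
      have h2 : Tendsto (fun ε : ℝ => Complex.sin (Real.pi * (x + ε * Complex.I))) (𝓝[>] 0)
          (𝓝 (Complex.sin (Real.pi * x))) := by
        simpa using hc.tendsto.mono_left (nhdsWithin_le_nhds (s := Set.Ioi 0))
      exact tendsto_const_nhds.div (h2.pow 2) (pow_ne_zero 2 hx)
    refine h1.congr' ?_
    filter_upwards [hne, self_mem_nhdsWithin] with ε h2 h3
    rw [inverseSquareSum_of_im_pos (by simpa using h3), hsin _ h2]
  exact tendsto_nhds_unique hlim hlim'

lemma summable_exp_natAbs : Summable fun n : ℤ => Real.exp (-(2 * Real.pi * (n.natAbs - 2))) := by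
  have h1 : Summable fun n : ℕ => Real.exp (-(2 * Real.pi * (n - 2))) := by
    have h2 : Real.exp (-(2 * Real.pi)) < 1 := by
      rw [Real.exp_lt_one_iff]
      have := Real.pi_pos
      linarith
    have h3 := (summable_geometric_of_lt_one (Real.exp_pos _).le h2).mul_left
      (Real.exp (2 * Real.pi * 2))
    refine h3.congr fun n => ?_
    rw [← Real.exp_nat_mul, ← Real.exp_add]
    congr 1
    ring
  exact Summable.of_nat_of_neg (by simpa using h1) (by simpa using h1)

/-- One term of the second Eisenstein function at `c + v τ`, multiplied by `q^(-γ)`, `γ ≤ v`. -/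
lemma tendsto_inverseSquareSum (c : ℂ) {v γ : ℝ} (hv : 0 < v) (hγ : γ ≤ v) :
    Tendsto (fun τ : ℂ => ex (-(γ : ℂ) * τ) * inverseSquareSum (c + v * τ))
      (comap Complex.im atTop)
      (𝓝 (if v - γ = 0 then -(4 * Real.pi ^ 2) * ex c else 0)) := by
  have h1 := tendsto_ex_ofReal_mul (sub_nonneg.mpr hγ)
  have h2 := tendsto_ex_ofReal_mul hv.le
  rw [if_neg hv.ne'] at h2
  have h3 : Tendsto (fun τ : ℂ => -(4 * Real.pi ^ 2) * ex c * ex ((v - γ : ℝ) * τ) /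
      (1 - ex c * ex (v * τ)) ^ 2) (comap Complex.im atTop)
      (𝓝 (-(4 * Real.pi ^ 2) * ex c * (if v - γ = 0 then 1 else 0) / (1 - ex c * 0) ^ 2)) :=
    (h1.const_mul _).div (((h2.const_mul _).const_sub 1).pow 2) (by simp)
  have h4 : -(4 * Real.pi ^ 2 : ℂ) * ex c * (if v - γ = 0 then 1 else 0) / (1 - ex c * 0) ^ 2 =
      if v - γ = 0 then -(4 * Real.pi ^ 2) * ex c else 0 := by
    split_ifs <;> simp
  rw [h4] at h3
  refine h3.congr' ?_
  have hev : ∀ᶠ τ : ℂ in comap Complex.im atTop, 0 < (c + v * τ).im := by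
    have := (tendsto_comap (f := Complex.im)).eventually (eventually_gt_atTop (-c.im / v))
    filter_upwards [this] with τ hτ
    rw [div_lt_iff₀ hv] at hτ
    rw [Complex.add_im, Complex.im_ofReal_mul]
    linarith
  filter_upwards [hev] with τ hτ
  have e1 : ex ((v - γ : ℝ) * τ) = ex (-(γ : ℂ) * τ) * ex (v * τ) := by
    rw [← ex_add]
    apply ex_eq_of_eq
    push_cast
    ring
  rw [inverseSquareSum_of_im_pos hτ, ex_add, e1]
  ring

/-- A bound of the terms of `E₂`, uniform for `Im τ ≥ T`. -/
lemma norm_inverseSquareSum_le {c : ℂ} (hc : c.im = 0) {v γ T : ℝ} (hγ : γ ≤ v) (hT : 1 ≤ T)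
    (hvT : 1 ≤ v * T) {τ : ℂ} (hτ : T ≤ τ.im) :
    ‖ex (-(γ : ℂ) * τ) * inverseSquareSum (c + v * τ)‖ ≤
      16 * Real.pi ^ 2 * Real.exp (-(2 * Real.pi * (v - γ))) := by
  have hpi := Real.pi_gt_three
  have hv : 0 < v := by
    by_contra h
    nlinarith
  have him : (c + v * τ).im = v * τ.im := by
    rw [Complex.add_im, Complex.im_ofReal_mul, hc, zero_add]
  have h1 : 1 ≤ v * τ.im := hvT.trans (by gcongr)
  have hsmall : ‖ex (c + v * τ)‖ ≤ 1 / 2 := by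
    rw [norm_ex, him, Real.exp_neg, one_div]
    gcongr
    have := Real.add_one_le_exp (2 * Real.pi * (v * τ.im))
    nlinarith
  have hden : 1 / 2 ≤ ‖1 - ex (c + v * τ)‖ := by
    have := norm_sub_norm_le 1 (ex (c + v * τ))
    rw [norm_one] at this
    linarith
  have e1 : ‖ex (-(γ : ℂ) * τ)‖ * ‖ex (c + v * τ)‖ = Real.exp (-(2 * Real.pi * ((v - γ) * τ.im))) := by
    rw [norm_ex, norm_ex, him, ← Real.exp_add, ← Complex.ofReal_neg, Complex.im_ofReal_mul]
    congr 1
    ring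
  have e2 : Real.exp (-(2 * Real.pi * ((v - γ) * τ.im))) ≤ Real.exp (-(2 * Real.pi * (v - γ))) := by
    rw [Real.exp_le_exp, neg_le_neg_iff]
    have : (v - γ) * 1 ≤ (v - γ) * τ.im :=
      mul_le_mul_of_nonneg_left (hT.trans hτ) (sub_nonneg.mpr hγ)
    rw [mul_one] at this
    gcongr
  have e3 : ‖(-(4 * Real.pi ^ 2) : ℂ)‖ = 4 * Real.pi ^ 2 := by
    rw [norm_neg, norm_mul, norm_pow, Complex.norm_real, Real.norm_of_nonneg Real.pi_pos.le]
    simp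
  rw [inverseSquareSum_of_im_pos (by rw [him]; linarith), norm_mul, norm_mul, norm_div, norm_pow, e3]
  have e4 : ‖ex (-(γ : ℂ) * τ)‖ * (4 * Real.pi ^ 2 * (‖ex (c + v * τ)‖ /
      ‖1 - ex (c + v * τ)‖ ^ 2)) = 4 * Real.pi ^ 2 *
      (Real.exp (-(2 * Real.pi * ((v - γ) * τ.im))) / ‖1 - ex (c + v * τ)‖ ^ 2) := by
    rw [← e1]
    ring
  rw [e4]
  have e5 : Real.exp (-(2 * Real.pi * ((v - γ) * τ.im))) / ‖1 - ex (c + v * τ)‖ ^ 2 ≤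
      Real.exp (-(2 * Real.pi * (v - γ))) / (1 / 2) ^ 2 := by gcongr
  calc _ ≤ 4 * Real.pi ^ 2 * (Real.exp (-(2 * Real.pi * (v - γ))) / (1 / 2) ^ 2) := by gcongr
    _ = _ := by ring

lemma eisensteinE2_eq (z τ : ℂ) : eisensteinE2 z τ = ∑' n : ℤ, inverseSquareSum (z + n * τ) :=
  tsum_congr fun n => tsum_congr fun k => by rw [add_right_comm]

variable (p) in
/-- The limit of `q^(-2 g(n)) E₂((m + n τ)/N)`. -/
def eisensteinLimit (x : Mode N) : ℂ :=
  if x.n = 0 then Real.pi ^ 2 / Complex.sin (Real.pi * x.m / N) ^ 2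
  else if x.n ≤ p then -(4 * Real.pi ^ 2) * ex ((x.m : ℂ) / N)
  else if N - p ≤ x.n then -(4 * Real.pi ^ 2) * ex (-((x.m : ℂ) / N))
  else 0

variable (p) in
/-- The limit of the `k`-th term of `q^(-2 g(n)) E₂((m + n τ)/N)`: only the terms `k = 0` and
`k = -1` can survive. -/
def eisensteinTermLimit (x : Mode N) (k : ℤ) : ℂ :=
  if x.n = 0 then if k = 0 then Real.pi ^ 2 / Complex.sin (Real.pi * x.m / N) ^ 2 else 0
  else if k = 0 then if x.n ≤ p then -(4 * Real.pi ^ 2) * ex ((x.m : ℂ) / N) else 0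
  else if k = -1 then if N - p ≤ x.n then -(4 * Real.pi ^ 2) * ex (-((x.m : ℂ) / N)) else 0
  else 0

lemma tsum_eisensteinTermLimit (hpN : 2 * p < N) (x : Mode N) :
    ∑' k, eisensteinTermLimit p x k = eisensteinLimit p x := by
  rw [tsum_eq_sum (s := {0, -1})]
  · rw [Finset.sum_pair (by norm_num)]
    simp only [eisensteinTermLimit, eisensteinLimit, if_true,
      if_neg (show ¬ (-1 : ℤ) = 0 by norm_num)]
    split_ifs <;> first | omega | simp
  · intro k hk
    simp only [Finset.mem_insert, Finset.mem_singleton, not_or] at hk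
    simp [eisensteinTermLimit, hk]

/-- The `k`-th term of `E₂((m + n τ)/N)`, taken at `±` its argument, is at height `d / N` with an
integer `d > 0`, and it contributes to the limit iff `d / N = 2 g(n)`. The term `n = k = 0` is the
only one at height zero. -/
lemma eisensteinTerm_cases (hpN : 2 * p < N) (x : Mode N) (k : ℤ) (hne : x.n ≠ 0 ∨ k ≠ 0) :
    ∃ (ε : ℤ) (d : ℕ), (ε = 1 ∨ ε = -1) ∧ ε * (x.n + k * N) = d ∧ 0 < d ∧
      shiftLen N p x.1.2 ≤ d ∧ k.natAbs * N ≤ d + N ∧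
      eisensteinTermLimit p x k = if d = shiftLen N p x.1.2 then
        -(4 * Real.pi ^ 2) * ex (ε * ((x.m : ℂ) / N)) else 0 := by
  have hx : x.n < N := ZMod.val_lt _
  have hs : shiftLen N p x.1.2 = min (min x.n (N - x.n)) p := rfl
  rcases lt_or_ge k 0 with h | h
  · obtain ⟨l, rfl⟩ : ∃ l : ℕ, k = -((l : ℤ) + 1) := ⟨(-k - 1).toNat, by omega⟩
    refine ⟨-1, l * N + (N - x.n), Or.inr rfl, ?_, by omega, by
      have : 0 ≤ l * N := Nat.zero_le _
      omega, ?_, ?_⟩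
    · push_cast [hx.le]
      ring
    · have : (-((l : ℤ) + 1)).natAbs = l + 1 := by omega
      rw [this, add_mul]
      omega
    · have hk0 : ¬ (-((l : ℤ) + 1)) = 0 := by omega
      simp only [eisensteinTermLimit, hk0, if_false]
      have hl : l ≠ 0 → N ≤ l * N := fun h => Nat.le_mul_of_pos_left _ (by omega)
      rcases eq_or_ne l 0 with rfl | h0
      · have h1 : (-(((0 : ℕ) : ℤ) + 1)) = -1 := by norm_num
        rw [h1, if_pos rfl]
        push_cast
        rw [neg_one_mul]
        split_ifs <;> first | rfl | (exfalso; omega)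
      · have h1 : ¬ (-((l : ℤ) + 1)) = -1 := by omega
        have := hl h0
        have h2 : ¬ l * N + (N - x.n) = shiftLen N p x.1.2 := by omega
        rw [if_neg h1, if_neg h2]
        simp
  · obtain ⟨l, rfl⟩ : ∃ l : ℕ, k = l := ⟨k.toNat, by omega⟩
    have hN0 : 0 < N := Nat.pos_of_ne_zero (NeZero.ne N)
    have hl : l ≠ 0 → N ≤ l * N := fun h => Nat.le_mul_of_pos_left _ (by omega)
    refine ⟨1, l * N + x.n, Or.inl rfl, by push_cast; ring, ?_, ?_, ?_, ?_⟩
    · rcases eq_or_ne l 0 with rfl | h0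
      · simp at hne
        omega
      · have := hl h0
        omega
    · omega
    · rw [Int.natAbs_natCast]
      omega
    · have hk1 : ¬ (l : ℤ) = -1 := by omega
      simp only [eisensteinTermLimit, hk1, if_false]
      rcases eq_or_ne l 0 with rfl | h0
      · simp at hne
        simp only [Nat.cast_zero, if_true, if_neg hne, Int.cast_one, one_mul]
        split_ifs <;> first | rfl | (exfalso; omega)
      · have := hl h0
        have h1 : ¬ (l : ℤ) = 0 := by omega
        have h2 : ¬ l * N + x.n = shiftLen N p x.1.2 := by omega
        rw [if_neg h1, if_neg h1, if_neg h2]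
        simp

/-- Asymptotics of the coefficients of the Hamiltonian. -/
lemma tendsto_eisensteinE2 (hpN : 2 * p < N) (x : Mode N) :
    Tendsto (fun τ : ℂ => ex (-(2 * scalingExp N p x.1.2 : ℝ) * τ) *
      eisensteinE2 (((x.m : ℂ) + x.n * τ) / N) τ) (comap Complex.im atTop)
      (𝓝 (eisensteinLimit p x)) := by
  have hN := natCast_ne_zero' N
  have hN0 : 0 < N := Nat.pos_of_ne_zero (NeZero.ne N)
  have hNr : (0 : ℝ) < N := by exact_mod_cast hN0
  have hx : x.n < N := ZMod.val_lt _
  set σ := shiftLen N p x.1.2 with hσ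
  have hg : 2 * scalingExp N p x.1.2 = σ / N := by
    rw [scalingExp_eq hpN, ← hσ]
    field_simp
  rw [← tsum_eisensteinTermLimit hpN, hg]
  simp_rw [eisensteinE2_eq, ← tsum_mul_left]
  set P : ℂ := Real.pi ^ 2 / Complex.sin (Real.pi * x.m / N) ^ 2 with hP
  -- the real term of a mode with `n = 0` does not depend on `τ`
  have hreal : x.n = 0 → ∀ τ : ℂ, ex (-(σ / N : ℝ) * τ) *
      inverseSquareSum (((x.m : ℂ) + x.n * τ) / N + (0 : ℤ) * τ) = P := by
    intro h τ
    have h1 : σ = 0 := by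
      have : x.1.2 = 0 := by rw [← mode_natCast_n, h, Nat.cast_zero]
      rw [hσ, this, shiftLen_zero]
    have h2 := sin_mode_ne_zero x h
    have h3 : ((x.m : ℂ) + x.n * τ) / N + (0 : ℤ) * τ = ((x.m / N : ℝ) : ℂ) := by
      rw [h]
      push_cast
      ring
    have h4 : (Real.pi : ℂ) * x.m / N = Real.pi * ((x.m / N : ℝ) : ℂ) := by
      push_cast
      ring
    rw [h4] at h2
    rw [h1, h3, inverseSquareSum_ofReal h2, hP, h4]
    simp [ex_zero]
  -- all other terms are of the form `c + v τ` with `v > 0`, up to the sign of the argument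
  have hterm : ∀ (ε : ℤ) (d : ℕ) (k : ℤ), (ε = 1 ∨ ε = -1) → ε * (x.n + k * N) = d → ∀ τ : ℂ,
      inverseSquareSum (((x.m : ℂ) + x.n * τ) / N + k * τ) =
        inverseSquareSum (ε * ((x.m : ℂ) / N) + (d / N : ℝ) * τ) := by
    intro ε d k hε h τ
    have h1 : (ε : ℂ) * (x.n + k * N) = d := by exact_mod_cast h
    have h2 : (ε : ℂ) * (((x.m : ℂ) + x.n * τ) / N + k * τ) =
        ε * ((x.m : ℂ) / N) + (d / N : ℝ) * τ := by
      push_cast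
      rw [← h1]
      field_simp
      ring
    rw [← h2]
    rcases hε with rfl | rfl
    · simp
    · push_cast
      rw [neg_one_mul, inverseSquareSum_neg]
  refine tendsto_tsum_of_dominated_convergence
    (f := fun (τ : ℂ) (k : ℤ) => ex (-(σ / N : ℝ) * τ) *
      inverseSquareSum (((x.m : ℂ) + x.n * τ) / N + k * τ))
    (bound := fun k : ℤ => 16 * Real.pi ^ 2 * Real.exp (-(2 * Real.pi * (k.natAbs - 2))) +
      if k = 0 then ‖P‖ else 0)
    ((summable_exp_natAbs.mul_left _).add ((hasSum_ite_eq 0 ‖P‖).summable)) ?_ ?_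
  · intro k
    by_cases hne : x.n ≠ 0 ∨ k ≠ 0
    · obtain ⟨ε, d, hε, hd, hd0, hσd, -, hlim⟩ := eisensteinTerm_cases hpN x k hne
      have h1 := tendsto_inverseSquareSum (ε * ((x.m : ℂ) / N)) (v := d / N) (γ := σ / N)
        (by positivity) (by gcongr)
      have h2 : ((d : ℝ) / N - σ / N = 0) ↔ d = σ := by
        rw [sub_eq_zero, div_left_inj' hNr.ne']
        norm_cast
      simp only [h2] at h1
      rw [hlim]
      refine h1.congr fun τ => ?_
      rw [hterm ε d k hε hd τ]
    · push Not at hne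
      obtain ⟨h1, rfl⟩ := hne
      have h2 : eisensteinTermLimit p x 0 = P := by
        rw [eisensteinTermLimit, if_pos h1, if_pos rfl]
      rw [h2]
      exact tendsto_const_nhds.congr fun τ => (hreal h1 τ).symm
  · have hev : ∀ᶠ τ : ℂ in comap Complex.im atTop, (N : ℝ) ≤ τ.im :=
      tendsto_comap.eventually (eventually_ge_atTop _)
    filter_upwards [hev] with τ hτ k
    by_cases hne : x.n ≠ 0 ∨ k ≠ 0
    · obtain ⟨ε, d, hε, hd, hd0, hσd, hkd, -⟩ := eisensteinTerm_cases hpN x k hne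
      have him : ((ε : ℂ) * ((x.m : ℂ) / N)).im = 0 := by
        rcases hε with rfl | rfl <;> simp [Complex.div_natCast_im]
      have h1 : (1 : ℝ) ≤ d := by exact_mod_cast hd0
      have h2 : (1 : ℝ) ≤ N := by exact_mod_cast hN0
      have h3 := norm_inverseSquareSum_le him (v := d / N) (γ := σ / N) (by gcongr) h2
        (by rwa [div_mul_cancel₀ _ hNr.ne']) hτ
      rw [← hterm ε d k hε hd τ] at h3
      refine h3.trans (le_add_of_le_of_nonneg ?_ (by split_ifs <;> positivity))
      have h4 : (k.natAbs : ℝ) - 2 ≤ d / N - σ / N := by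
        have h5 : (k.natAbs : ℝ) * N ≤ d + N := by exact_mod_cast hkd
        have h6 : (σ : ℝ) ≤ N := by
          have := shiftLen_le (p := p) x.1.2
          exact_mod_cast (by omega : σ ≤ N)
        rw [← sub_div, le_div_iff₀ hNr]
        linarith
      gcongr
    · push Not at hne
      obtain ⟨h1, rfl⟩ := hne
      rw [hreal h1, if_pos rfl]
      exact le_add_of_nonneg_left (by positivity)

lemma trace_sinBasis_mul_eq_zero {x y : Mode N} (h : x.1 ≠ -y.1) :
    Matrix.trace (sinBasis N x * sinBasis N y) = 0 := by
  simp only [Matrix.trace, Matrix.diag_apply, Matrix.mul_apply, sinBasis_apply]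
  by_cases hn : x.1.2 = -y.1.2
  · have hm : x.1.1 + y.1.1 ≠ 0 := fun h' => h (Prod.ext (eq_neg_of_add_eq_zero_left h') hn)
    have h1 : ∀ i j : ZMod N, (if j - i = x.1.2 then
        ex ((x.m : ℂ) * x.n / (2 * N)) * chr N (i * x.1.1) else 0) * (if i - j = y.1.2 then
        ex ((y.m : ℂ) * y.n / (2 * N)) * chr N (j * y.1.1) else 0) =
        if j = i + x.1.2 then ex ((x.m : ℂ) * x.n / (2 * N)) * ex ((y.m : ℂ) * y.n / (2 * N)) *
          chr N (x.1.2 * y.1.1) * chr N ((x.1.1 + y.1.1) * i) else 0 := by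
      intro i j
      by_cases hj : j = i + x.1.2
      · subst hj
        rw [if_pos (by ring), if_pos (by rw [hn]; ring), if_pos rfl]
        have : chr N (i * x.1.1) * chr N ((i + x.1.2) * y.1.1) =
            chr N (x.1.2 * y.1.1) * chr N ((x.1.1 + y.1.1) * i) := by
          rw [← AddChar.map_add_eq_mul, ← AddChar.map_add_eq_mul]
          congr 1
          ring
        linear_combination ex ((x.m : ℂ) * x.n / (2 * N)) * ex ((y.m : ℂ) * y.n / (2 * N)) * this
      · rw [if_neg (fun h' => hj (by rw [← h']; ring)), if_neg hj, zero_mul]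
    simp only [h1, Finset.sum_ite_eq', Finset.mem_univ, if_true]
    rw [← Finset.mul_sum, chr_sum, if_neg hm, mul_zero]
  · refine Finset.sum_eq_zero fun i _ => Finset.sum_eq_zero fun j _ => ?_
    by_cases h1 : j - i = x.1.2
    · rw [if_neg (c := i - j = y.1.2), mul_zero]
      intro h2
      apply hn
      rw [← h1, ← h2]
      ring
    · rw [if_neg h1, zero_mul]

/-- For opposite modes the product of the limiting Lax coefficients is minus the limit of the
coefficient of the Hamiltonian. -/
lemma limitLaxCoeff_mul (hpN : 2 * p < N) {x y : Mode N} (h : x.1 = -y.1) :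
    limitLaxCoeff N p 0 x * limitLaxCoeff N p 0 y = -eisensteinLimit p y := by
  have hN := natCast_ne_zero' N
  have hyn : y.n < N := ZMod.val_lt _
  have hym : y.m < N := ZMod.val_lt _
  have hn : x.n = if y.n = 0 then 0 else N - y.n := by
    have : x.n = (-y.1.2).val := by rw [Mode.n, h]; rfl
    rw [this, ZMod.neg_val]
    have h2 : y.1.2 = 0 ↔ y.n = 0 := (ZMod.val_eq_zero _).symm
    simp only [h2]
    rfl
  have hm : x.m = if y.m = 0 then 0 else N - y.m := by
    have : x.m = (-y.1.1).val := by rw [Mode.m, h]; rfl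
    rw [this, ZMod.neg_val]
    have h2 : y.1.1 = 0 ↔ y.m = 0 := (ZMod.val_eq_zero _).symm
    simp only [h2]
    rfl
  have hex : ex ((x.m : ℂ) / N) = ex (-((y.m : ℂ) / N)) := by
    rw [← chr_natCast, mode_natCast_m, ex_neg, ← chr_natCast, mode_natCast_m, h, Prod.fst_neg,
      AddChar.map_neg_eq_inv]
  have hI := Complex.I_sq
  simp only [limitLaxCoeff, eisensteinLimit, mul_zero, zero_div, neg_zero, zero_add]
  by_cases h0 : y.n = 0
  · have hy0 : y.m ≠ 0 := by
      intro h1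
      apply y.2
      refine Prod.ext ?_ ?_
      · rw [← mode_natCast_m, h1, Nat.cast_zero]
        rfl
      · rw [← mode_natCast_n, h0, Nat.cast_zero]
        rfl
    rw [if_pos h0] at hn
    rw [if_neg hy0] at hm
    rw [if_pos hn, if_pos h0, if_pos h0, hm, Nat.cast_sub hym.le]
    have h1 := sin_mode_ne_zero y h0
    have h2 : Complex.sin (Real.pi * ((N : ℂ) - y.m) / N) = Complex.sin (Real.pi * y.m / N) := by
      rw [← Complex.sin_pi_sub]
      congr 1
      field_simp
      ring
    have h3 : ex (((N : ℂ) - y.m) / (2 * N)) * ex ((y.m : ℂ) / (2 * N)) = -1 := by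
      have e1 : ((N : ℂ) - y.m) / (2 * N) + (y.m : ℂ) / (2 * N) = 1 / 4 + 1 / 4 := by
        field_simp
        ring
      rw [← ex_add, e1, ex_add, ex_one_div_four, Complex.I_mul_I]
    rw [h2]
    generalize Complex.sin (Real.pi * y.m / N) = σ at *
    rw [neg_mul_neg, div_mul_div_comm, mul_mul_mul_comm, h3]
    ring
  · rw [if_neg h0] at hn
    rw [if_neg (by omega), if_neg h0, if_neg h0]
    by_cases h1 : y.n ≤ p
    · rw [if_neg (by omega), if_pos (by omega), if_pos h1, if_pos h1, ex_zero]
      linear_combination (-4 * Real.pi ^ 2 * ex ((y.m : ℂ) / N)) * hI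
    · rw [if_neg h1, if_neg h1]
      by_cases h2 : N - p ≤ y.n
      · rw [if_pos (by omega), if_pos h2, if_pos h2, ex_zero, hex]
        linear_combination (-4 * Real.pi ^ 2 * ex (-((y.m : ℂ) / N))) * hI
      · rw [if_neg h2, if_neg h2, mul_zero, neg_zero]

/-- Both sides are sums over pairs of opposite modes, on which the limits of the coefficients agree
by `limitLaxCoeff_mul`. -/
lemma tendsto_topHamiltonian (hpN : 2 * p < N) (s : Mode N → ℂ) :
    Tendsto (fun τ : ℂ => topHamiltonian N τ (unscale N p τ s)) (comap Complex.im atTop)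
      (𝓝 (eval s (C (1 / 2) * Matrix.trace (limitLax N p 0 ^ 2)))) := by
  have hlim : eval s (C (1 / 2) * Matrix.trace (limitLax N p 0 ^ 2)) =
      -(1 / 2) * ∑ x : Mode N, ∑ y : Mode N, s x * s y *
        Matrix.trace (sinBasis N x * sinBasis N y) * eisensteinLimit p y := by
    have h1 : (limitLax N p 0).map (eval s) =
        ∑ x : Mode N, (s x * limitLaxCoeff N p 0 x) • sinBasis N x := by
      ext i j
      rw [Matrix.map_apply, limitLax, Matrix.of_apply, map_sum, Matrix.sum_apply]
      refine Finset.sum_congr rfl fun x _ => ?_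
      rw [map_mul, eval_C, eval_X, Matrix.smul_apply, smul_eq_mul]
      ring
    have h2 : eval s (Matrix.trace (limitLax N p 0 ^ 2)) =
        Matrix.trace ((limitLax N p 0).map (eval s) * (limitLax N p 0).map (eval s)) := by
      rw [← Matrix.map_mul, sq, Matrix.trace, Matrix.trace, map_sum]
      rfl
    rw [map_mul, eval_C, h2, h1, Finset.sum_mul_sum, Matrix.trace_sum, Finset.mul_sum,
      Finset.mul_sum]
    refine Finset.sum_congr rfl fun x _ => ?_
    rw [Matrix.trace_sum, Finset.mul_sum, Finset.mul_sum]
    refine Finset.sum_congr rfl fun y _ => ?_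
    rw [Matrix.smul_mul, Matrix.mul_smul, Matrix.trace_smul, Matrix.trace_smul, smul_eq_mul,
      smul_eq_mul]
    by_cases h : x.1 = -y.1
    · linear_combination (1 / 2 * s x * s y * Matrix.trace (sinBasis N x * sinBasis N y)) *
        limitLaxCoeff_mul hpN h
    · rw [trace_sinBasis_mul_eq_zero h]
      ring
  rw [hlim]
  have h3 : Tendsto (fun τ : ℂ => -(1 / 2) * ∑ x : Mode N, ∑ y : Mode N, s x * s y *
        Matrix.trace (sinBasis N x * sinBasis N y) * (ex (-(2 * scalingExp N p y.1.2 : ℝ) * τ) *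
          eisensteinE2 (((y.m : ℂ) + y.n * τ) / N) τ)) (comap Complex.im atTop)
      (𝓝 (-(1 / 2) * ∑ x : Mode N, ∑ y : Mode N, s x * s y *
        Matrix.trace (sinBasis N x * sinBasis N y) * eisensteinLimit p y)) :=
    (tendsto_finsetSum _ fun x _ => tendsto_finsetSum _ fun y _ =>
      (tendsto_eisensteinE2 hpN y).const_mul _).const_mul _
  refine h3.congr fun τ => ?_
  rw [topHamiltonian, Finset.sum_mul_sum, Matrix.trace_sum]
  congr 1
  refine Finset.sum_congr rfl fun x _ => ?_
  rw [Matrix.trace_sum]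
  refine Finset.sum_congr rfl fun y _ => ?_
  rw [Matrix.smul_mul, Matrix.mul_smul, Matrix.trace_smul, Matrix.trace_smul, smul_eq_mul,
    smul_eq_mul]
  by_cases h : x.1 = -y.1
  · have h4 : scalingExp N p x.1.2 = scalingExp N p y.1.2 := by
      rw [h, Prod.snd_neg, scalingExp_eq hpN, scalingExp_eq hpN, shiftLen_neg]
    have h5 : ex (-(2 * scalingExp N p y.1.2 : ℝ) * τ) =
        ex (-(scalingExp N p y.1.2 : ℂ) * τ) * ex (-(scalingExp N p y.1.2 : ℂ) * τ) := by
      rw [← ex_add]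
      apply ex_eq_of_eq
      push_cast
      ring
    rw [unscale, unscale, h4, h5]
    ring
  · rw [trace_sinBasis_mul_eq_zero h]
    ring

end EllipticTop

end

theorem mainTheorem1 (N p : ℕ) [NeZero N] (hp : 0 < p) (hpN : 2 * p < N)
    (hcop : Nat.Coprime N p) :
    -- the scaled Poisson tensor and Lax matrix of the elliptic top have the stated limits
    (∀ (s : Mode N → ℂ) (x y : Mode N),
      Tendsto (fun τ : ℂ => scaledTensor N p τ s x y) (comap Complex.im atTop)
        (𝓝 (eval s (limitTensor N p x y)))) ∧
    (∀ (s : Mode N → ℂ) (z : ℂ) (i j : ZMod N),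
      Tendsto (fun τ : ℂ => topLax N τ (z + τ / 2) (unscale N p τ s) i j)
        (comap Complex.im atTop) (𝓝 (eval s (limitLax N p z i j)))) ∧
    ∃ H : ℕ → ℤ → MvPolynomial (Mode N) ℂ,
      -- the `H k j` are the Fourier coefficients of the traces of powers of the Lax matrix
      (∀ (k : ℕ) (z : ℂ), Matrix.trace (limitLax N p z ^ k) =
        ∑ j ∈ Finset.Icc (-((k * p / N : ℕ) : ℤ)) ((k * p / N : ℕ) : ℤ),
          C (ex (j * z)) * H k j) ∧
      -- the limiting Hamiltonian
      (∀ s : Mode N → ℂ,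
        Tendsto (fun τ : ℂ => topHamiltonian N τ (unscale N p τ s)) (comap Complex.im atTop)
          (𝓝 (eval s (C (1 / 2) * H 2 0)))) ∧
      (∀ z : ℂ, C (1 / 2) * H 2 0 = C (1 / 2) * Matrix.trace (limitLax N p z ^ 2)) ∧
      -- all coefficients are in involution
      (∀ (k k' : ℕ) (j j' : ℤ), j.natAbs ≤ k * p / N → j'.natAbs ≤ k' * p / N →
        poissonBracket (limitTensor N p) (H k j) (H k' j') = 0) ∧
      -- Liouville integrability of the limiting system by means of `p (N - 1)` coefficients
      (hamiltonianLabels N p).card = p * (N - 1) ∧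
      (∀ a ∈ hamiltonianLabels N p, a.2.natAbs ≤ a.1 * p / N) ∧
      IsLiouvilleIntegrable (limitTensor N p) (C (1 / 2) * H 2 0)
        (fun a : hamiltonianLabels N p => H a.1.1 a.1.2) ∧
      -- the subalgebra `𝒮₂`: it is Poisson, contains the coefficients, its generic symplectic leaf
      -- has dimension `2 p (N - 1)`, and the Hamiltonians are independent on that leaf
      (∀ f ∈ bandAlgebra N p, ∀ g ∈ bandAlgebra N p,
        poissonBracket (limitTensor N p) f g ∈ bandAlgebra N p) ∧
      (∀ (k : ℕ) (j : ℤ), j.natAbs ≤ k * p / N → H k j ∈ bandAlgebra N p) ∧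
      Generically fun s : Mode N → ℂ =>
        (bracketMatrix (limitTensor N p) (bandCoord N p) s).rank = 2 * p * (N - 1) ∧
        LinearIndependent ℂ fun a : hamiltonianLabels N p =>
          hamiltonianVector (limitTensor N p) (bandCoord N p) (H a.1.1 a.1.2) s := by
  have hfloor : ∀ k : ℕ, ∀ j : ℤ, (k, j) ∈ hamiltonianLabels N p → j.natAbs ≤ k * p / N := by
    intro k j hkj
    obtain ⟨h2, -, h3⟩ := (mem_hamiltonianLabels_iff hp hcop (k, j)).mp hkj
    rw [Nat.le_div_iff_mul_le (Nat.pos_of_ne_zero (NeZero.ne N)), mul_comm k]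
    exact h3.le.trans (Nat.mul_le_mul_left p (Nat.sub_le k 1))
  -- `⌊2p/N⌋ = 0`, so that the trace of the square has only one Fourier coefficient
  have hH : ∀ z : ℂ, laxHamiltonian N p 2 0 = Matrix.trace (limitLax N p z ^ 2) := by
    intro z
    rw [trace_limitLax_pow hpN, Nat.div_eq_of_lt hpN]
    simp [ex_zero]
  have hinv : ∀ (k : ℕ) (j : ℤ), poissonBracket (limitTensor N p)
      (C (1 / 2) * laxHamiltonian N p 2 0) (laxHamiltonian N p k j) = 0 := fun k j => by
    rw [poissonBracket_C_mul_left, involution hpN, mul_zero]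
  obtain ⟨D, hD, hgen⟩ := generic_rank_and_independence hp hpN hcop
  refine ⟨tendsto_scaledTensor hpN, tendsto_topLax hpN, laxHamiltonian N p,
    trace_limitLax_pow hpN, fun s => ?_, fun z => by rw [← hH z],
    fun k k' j j' _ _ => involution hpN k k' j j', card_hamiltonianLabels hp hcop,
    fun a ha => hfloor a.1 a.2 ha,
    ⟨isPoissonTensor_limitTensor hpN, fun a => hinv _ _, fun a b => involution hpN _ _ _ _,
      D, hD, fun s hs => ⟨?_, (hgen s hs).2.1⟩⟩,
    fun f hf g hg => bracket_mem_bandAlgebra hpN hf hg,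
    fun k j _ => laxHamiltonian_mem_bandAlgebra hpN k j,
    D, hD, fun s hs => ⟨?_, (hgen s hs).2.2.2⟩⟩
  · rw [hH 0]
    exact tendsto_topHamiltonian hpN s
  · rw [Fintype.card_coe, card_hamiltonianLabels hp hcop]
    exact (hgen s hs).1
  · rw [mul_assoc]
    exact (hgen s hs).2.2.1
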